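/- Let $(Z,\mathfrak Z)$ be a measurable space, $\nu$ a $\sigma$-finite measure on it, and let $\eta$ be a Poisson point process on $Z$ with intensity $\nu$, defined on a probability space $(\Omega,\mathfrak O,\mathbb P)$ that also supports a standard Gaussian random variable $N$ independent of $\eta$. Let $\mathfrak W=\sigma(\eta)$. For $f\in L^2(\nu^2)$, let $I_2(f)$ be the double Wiener--Itô Poisson integral of $f$, that is, the $L^2(\mathbb P)$-continuous extension from $L^1(\nu^2)\cap L^2(\nu^2)$ to $L^2(\nu^2)$ of $$I_2(f)=\int f\,d\eta^{(2)}-\iint f(x,y)\,\nu(dy)\,\eta(dx)-\iint f(x,y)\,\eta(dy)\,\nu(dx)+\int f\,d\nu^2,$$ where $\eta^{(2)}$ is the second factorial measure of $\eta$; it satisfies $\mathbb E\,I_2(f)^2=2\|f_\sigma\|^2_{L^2(\nu^2)}$, where $f_\sigma(x,y)=\tfrac12(f(x,y)+f(y,x))$ is the symmetrization of $f$. For $f,g\in L^2(\nu^2)$ and $h\in L^2(\nu)$ write $$(f\star_1^1 g)(x_1,x_2)=\int f(y,x_1)g(y,x_2)\,\nu(dy),\quad (f\star_2^1 g)(x)=\int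 f(y,x)g(y,x)\,\nu(dy),\quad (f\star_1^1 h)(x)=\int f(y,x)h(y)\,\nu(dy).$$ **Theorem.** Let $(g_n)_{n\in\mathbb N}$ be a sequence of symmetric functions in $L^2(\nu^2)$, let $F_n=I_2(g_n)$, and let $(\hat g_n)\subset L^2(\nu^2)$ be such that, for every $n$, the symmetrization of $\hat g_n$ is $g_n$. Let $g_{2,\infty}\in L^2(\nu^2)$ and $g_{0,\infty}\in\mathbb R$, and assume that, as $n\to\infty$, 1. $g_n\star_1^1\hat g_n\to g_{2,\infty}$ in $L^2(\nu^2)$, and $\nu^2(g_n\hat g_n)\to g_{0,\infty}$; 2. $g_n\to0$ in $L^4(\nu^2)$; 3. $g_n\star_2^1 g_n\to0$ in $L^2(\nu)$; 4. $\hat g_n\star_1^1 h\to0$ in $L^2(\nu)$ for every $h\in L^2(\nu)$. Assume that $S^2:=2\bigl(I_2(g_{2,\infty})+g_{0,\infty}\bigr)\ge0$ almost surely. Then $F_n$ converges stably to the Gaussian mixture $\mathbf N(0,S^2)$, with respect to $\mathfrak W$: for every bounded $\mathfrak W$-measurable real random variable $Y$, the pair $(F_n,Y)$ converges in law to $(SN,Y)$,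 where $S=\sqrt{S^2}$. -/

import Mathlib

open MeasureTheory ProbabilityTheory Filter Topology
open scoped ENNReal NNReal

noncomputable section

/-- `m` is a countable sum of `ℕ`-valued measures. -/
def IsCountableSumOfNatMeasures {Z : Type*} [MeasurableSpace Z] (m : Measure Z) : Prop :=
  ∃ μ : ℕ → Measure Z,
    (∀ i, ∀ B : Set Z, MeasurableSet B → ∃ k : ℕ, μ i B = (k : ℝ≥0∞)) ∧ m = Measure.sum μ

/-- `η` is a Poisson point process on `Z` with intensity `ν`. The σ-algebra on `Measure Z` is the
one generated by the evaluations `m ↦ m B`, for `B` measurable. -/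
structure IsPoissonPointProcess {Ω Z : Type*} [MeasurableSpace Ω] [MeasurableSpace Z]
    (η : Ω → Measure Z) (ν : Measure Z) (P : Measure Ω) : Prop where
  measurable : Measurable η
  counting : ∀ ω, IsCountableSumOfNatMeasures (η ω)
  indep : ∀ (k : ℕ) (B : Fin k → Set Z), (∀ i, MeasurableSet (B i)) →
    Pairwise (fun i j => Disjoint (B i) (B j)) → iIndepFun (fun i ω => η ω (B i)) P
  poisson : ∀ B : Set Z, MeasurableSet B → ν B < ∞ →
    P.map (fun ω => η ω B) = (poissonMeasure (ν B).toNNReal).map (fun k : ℕ => (k : ℝ≥0∞))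

/-- The σ-algebra on `Ω` generated by the random measure `η`. -/
abbrev sigmaAlgebraOf {Ω Z : Type*} [MeasurableSpace Z] (η : Ω → Measure Z) : MeasurableSpace Ω :=
  MeasurableSpace.comap η inferInstance

/-- The double Poisson integral of `f`, as given pathwise for `f ∈ L¹(ν²)`:
`∫ f dη⁽²⁾ - ∫∫ f(x,y) ν(dy) η(dx) - ∫∫ f(x,y) η(dy) ν(dx) + ∫ f dν²`.
The first term is the integral against the second factorial power of `m = η ω` (the sum of
`f (xᵢ, xⱼ)` over `i ≠ j` when `m = ∑ᵢ δ_{xᵢ}`): the inner integral is over all points of `m`, and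
the diagonal contribution `f (x, x)` of the point `x` itself is removed. -/
def pathwiseDoubleIntegral {Ω Z : Type*} [MeasurableSpace Z] (η : Ω → Measure Z) (ν : Measure Z)
    (f : Z × Z → ℝ) (ω : Ω) : ℝ :=
  (∫ x, ((∫ y, f (x, y) ∂(η ω)) - f (x, x)) ∂(η ω))
    - (∫ x, (∫ y, f (x, y) ∂ν) ∂(η ω))
    - (∫ x, (∫ y, f (x, y) ∂(η ω)) ∂ν)
    + ∫ p, f p ∂(ν.prod ν)

/-- `X` is (a version of) the double Poisson integral `I₂(f)` of `f ∈ L²(ν²)`: the `L²(P)`-limit of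
the pathwise integrals of kernels in `L¹(ν²) ∩ L²(ν²)` that converge to `f` in `L²(ν²)`. -/
structure IsDoublePoissonIntegral {Ω Z : Type*} [MeasurableSpace Ω] [MeasurableSpace Z]
    (η : Ω → Measure Z) (ν : Measure Z) (P : Measure Ω) (f : Z × Z → ℝ) (X : Ω → ℝ) : Prop where
  memLp_kernel : MemLp f 2 (ν.prod ν)
  memLp : MemLp X 2 P
  exists_approx : ∃ φ : ℕ → Z × Z → ℝ,
    (∀ k, Measurable (φ k) ∧ MemLp (φ k) 1 (ν.prod ν) ∧ MemLp (φ k) 2 (ν.prod ν)) ∧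
    Tendsto (fun k => eLpNorm (φ k - f) 2 (ν.prod ν)) atTop (𝓝 0) ∧
    Tendsto (fun k => eLpNorm (pathwiseDoubleIntegral η ν (φ k) - X) 2 P) atTop (𝓝 0)

/-- The symmetrization of a function of two variables. -/
def symmetrization {Z : Type*} (f : Z × Z → ℝ) : Z × Z → ℝ :=
  fun p => (f p + f p.swap) / 2

/-- The contraction `f ⋆₁¹ g` of two functions of two variables. -/
def starOneOne {Z : Type*} [MeasurableSpace Z] (ν : Measure Z) (f g : Z × Z → ℝ) : Z × Z → ℝ :=
  fun p => ∫ y, f (y, p.1) * g (y, p.2) ∂ν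

/-- The contraction `f ⋆₂¹ g` of two functions of two variables. -/
def starTwoOne {Z : Type*} [MeasurableSpace Z] (ν : Measure Z) (f g : Z × Z → ℝ) : Z → ℝ :=
  fun x => ∫ y, f (y, x) * g (y, x) ∂ν

/-- The contraction `f ⋆₁¹ h` of a function of two variables with a function of one variable. -/
def starOneOneVec {Z : Type*} [MeasurableSpace Z] (ν : Measure Z) (f : Z × Z → ℝ) (h : Z → ℝ) :
    Z → ℝ :=
  fun x => ∫ y, f (y, x) * h y ∂ν

/-- Stable convergence of `F n` to `Flim` with respect to the sub-σ-algebra `W`: for every bounded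
`W`-measurable `Y`, the pairs `(F n, Y)` converge in law to `(Flim, Y)`. -/
def StablyConverges {Ω : Type*} (W : MeasurableSpace Ω) [mΩ : MeasurableSpace Ω]
    (P : Measure Ω) [IsProbabilityMeasure P] (F : ℕ → Ω → ℝ) (Flim : Ω → ℝ) : Prop :=
  ∀ Y : Ω → ℝ, Measurable[W] Y → MemLp Y ∞ P →
    TendstoInDistribution (fun n ω => (F n ω, Y ω)) atTop (fun ω => (Flim ω, Y ω)) (fun _ => P) P

end

/-! The hypotheses force `g2 = 0` almost everywhere, so the asymptotic variance is the constant `2 *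
g0` and the theorem is a mixing central limit theorem. Call the integral of `g n ^ 2` over `C × Z`,
with `ν C < ∞`, the local mass of `g n` on `C`. By Cauchy–Schwarz it is at most `‖g n ⋆₂¹ g n‖ * √(ν
C)`, hence tends to zero. The integral of `g n ⋆₁¹ ghat n` over a rectangle `D × C` is the scalar
product of the functions `y ↦ ∫_D g n (y, ·)` and `y ↦ ∫_C ghat n (y, ·)`. The first tends to zero
by loss of local mass; the second does too, since `ghat n (y, x) = 2 g n (x, y) - ghat n (x, y)` and
the last term is governed by the condition on `ghat n ⋆₁¹ h`. So `g2` integrates to zero over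
rectangles (`ae_eq_zero_of_tendsto_starOneOne`).

The antisymmetric part `A` of `ghat n` satisfies `tr (G³ A) = 0` against the symmetric operator `G`
of `g n`. Thus `g n ⋆₁¹ g n` and `g n ⋆₁¹ A` are orthogonal, and `‖g n ⋆₁¹ g n‖ ≤ ‖g n ⋆₁¹ ghat n‖ →
0` (`eLpNorm_starOneOne_symmetrization_le`). Also `⟨g n, ghat n⟩ = ‖g n‖²`, so `‖g n‖² → g0`. These
are the ingredients of a fourth-moment type theorem.

The central limit theorem is proved for step kernels, where the double integral is a quadratic form
`F` in independent compensated Poisson variables. With `φ t = E exp(itF)`, integration by parts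
gives `φ' t = -2 t v φ t` up to a third-order Taylor error and the fluctuation of the squared
gradient. Solving this differential equation on `[0, 1]` gives
`norm_integral_cexp_poissonQuad_sub_le`, with errors in terms of the contractions and the fourth
power. Averaging over cells passes to general kernels: averages are best `L²` approximations, and by
Jensen they increase neither the `L⁴` norm nor the norm of `⋆₂¹`.

For stability, take an event depending on the point counts in finitely many sets, with union `D` of
finite intensity. Loss of local mass allows `g n` to be replaced by a kernel vanishing as soon as
one variable lies in `D`; its double integral is independent of the event
(`IsPoissonPointProcess.setIntegral_cexp_stepKernel`). Such events form a π-system generating the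
σ-algebra of `η`; a monotone class argument and Lévy's continuity theorem finish the proof. -/

noncomputable section

/-! ### Calculus of independent Poisson variables: Mecke identity, integration by parts, moments. -/

section FiniteModel

variable {ι : Type*} [Fintype ι]

/-- The law of a finite family of independent Poisson variables. -/
abbrev poissonVec {ι : Type*} [Fintype ι] (l : ι → ℝ≥0) : Measure (ι → ℕ) :=
  Measure.pi fun i => poissonMeasure (l i)

lemma poissonMeasure_singleton_succ (r : ℝ≥0) (k : ℕ) :
    ((k + 1 : ℕ) : ℝ≥0∞) * poissonMeasure r {k + 1} = r * poissonMeasure r {k} := by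
  rw [poissonMeasure_singleton, poissonMeasure_singleton, ← ENNReal.ofReal_natCast,
    ← ENNReal.ofReal_mul (by positivity), ← ENNReal.ofReal_coe_nnreal,
    ← ENNReal.ofReal_mul (by positivity)]
  congr 1
  rw [Nat.factorial_succ]
  push_cast
  field_simp
  ring

/-- The Mecke (Stein–Chen) identity for a Poisson vector, as an identity of measures. -/
lemma poissonVec_withDensity_coord [DecidableEq ι] (l : ι → ℝ≥0) (i : ι) :
    (poissonVec l).withDensity (fun n => (n i : ℝ≥0∞)) =
      (l i : ℝ≥0∞) • (poissonVec l).map (fun n => n + Pi.single i 1) := by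
  refine Measure.ext_of_singleton fun m => ?_
  rw [withDensity_apply _ (measurableSet_singleton m), Measure.smul_apply,
    Measure.map_apply (Measurable.of_discrete) (measurableSet_singleton m),
    lintegral_singleton, smul_eq_mul]
  -- The shift misses every point with `m i = 0`, where the density vanishes as well; any other
  -- point has exactly one preimage.
  rcases Nat.eq_zero_or_pos (m i) with h0 | hpos
  · have : (fun n : ι → ℕ => n + Pi.single i 1) ⁻¹' {m} = ∅ := by
      ext n
      simp only [Set.mem_preimage, Set.mem_singleton_iff, Set.mem_empty_iff_false, iff_false]
      intro h
      have := congrFun h i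
      simp [h0] at this
    rw [this, h0]
    simp
  · obtain ⟨k, hk⟩ : ∃ k, m i = k + 1 := ⟨m i - 1, by omega⟩
    have hpre : (fun n : ι → ℕ => n + Pi.single i 1) ⁻¹' {m} = {Function.update m i k} := by
      ext n
      simp only [Set.mem_preimage, Set.mem_singleton_iff]
      constructor
      · rintro rfl
        ext j
        by_cases hj : j = i
        · subst hj; simp at hk ⊢; omega
        · simp [hj]
      · rintro rfl
        ext j
        by_cases hj : j = i
        · subst hj; simp [hk]
        · simp [hj]
    rw [hpre, Measure.pi_singleton, Measure.pi_singleton,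
      ← Finset.mul_prod_erase _ _ (Finset.mem_univ i),
      ← Finset.mul_prod_erase _ _ (Finset.mem_univ i), ← mul_assoc, ← mul_assoc, hk,
      poissonMeasure_singleton_succ, Function.update_self]
    congr 1
    refine Finset.prod_congr rfl fun j hj => ?_
    rw [Function.update_of_ne (Finset.ne_of_mem_erase hj)]

/-- Since this comes from an identity of measures, `G` needs no integrability: otherwise both sides
take the default value together. -/
lemma integral_poissonVec_coord_smul [DecidableEq ι] {E : Type*} [NormedAddCommGroup E] [NormedSpace ℝ E]
    (l : ι → ℝ≥0) (i : ι) (G : (ι → ℕ) → E) :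
    ∫ n, (n i : ℝ) • G n ∂(poissonVec l) =
      (l i : ℝ) • ∫ n, G (n + Pi.single i 1) ∂(poissonVec l) := by
  have h1 := congrArg (fun μ : Measure (ι → ℕ) => ∫ n, G n ∂μ) (poissonVec_withDensity_coord l i)
  rw [integral_smul_measure, integral_map (Measurable.of_discrete).aemeasurable
    (.of_discrete)] at h1
  rw [show (fun n : ι → ℕ => (n i : ℝ≥0∞)) = fun n => (((n i : ℝ≥0)) : ℝ≥0∞) by
    ext n; simp, integral_withDensity_eq_integral_smul (Measurable.of_discrete)] at h1
  simpa [NNReal.smul_def] using h1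

/-- Functions of a Poisson vector with at most exponential growth. -/
def ExpBounded {ι : Type*} [Fintype ι] {E : Type*} [NormedAddCommGroup E]
    (Φ : (ι → ℕ) → E) : Prop :=
  ∃ C c : ℝ, 0 ≤ C ∧ 0 ≤ c ∧ ∀ n, ‖Φ n‖ ≤ C * Real.exp (c * ∑ j, (n j : ℝ))

lemma integrable_exp_poissonMeasure (r : ℝ≥0) (c : ℝ) :
    Integrable (fun n : ℕ => Real.exp (c * n)) (poissonMeasure r) := by
  rw [integrable_poissonMeasure_iff]
  have := (NormedSpace.expSeries_div_summable (𝔸 := ℝ) (r * Real.exp c)).mul_left (Real.exp (-r))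
  refine this.congr fun n => ?_
  rw [Real.norm_of_nonneg (Real.exp_pos _).le, mul_pow, ← Real.exp_nat_mul, mul_comm c]
  ring

namespace ExpBounded

variable {E : Type*} [NormedAddCommGroup E] {Φ Ψ : (ι → ℕ) → E}

/-- Poisson variables have all exponential moments. As the class is stable under sums, products and
unit shifts, it settles every integrability question in the finite model. -/
lemma integrable (h : ExpBounded Φ) (l : ι → ℝ≥0) : Integrable Φ (poissonVec l) := by
  obtain ⟨C, c, hC, hc, h⟩ := h
  have h1 : Integrable (fun n : ι → ℕ => ∏ j, Real.exp (c * n j)) (poissonVec l) :=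
    Integrable.fintype_prod fun j => integrable_exp_poissonMeasure (l j) c
  refine (h1.const_mul C).mono' .of_discrete (ae_of_all _ fun n => ?_)
  rw [← Real.exp_sum, ← Finset.mul_sum]
  exact h n

lemma of_bounded {C : ℝ} (h : ∀ n, ‖Φ n‖ ≤ C) : ExpBounded Φ :=
  ⟨C, 0, (norm_nonneg _).trans (h 0), le_rfl, fun n => by simpa using h n⟩

lemma const (x : E) : ExpBounded (fun _ : ι → ℕ => x) := of_bounded fun _ => le_rfl

lemma coord (i : ι) : ExpBounded (fun n : ι → ℕ => (n i : ℝ)) := by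
  refine ⟨1, 1, zero_le_one, zero_le_one, fun n => ?_⟩
  have h1 : (n i : ℝ) ≤ ∑ j, (n j : ℝ) :=
    Finset.single_le_sum (f := fun j => (n j : ℝ)) (fun j _ => by positivity) (Finset.mem_univ i)
  have h2 := Real.add_one_le_exp (∑ j, (n j : ℝ))
  rw [Real.norm_of_nonneg (by positivity), one_mul, one_mul]
  linarith

lemma add (h : ExpBounded Φ) (h' : ExpBounded Ψ) : ExpBounded (fun n => Φ n + Ψ n) := by
  obtain ⟨C, c, hC, hc, h⟩ := h
  obtain ⟨C', c', hC', hc', h'⟩ := h'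
  refine ⟨C + C', c + c', by positivity, by positivity, fun n => ?_⟩
  have hs : 0 ≤ ∑ j, (n j : ℝ) := by positivity
  calc ‖Φ n + Ψ n‖ ≤ ‖Φ n‖ + ‖Ψ n‖ := norm_add_le _ _
    _ ≤ C * Real.exp (c * ∑ j, (n j : ℝ)) + C' * Real.exp (c' * ∑ j, (n j : ℝ)) :=
        add_le_add (h n) (h' n)
    _ ≤ C * Real.exp ((c + c') * ∑ j, (n j : ℝ)) + C' * Real.exp ((c + c') * ∑ j, (n j : ℝ)) := by
        gcongr <;> linarith
    _ = _ := by ring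

lemma smul [NormedSpace ℝ E] {f : (ι → ℕ) → ℝ} (hf : ExpBounded f) (h : ExpBounded Φ) :
    ExpBounded (fun n => f n • Φ n) := by
  obtain ⟨C, c, hC, hc, h⟩ := h
  obtain ⟨C', c', hC', hc', h'⟩ := hf
  refine ⟨C' * C, c' + c, by positivity, by positivity, fun n => ?_⟩
  calc ‖f n • Φ n‖ = ‖f n‖ * ‖Φ n‖ := norm_smul _ _
    _ ≤ (C' * Real.exp (c' * ∑ j, (n j : ℝ))) * (C * Real.exp (c * ∑ j, (n j : ℝ))) := by
        gcongr
        · exact h' n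
        · exact h n
    _ = _ := by rw [add_mul, Real.exp_add]; ring

lemma mul {f g : (ι → ℕ) → ℝ} (hf : ExpBounded f) (hg : ExpBounded g) :
    ExpBounded (fun n => f n * g n) := hf.smul hg

lemma neg (h : ExpBounded Φ) : ExpBounded (fun n => -Φ n) := by
  obtain ⟨C, c, hC, hc, h⟩ := h
  exact ⟨C, c, hC, hc, fun n => by rw [norm_neg]; exact h n⟩

lemma sub (h : ExpBounded Φ) (h' : ExpBounded Ψ) : ExpBounded (fun n => Φ n - Ψ n) := by
  simpa [sub_eq_add_neg] using h.add h'.neg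

lemma norm (h : ExpBounded Φ) : ExpBounded (fun n => ‖Φ n‖) := by
  obtain ⟨C, c, hC, hc, h⟩ := h
  exact ⟨C, c, hC, hc, fun n => by rw [norm_norm]; exact h n⟩

lemma abs {f : (ι → ℕ) → ℝ} (h : ExpBounded f) : ExpBounded (fun n => |f n|) := h.norm

lemma pow {f : (ι → ℕ) → ℝ} (h : ExpBounded f) (k : ℕ) : ExpBounded (fun n => f n ^ k) := by
  induction k with
  | zero => simpa using const (1 : ℝ)
  | succ k ih => simpa [pow_succ] using ih.mul h

lemma sum {κ : Type*} (s : Finset κ) {f : κ → (ι → ℕ) → E} (h : ∀ k ∈ s, ExpBounded (f k)) :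
    ExpBounded (fun n => ∑ k ∈ s, f k n) := by
  classical
  induction s using Finset.induction_on with
  | empty => simpa using const (0 : E)
  | insert k s hk ih =>
    simp_rw [Finset.sum_insert hk]
    exact (h k (Finset.mem_insert_self _ _)).add
      (ih fun j hj => h j (Finset.mem_insert_of_mem hj))

lemma shift [DecidableEq ι] (h : ExpBounded Φ) (i : ι) : ExpBounded (fun n => Φ (n + Pi.single i 1)) := by
  obtain ⟨C, c, hC, hc, h⟩ := h
  refine ⟨C * Real.exp c, c, by positivity, hc, fun n => (h _).trans (le_of_eq ?_)⟩
  have : ∑ j, (((n + Pi.single i 1 : ι → ℕ) j : ℕ) : ℝ) = ∑ j, (n j : ℝ) + 1 := by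
    simp [Finset.sum_add_distrib, Pi.single_apply]
  rw [this, mul_assoc, ← Real.exp_add]
  ring_nf

end ExpBounded

/-- The linear form `∑ j, b j (n j - l j)` in the compensated coordinates. -/
def poissonLin {ι : Type*} [Fintype ι] (l : ι → ℝ≥0) (b : ι → ℝ) (n : ι → ℕ) : ℝ :=
  ∑ j, b j * ((n j : ℝ) - l j)

/-- The double Poisson integral of the step kernel with coefficients `a`. -/
def poissonQuad {ι : Type*} [Fintype ι] (l : ι → ℝ≥0) (a : ι → ι → ℝ) (n : ι → ℕ) : ℝ :=
  ∑ i, (((n i : ℝ) - l i) * poissonLin l (a i) n - a i i * n i)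

variable (l : ι → ℝ≥0)

lemma expBounded_poissonLin (b : ι → ℝ) : ExpBounded (poissonLin l b) :=
  ExpBounded.sum _ fun j _ => (ExpBounded.const (b j)).mul
    ((ExpBounded.coord j).sub (ExpBounded.const _))

lemma expBounded_poissonQuad (a : ι → ι → ℝ) : ExpBounded (poissonQuad l a) :=
  ExpBounded.sum _ fun i _ => (((ExpBounded.coord i).sub (ExpBounded.const _)).mul
    (expBounded_poissonLin l (a i))).sub ((ExpBounded.const _).mul (ExpBounded.coord i))

lemma poissonLin_shift [DecidableEq ι] (b : ι → ℝ) (n : ι → ℕ) (i : ι) :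
    poissonLin l b (n + Pi.single i 1) = poissonLin l b n + b i := by
  simp only [poissonLin]
  have : ∀ j, b j * (((n + Pi.single i 1 : ι → ℕ) j : ℕ) - (l j : ℝ)) =
      b j * ((n j : ℝ) - l j) + b j * (if j = i then 1 else 0) := by
    intro j
    by_cases h : j = i
    · subst h; simp; ring
    · simp [h]
  simp_rw [this, Finset.sum_add_distrib]
  simp

/-- An added point does not interact with itself: the diagonal correction in `poissonQuad` cancels
`a i i`. The difference operator is therefore exactly twice the linear form of row `i`. -/
lemma poissonQuad_shift [DecidableEq ι] {a : ι → ι → ℝ} (ha : ∀ i j, a i j = a j i) (n : ι → ℕ) (i : ι) :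
    poissonQuad l a (n + Pi.single i 1) = poissonQuad l a n + 2 * poissonLin l (a i) n := by
  simp only [poissonQuad]
  have : ∀ j, ((((n + Pi.single i 1 : ι → ℕ) j : ℕ) : ℝ) - l j) *
        poissonLin l (a j) (n + Pi.single i 1) - a j j * ((n + Pi.single i 1 : ι → ℕ) j : ℕ) =
      (((n j : ℝ) - l j) * poissonLin l (a j) n - a j j * n j) +
        (a i j * ((n j : ℝ) - l j) +
          (if j = i then poissonLin l (a i) n + a i i - a i i else 0)) := by
    intro j
    rw [poissonLin_shift, ha i j]
    by_cases h : j = i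
    · subst h; simp; ring
    · simp [h]; ring
  simp_rw [this, Finset.sum_add_distrib]
  simp only [Finset.sum_ite_eq', Finset.mem_univ, if_true]
  simp only [poissonLin]
  ring

section IBP

variable {E : Type*} [NormedAddCommGroup E] [NormedSpace ℝ E]

/-- Discrete integration by parts: multiplication by the compensated coordinate is adjoint to the
difference operator. -/
lemma integral_compensated_smul [DecidableEq ι] {G : (ι → ℕ) → E} (hG : ExpBounded G) (i : ι) :
    ∫ n, ((n i : ℝ) - l i) • G n ∂(poissonVec l) =
      (l i : ℝ) • ∫ n, (G (n + Pi.single i 1) - G n) ∂(poissonVec l) := by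
  simp_rw [sub_smul]
  rw [integral_sub (((ExpBounded.coord i).smul hG).integrable l)
    (((ExpBounded.const (l i : ℝ)).smul hG).integrable l),
    integral_poissonVec_coord_smul, integral_smul, integral_sub ((hG.shift i).integrable l)
    (hG.integrable l), smul_sub]

lemma integral_poissonLin_smul [DecidableEq ι] {G : (ι → ℕ) → E} (hG : ExpBounded G) (b : ι → ℝ) :
    ∫ n, poissonLin l b n • G n ∂(poissonVec l) =
      ∑ j, ((l j : ℝ) * b j) • ∫ n, (G (n + Pi.single j 1) - G n) ∂(poissonVec l) := by
  simp_rw [poissonLin, Finset.sum_smul]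
  rw [integral_finsetSum _ fun j _ => ((((ExpBounded.const (b j)).mul
    ((ExpBounded.coord j).sub (ExpBounded.const _))).smul hG).integrable l)]
  refine Finset.sum_congr rfl fun j _ => ?_
  simp_rw [mul_smul]
  rw [integral_smul, integral_compensated_smul l hG, smul_comm]

/-- Only one of the two variables is integrated by parts. Differencing the remaining linear form
creates `a i i • G (n + Pi.single i 1)`, which is what the diagonal correction contributes with the
opposite sign. -/
lemma integral_poissonQuad_smul [DecidableEq ι] {G : (ι → ℕ) → E} (hG : ExpBounded G) (a : ι → ι → ℝ) :
    ∫ n, poissonQuad l a n • G n ∂(poissonVec l) =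
      ∑ i, (l i : ℝ) • ∫ n, poissonLin l (a i) n • (G (n + Pi.single i 1) - G n)
        ∂(poissonVec l) := by
  simp_rw [poissonQuad, Finset.sum_smul]
  rw [integral_finsetSum _ fun i _ => (((((ExpBounded.coord i).sub (ExpBounded.const _)).mul
    (expBounded_poissonLin l (a i))).sub
      ((ExpBounded.const (a i i)).mul (ExpBounded.coord i))).smul hG).integrable l]
  refine Finset.sum_congr rfl fun i _ => ?_
  have hU := expBounded_poissonLin l (a i)
  have hUG := hU.smul hG
  simp_rw [sub_smul, mul_smul]
  rw [integral_sub, integral_compensated_smul l hUG, integral_smul,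
    integral_poissonVec_coord_smul, smul_comm (a i i), ← smul_sub, ← integral_smul,
    ← integral_sub]
  · congr 2
    ext n
    rw [poissonLin_shift]
    module
  · exact ((hUG.shift i).sub hUG).integrable l
  · exact ((ExpBounded.const (a i i)).smul (hG.shift i)).integrable l
  · have := (((ExpBounded.coord i).sub (ExpBounded.const (l i : ℝ))).smul hUG).integrable l
    exact this
  · exact ((ExpBounded.const (a i i)).smul ((ExpBounded.coord i).smul hG)).integrable l

end IBP

lemma integral_poissonLin (b : ι → ℝ) : ∫ n, poissonLin l b n ∂(poissonVec l) = 0 := by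
  classical
  have := integral_poissonLin_smul l (ExpBounded.const (ι := ι) (1 : ℝ)) b
  simpa using this

lemma integral_poissonLin_sq (b : ι → ℝ) :
    ∫ n, poissonLin l b n ^ 2 ∂(poissonVec l) = ∑ j, (l j : ℝ) * b j ^ 2 := by
  classical
  have := integral_poissonLin_smul l (expBounded_poissonLin l b) b
  simp only [poissonLin_shift, smul_eq_mul, add_sub_cancel_left, integral_const, probReal_univ,
    one_mul, ← pow_two] at this
  rw [this]
  exact Finset.sum_congr rfl fun j _ => by ring

lemma integral_poissonLin_pow_four (b : ι → ℝ) :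
    ∫ n, poissonLin l b n ^ 4 ∂(poissonVec l) =
      3 * (∑ j, (l j : ℝ) * b j ^ 2) ^ 2 + ∑ j, (l j : ℝ) * b j ^ 4 := by
  classical
  have hL := expBounded_poissonLin l b
  have := integral_poissonLin_smul l (hL.pow 3) b
  simp only [poissonLin_shift, smul_eq_mul, ← pow_succ'] at this
  rw [this]
  have h : ∀ j, ∫ n, ((poissonLin l b n + b j) ^ 3 - poissonLin l b n ^ 3) ∂(poissonVec l) =
      3 * b j * (∑ j, (l j : ℝ) * b j ^ 2) + b j ^ 3 := by
    intro j
    have h1 : ∀ n, (poissonLin l b n + b j) ^ 3 - poissonLin l b n ^ 3 =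
      3 * b j * poissonLin l b n ^ 2 + (3 * b j ^ 2 * poissonLin l b n + b j ^ 3) :=
        fun n => by ring
    simp_rw [h1]
    rw [integral_add, integral_add, integral_const_mul, integral_const_mul,
      integral_poissonLin_sq, integral_poissonLin]
    · simp
    · exact (hL.integrable l).const_mul _
    · exact integrable_const _
    · exact ((hL.pow 2).integrable l).const_mul _
    · exact ((hL.integrable l).const_mul _).add (integrable_const _)
  simp_rw [h]
  rw [pow_two, Finset.mul_sum, Finset.mul_sum, ← Finset.sum_add_distrib]
  exact Finset.sum_congr rfl fun j _ => by ring

lemma integral_poissonQuad_sq {a : ι → ι → ℝ} (ha : ∀ i j, a i j = a j i) :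
    ∫ n, poissonQuad l a n ^ 2 ∂(poissonVec l) =
      2 * ∑ i, ∑ j, (l i : ℝ) * l j * a i j ^ 2 := by
  classical
  have := integral_poissonQuad_smul l (expBounded_poissonQuad l a) a
  simp only [poissonQuad_shift l ha, smul_eq_mul, add_sub_cancel_left, ← pow_two] at this
  rw [this, Finset.mul_sum]
  refine Finset.sum_congr rfl fun i _ => ?_
  have : ∀ n, poissonLin l (a i) n * (2 * poissonLin l (a i) n) =
      2 * poissonLin l (a i) n ^ 2 := fun n => by ring
  simp_rw [this]
  rw [integral_const_mul, integral_poissonLin_sq, Finset.mul_sum, Finset.mul_sum, Finset.mul_sum]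
  exact Finset.sum_congr rfl fun j _ => by ring

end FiniteModel

end

noncomputable section

/-! ### A quantitative central limit theorem for quadratic forms in Poisson variables. -/

section FiniteCLT

/-- The Taylor bound `x ^ 2` covers `|x| ≤ 1`; elsewhere the trivial bound `2 + |x|` is at most `3 *
x ^ 2`. -/
lemma norm_cexp_mul_I_sub_one_sub_le (x : ℝ) :
    ‖Complex.exp (x * Complex.I) - 1 - x * Complex.I‖ ≤ 3 * x ^ 2 := by
  have hn : ‖(x : ℂ) * Complex.I‖ = |x| := by simp
  rcases le_or_gt |x| 1 with h | h
  · have := Complex.norm_exp_sub_one_sub_id_le (x := (x : ℂ) * Complex.I) (by rw [hn]; exact h)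
    rw [hn, sq_abs] at this
    nlinarith [sq_nonneg x]
  · calc ‖Complex.exp (x * Complex.I) - 1 - x * Complex.I‖
        ≤ ‖Complex.exp (x * Complex.I)‖ + ‖(1 : ℂ)‖ + ‖(x : ℂ) * Complex.I‖ :=
          (norm_sub_le _ _).trans (add_le_add_left (norm_sub_le _ _) _)
      _ = 2 + |x| := by rw [Complex.norm_exp_ofReal_mul_I, hn, norm_one]; ring
      _ ≤ 3 * |x| ^ 2 := by nlinarith
      _ = 3 * x ^ 2 := by rw [sq_abs]

variable {ι : Type*} [Fintype ι] (l : ι → ℝ≥0) (a : ι → ι → ℝ)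

/-- `∑ l i a i j²`: the squared norms of the columns of a step kernel. -/
def stepCol {ι : Type*} [Fintype ι] (l : ι → ℝ≥0) (a : ι → ι → ℝ) (j : ι) : ℝ :=
  ∑ i, (l i : ℝ) * a i j ^ 2

/-- The coefficients of the contraction of two step kernels. -/
def stepContr {ι : Type*} [Fintype ι] (l : ι → ℝ≥0) (a b : ι → ι → ℝ) (j k : ι) : ℝ :=
  ∑ i, (l i : ℝ) * (a i j * b i k)

/-- The integral of a step kernel. -/
def stepSum {ι : Type*} [Fintype ι] (l : ι → ℝ≥0) (a : ι → ι → ℝ) : ℝ :=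
  ∑ i, ∑ j, (l i : ℝ) * l j * a i j

/-- The random variable `∑ i, l i U i²`, a quarter of the squared norm of the gradient. -/
def stepGradSq {ι : Type*} [Fintype ι] (l : ι → ℝ≥0) (a : ι → ι → ℝ) (n : ι → ℕ) : ℝ :=
  ∑ i, (l i : ℝ) * poissonLin l (a i) n ^ 2

/-- The product formula: the squared gradient has a constant part, a second-chaos part with kernel
the contraction of `a` with itself, and a first-chaos part with the diagonal of that contraction. -/
lemma stepGradSq_eq (n : ι → ℕ) :
    stepGradSq l a n - stepSum l (fun i j => a i j ^ 2) =
      poissonQuad l (stepContr l a a) n + poissonLin l (fun j => stepContr l a a j j) n := by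
  have h1 : stepGradSq l a n = ∑ j, ((n j : ℝ) - l j) * poissonLin l (stepContr l a a j) n := by
    simp only [stepGradSq, poissonLin, stepContr, pow_two, Finset.mul_sum, Finset.sum_mul]
    rw [Finset.sum_comm]
    refine Finset.sum_congr rfl fun j _ => ?_
    rw [Finset.sum_comm]
    refine Finset.sum_congr rfl fun k _ => ?_
    exact Finset.sum_congr rfl fun i _ => by ring
  have h2 : stepSum l (fun i j => a i j ^ 2) = ∑ j, (l j : ℝ) * stepContr l a a j j := by
    simp only [stepSum, stepContr, Finset.mul_sum]
    rw [Finset.sum_comm]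
    exact Finset.sum_congr rfl fun j _ => Finset.sum_congr rfl fun i _ => by ring
  rw [h1, h2, poissonQuad, poissonLin.eq_1 l (fun j => stepContr l a a j j),
    ← Finset.sum_add_distrib, ← Finset.sum_sub_distrib]
  exact Finset.sum_congr rfl fun j _ => by ring

lemma expBounded_stepGradSq : ExpBounded (stepGradSq l a) :=
  ExpBounded.sum _ fun i _ => (ExpBounded.const _).mul ((expBounded_poissonLin l (a i)).pow 2)

/-- The two chaos parts are estimated through `(x + y) ^ 2 ≤ 2 * x ^ 2 + 2 * y ^ 2` and their
isometries. The diagonal of the contraction is `stepCol`, the discrete form of `⋆₂¹`. -/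
lemma integral_stepGradSq_sub_sq_le :
    ∫ n, (stepGradSq l a n - stepSum l (fun i j => a i j ^ 2)) ^ 2 ∂(poissonVec l) ≤
      4 * stepSum l (fun j k => stepContr l a a j k ^ 2) +
        2 * ∑ j, (l j : ℝ) * stepCol l a j ^ 2 := by
  have hq := (expBounded_poissonQuad l (stepContr l a a)).pow 2
  have hl := (expBounded_poissonLin l (fun j => stepContr l a a j j)).pow 2
  have hsymm : ∀ j k, stepContr l a a j k = stepContr l a a k j := fun j k =>
    Finset.sum_congr rfl fun i _ => by ring
  have hdiag : ∀ j, stepContr l a a j j = stepCol l a j := fun j =>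
    Finset.sum_congr rfl fun i _ => by ring
  calc ∫ n, (stepGradSq l a n - stepSum l (fun i j => a i j ^ 2)) ^ 2 ∂(poissonVec l)
      ≤ ∫ n, (2 * poissonQuad l (stepContr l a a) n ^ 2 +
          2 * poissonLin l (fun j => stepContr l a a j j) n ^ 2) ∂(poissonVec l) := by
        refine integral_mono ?_ ?_ fun n => ?_
        · exact (((expBounded_stepGradSq l a).sub (ExpBounded.const _)).pow 2).integrable l
        · exact ((hq.integrable l).const_mul 2).add ((hl.integrable l).const_mul 2)
        · simp only [stepGradSq_eq]
          nlinarith [sq_nonneg (poissonQuad l (stepContr l a a) n -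
            poissonLin l (fun j => stepContr l a a j j) n)]
    _ = _ := by
        rw [integral_add ((hq.integrable l).const_mul 2) ((hl.integrable l).const_mul 2),
          integral_const_mul, integral_const_mul, integral_poissonQuad_sq l hsymm,
          integral_poissonLin_sq]
        simp only [stepSum, hdiag]
        ring

/-- The characteristic function of a double Poisson integral along a ray, and its derivative. -/
lemma hasDerivAt_integral_cexp_poissonQuad (t : ℝ) :
    HasDerivAt (fun t : ℝ => ∫ n, Complex.exp ((t * poissonQuad l a n : ℝ) * Complex.I)
        ∂(poissonVec l))
      (∫ n, poissonQuad l a n • (Complex.I * Complex.exp ((t * poissonQuad l a n : ℝ) * Complex.I))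
        ∂(poissonVec l)) t := by
  refine (hasDerivAt_integral_of_dominated_loc_of_deriv_le (s := Set.univ)
    (F := fun (t : ℝ) n => Complex.exp ((t * poissonQuad l a n : ℝ) * Complex.I))
    (F' := fun t n => poissonQuad l a n •
      (Complex.I * Complex.exp ((t * poissonQuad l a n : ℝ) * Complex.I)))
    (bound := fun n => |poissonQuad l a n|) univ_mem ?_ ?_ .of_discrete ?_ ?_ ?_).2
  · exact Eventually.of_forall fun _ => .of_discrete
  · exact (ExpBounded.of_bounded (C := 1) fun n => by
      rw [Complex.norm_exp_ofReal_mul_I]).integrable l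
  · refine ae_of_all _ fun n s _ => ?_
    rw [norm_smul, norm_mul, Complex.norm_exp_ofReal_mul_I]
    simp
  · exact ((expBounded_poissonQuad l a).abs).integrable l
  · refine ae_of_all _ fun n s _ => ?_
    have h1 : HasDerivAt (fun s : ℝ => ((s * poissonQuad l a n : ℝ) : ℂ) * Complex.I)
        ((poissonQuad l a n : ℂ) * Complex.I) s := by
      have := ((hasDerivAt_id s).mul_const (poissonQuad l a n)).ofReal_comp.mul_const Complex.I
      simpa using this
    refine h1.cexp.congr_deriv ?_
    rw [Complex.real_smul]
    ring

variable {a}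

/-- The approximate differential equation `φ' = -2 t v φ`. Integration by parts turns `E[i F
exp(itF)]` into a sum of `l i * E[i U i exp(itF) (exp(2itU i) - 1)]`. The first-order Taylor term
yields `-2t` times the squared gradient, which is then replaced by its mean `v`. -/
lemma norm_deriv_cexp_poissonQuad_le (ha : ∀ i j, a i j = a j i) {t : ℝ} (ht0 : 0 ≤ t)
    (ht1 : t ≤ 1) :
    ‖∫ n, poissonQuad l a n • (Complex.I * Complex.exp ((t * poissonQuad l a n : ℝ) * Complex.I))
        ∂(poissonVec l) + 2 * t * stepSum l (fun i j => a i j ^ 2) *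
        ∫ n, Complex.exp ((t * poissonQuad l a n : ℝ) * Complex.I) ∂(poissonVec l)‖ ≤
      12 * ∑ i, (l i : ℝ) * ∫ n, |poissonLin l (a i) n| ^ 3 ∂(poissonVec l) +
        2 * ∫ n, |stepGradSq l a n - stepSum l (fun i j => a i j ^ 2)| ∂(poissonVec l) := by
  classical
  set v := stepSum l (fun i j => a i j ^ 2) with hv
  set U : ι → (ι → ℕ) → ℝ := fun i => poissonLin l (a i) with hU
  set G : (ι → ℕ) → ℂ := fun n => Complex.exp ((t * poissonQuad l a n : ℝ) * Complex.I) with hG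
  have hGn : ∀ n, ‖G n‖ = 1 := fun n => Complex.norm_exp_ofReal_mul_I _
  have hUE : ∀ i, ExpBounded (U i) := fun i => expBounded_poissonLin l (a i)
  have hGE : ExpBounded G := ExpBounded.of_bounded fun n => (hGn n).le
  have hIGE : ExpBounded (fun n => Complex.I * G n) :=
    ExpBounded.of_bounded (C := 1) fun n => by rw [norm_mul, hGn]; simp
  have hshift : ∀ i n, Complex.I * G (n + Pi.single i 1) - Complex.I * G n =
      Complex.I * (G n * (Complex.exp ((2 * t * U i n : ℝ) * Complex.I) - 1)) := by
    intro i n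
    have : G (n + Pi.single i 1) = G n * Complex.exp ((2 * t * U i n : ℝ) * Complex.I) := by
      simp only [hG, hU, poissonQuad_shift l ha, ← Complex.exp_add]
      congr 1
      push_cast
      ring
    rw [this]
    ring
  have hE1 : ∀ i, ExpBounded (fun n => U i n • (Complex.I * G (n + Pi.single i 1) -
      Complex.I * G n)) := fun i => (hUE i).smul ((hIGE.shift i).sub hIGE)
  have key : ∫ n, poissonQuad l a n • (Complex.I * G n) ∂(poissonVec l) +
      2 * t * v * ∫ n, G n ∂(poissonVec l) =
      ∫ n, ((∑ i, (l i : ℝ) • (U i n • (Complex.I * G (n + Pi.single i 1) - Complex.I * G n))) +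
        2 * t * v * G n) ∂(poissonVec l) := by
    rw [integral_add ((ExpBounded.sum _ fun i _ => (ExpBounded.const _).smul
        (hE1 i)).integrable l) ((hGE.integrable l).const_mul _), integral_const_mul,
      integral_finsetSum _ fun i _ => ((ExpBounded.const _).smul (hE1 i)).integrable l,
      integral_poissonQuad_smul l hIGE]
    simp_rw [integral_smul]
    rfl
  have hint : ∀ n, ‖(∑ i, (l i : ℝ) • (U i n • (Complex.I * G (n + Pi.single i 1) -
      Complex.I * G n))) + 2 * t * v * G n‖ ≤
      12 * ∑ i, (l i : ℝ) * |U i n| ^ 3 + 2 * |stepGradSq l a n - v| := by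
    intro n
    have h1 : (∑ i, (l i : ℝ) • (U i n • (Complex.I * G (n + Pi.single i 1) -
        Complex.I * G n))) + 2 * t * v * G n =
        G n * ((∑ i, (l i : ℂ) * U i n * Complex.I *
          (Complex.exp ((2 * t * U i n : ℝ) * Complex.I) - 1 - (2 * t * U i n : ℝ) * Complex.I)) -
          (2 * t * (stepGradSq l a n - v) : ℝ)) := by
      have h2 : ((2 * t * (stepGradSq l a n - v) : ℝ) : ℂ) =
          (∑ i, 2 * t * ((l i : ℂ) * U i n ^ 2)) - 2 * t * v := by
        rw [← Finset.mul_sum]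
        simp only [stepGradSq, hU]
        push_cast
        ring
      rw [h2, ← sub_add, ← Finset.sum_sub_distrib, mul_add, Finset.mul_sum]
      congr 1
      · refine Finset.sum_congr rfl fun i _ => ?_
        rw [hshift, Complex.real_smul, Complex.real_smul]
        push_cast
        linear_combination (2 * (l i : ℂ) * (U i n) ^ 2 * t * G n) * Complex.I_sq
      · ring
    rw [h1, norm_mul, hGn, one_mul]
    refine (norm_sub_le _ _).trans (add_le_add ?_ ?_)
    · rw [Finset.mul_sum]
      refine (norm_sum_le _ _).trans (Finset.sum_le_sum fun i _ => ?_)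
      have h3 := norm_cexp_mul_I_sub_one_sub_le (2 * t * U i n)
      rw [norm_mul, norm_mul, norm_mul, Complex.norm_I, mul_one, Complex.norm_real,
        Complex.norm_real, Real.norm_eq_abs, Real.norm_eq_abs, NNReal.abs_eq]
      -- The constant is `3 * 2 ^ 2 = 12`: the global Taylor bound at `2 * t * U i n`, with `t ≤ 1`.
      calc (l i : ℝ) * |U i n| * _ ≤ (l i : ℝ) * |U i n| * (3 * (2 * t * U i n) ^ 2) := by gcongr
        _ = 12 * ((l i : ℝ) * |U i n| ^ 3) * t ^ 2 := by
            rw [pow_succ |U i n| 2, sq_abs]; ring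
        _ ≤ 12 * ((l i : ℝ) * |U i n| ^ 3) * 1 := by
            gcongr
            nlinarith
        _ = _ := mul_one _
    · rw [Complex.norm_real, Real.norm_eq_abs, abs_mul, abs_of_nonneg (by positivity : 0 ≤ 2 * t)]
      gcongr
      linarith
  have hE3 : ∀ i, ExpBounded (fun n => |U i n| ^ 3) := fun i => (hUE i).abs.pow 3
  have hEW : ExpBounded (fun n => |stepGradSq l a n - v|) :=
    ((expBounded_stepGradSq l a).sub (ExpBounded.const _)).abs
  rw [key]
  refine (norm_integral_le_of_norm_le ?_ (ae_of_all _ hint)).trans (le_of_eq ?_)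
  · exact (((ExpBounded.const 12).mul (ExpBounded.sum _ fun i _ =>
      (ExpBounded.const _).mul (hE3 i))).add ((ExpBounded.const 2).mul hEW)).integrable l
  · rw [integral_add (((ExpBounded.const 12).mul (ExpBounded.sum _ fun i _ =>
      (ExpBounded.const _).mul (hE3 i))).integrable l)
      (((ExpBounded.const 2).mul hEW).integrable l), integral_const_mul, integral_const_mul,
      integral_finsetSum _ fun i _ => (((ExpBounded.const _).mul (hE3 i)).integrable l)]
    simp_rw [integral_const_mul]
    rfl

/-- Quantitative central limit theorem for double Poisson integrals of step kernels. -/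
lemma norm_integral_cexp_poissonQuad_sub_le (ha : ∀ i j, a i j = a j i) {c : ℝ} (hc : 0 < c) :
    ‖∫ n, Complex.exp ((poissonQuad l a n : ℝ) * Complex.I) ∂(poissonVec l) -
        Complex.exp (-stepSum l (fun i j => a i j ^ 2) : ℝ)‖ ≤
      c * (1 + 6 * stepSum l (fun i j => a i j ^ 2)) +
      (4 * stepSum l (fun j k => stepContr l a a j k ^ 2) +
        20 * ∑ j, (l j : ℝ) * stepCol l a j ^ 2 +
        6 * stepSum l (fun i j => a i j ^ 4)) / c := by
  set v := stepSum l (fun i j => a i j ^ 2) with hv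
  have hv0 : 0 ≤ v := by simp only [hv, stepSum]; positivity
  set R := 12 * ∑ i, (l i : ℝ) * ∫ n, |poissonLin l (a i) n| ^ 3 ∂(poissonVec l) +
        2 * ∫ n, |stepGradSq l a n - v| ∂(poissonVec l) with hR
  set ψ : ℝ → ℂ := fun t => ∫ n, Complex.exp ((t * poissonQuad l a n : ℝ) * Complex.I)
        ∂(poissonVec l) with hψ
  have hmain : ‖ψ 1 - Complex.exp (-v : ℝ)‖ ≤ R := by
    -- With the integrating factor `exp (t ^ 2 * v)` the derivative contains exactly the combination
    -- bounded by `R`. The mean value inequality on `[0, 1]` costs `exp v`, which is lost again on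
    -- multiplying by `exp (-v)`.
    have hd : ∀ t : ℝ, HasDerivAt (fun t : ℝ => Complex.exp ((t ^ 2 * v : ℝ) : ℂ) * ψ t)
        (Complex.exp ((t ^ 2 * v : ℝ) : ℂ) * (∫ n, poissonQuad l a n • (Complex.I *
          Complex.exp ((t * poissonQuad l a n : ℝ) * Complex.I)) ∂(poissonVec l) +
          2 * t * v * ψ t)) t := by
      intro t
      have h1 : HasDerivAt (fun t : ℝ => ((t ^ 2 * v : ℝ) : ℂ)) ((2 * t * v : ℝ) : ℂ) t := by
        have := (((hasDerivAt_pow 2 t).mul_const v).ofReal_comp)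
        simpa using this
      refine (h1.cexp.mul (hasDerivAt_integral_cexp_poissonQuad l a t)).congr_deriv ?_
      simp only [hψ]
      push_cast
      ring
    have hb := norm_image_sub_le_of_norm_deriv_le_segment_01' (C := Real.exp v * R)
      (fun t _ => (hd t).hasDerivWithinAt) (fun t ht => by
        rw [norm_mul, Complex.norm_exp_ofReal]
        have := norm_deriv_cexp_poissonQuad_le l ha ht.1 ht.2.le
        gcongr
        have : t ^ 2 ≤ 1 := by nlinarith [ht.1, ht.2]
        nlinarith)
    have hψ0 : ψ 0 = 1 := by simp [hψ]
    simp only [hψ0, one_pow, one_mul, mul_one] at hb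
    have h2 : ψ 1 - Complex.exp (-v : ℝ) = Complex.exp (-v : ℝ) *
        (Complex.exp (v : ℝ) * ψ 1 - 1) := by
      rw [mul_sub, ← mul_assoc, ← Complex.exp_add]
      simp
    rw [h2, norm_mul, Complex.norm_exp_ofReal]
    have hb' : ‖Complex.exp (v : ℝ) * ψ 1 - 1‖ ≤ Real.exp v * R := by simpa using hb
    calc Real.exp (-v) * ‖Complex.exp (v : ℝ) * ψ 1 - 1‖ ≤ Real.exp (-v) * (Real.exp v * R) := by
          gcongr
      _ = R := by rw [← mul_assoc, ← Real.exp_add]; simp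
  have hψ1 : ψ 1 = ∫ n, Complex.exp ((poissonQuad l a n : ℝ) * Complex.I) ∂(poissonVec l) := by
    simp [hψ]
  rw [← hψ1]
  refine hmain.trans ?_
  have hcol : ∀ i, ∑ j, (l j : ℝ) * a i j ^ 2 = stepCol l a i := fun i =>
    Finset.sum_congr rfl fun j _ => by rw [ha]
  -- The third absolute moment is interpolated by `u ^ 3 ≤ c / 2 * u ^ 2 + u ^ 4 / (2 * c)`, so that
  -- only explicit even moments remain; `c` stays free.
  have h3 : ∀ i, ∫ n, |poissonLin l (a i) n| ^ 3 ∂(poissonVec l) ≤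
      c / 2 * (∑ j, (l j : ℝ) * a i j ^ 2) +
        (3 * stepCol l a i ^ 2 + ∑ j, (l j : ℝ) * a i j ^ 4) / (2 * c) := by
    intro i
    have hUE := expBounded_poissonLin l (a i)
    rw [← hcol, ← integral_poissonLin_pow_four, ← integral_poissonLin_sq, ← integral_const_mul,
      ← integral_div, ← integral_add (((hUE.pow 2).integrable l).const_mul _)
        (((hUE.pow 4).integrable l).div_const _)]
    refine integral_mono ((hUE.abs.pow 3).integrable l)
      ((((hUE.pow 2).integrable l).const_mul _).add (((hUE.pow 4).integrable l).div_const _))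
      fun n => ?_
    simp only
    set u := |poissonLin l (a i) n|
    rw [← sq_abs, show poissonLin l (a i) n ^ 4 = u ^ 4 from (Even.pow_abs ⟨2, rfl⟩ _).symm]
    rw [← sub_nonneg]
    have : c / 2 * u ^ 2 + u ^ 4 / (2 * c) - u ^ 3 = u ^ 2 * (c - u) ^ 2 / (2 * c) := by
      field_simp
      ring
    rw [this]
    positivity
  -- The same device, `u ≤ c / 2 + u ^ 2 / (2 * c)`, for the fluctuation of the squared gradient.
  have hW : ∫ n, |stepGradSq l a n - v| ∂(poissonVec l) ≤
      c / 2 + (4 * stepSum l (fun j k => stepContr l a a j k ^ 2) +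
        2 * ∑ j, (l j : ℝ) * stepCol l a j ^ 2) / (2 * c) := by
    have hWE := (expBounded_stepGradSq l a).sub (ExpBounded.const v)
    calc ∫ n, |stepGradSq l a n - v| ∂(poissonVec l)
        ≤ ∫ n, (c / 2 + (stepGradSq l a n - v) ^ 2 / (2 * c)) ∂(poissonVec l) := by
          refine integral_mono (hWE.abs.integrable l)
            ((integrable_const _).add (((hWE.pow 2).integrable l).div_const _)) fun n => ?_
          simp only
          rw [← sq_abs (stepGradSq l a n - v), ← sub_nonneg]
          set u := |stepGradSq l a n - v|
          have : c / 2 + u ^ 2 / (2 * c) - u = (c - u) ^ 2 / (2 * c) := by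
            field_simp
            ring
          rw [this]
          positivity
      _ = c / 2 + (∫ n, (stepGradSq l a n - v) ^ 2 ∂(poissonVec l)) / (2 * c) := by
          rw [integral_add (integrable_const _) (((hWE.pow 2).integrable l).div_const _),
            integral_div (2 * c)]
          simp
      _ ≤ _ := by
          gcongr
          exact integral_stepGradSq_sub_sq_le l a
  calc R ≤ 12 * ∑ i, (l i : ℝ) * (c / 2 * (∑ j, (l j : ℝ) * a i j ^ 2) +
        (3 * stepCol l a i ^ 2 + ∑ j, (l j : ℝ) * a i j ^ 4) / (2 * c)) +
        2 * (c / 2 + (4 * stepSum l (fun j k => stepContr l a a j k ^ 2) +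
        2 * ∑ j, (l j : ℝ) * stepCol l a j ^ 2) / (2 * c)) := by
        simp only [hR]
        gcongr with i
        exact h3 i
    _ = _ := by
        have e1 : v = ∑ i, (l i : ℝ) * ∑ j, (l j : ℝ) * a i j ^ 2 := by
          simp only [hv, stepSum, Finset.mul_sum]
          exact Finset.sum_congr rfl fun i _ => Finset.sum_congr rfl fun j _ => by ring
        have e2 : stepSum l (fun i j => a i j ^ 4) = ∑ i, (l i : ℝ) * ∑ j, (l j : ℝ) * a i j ^ 4 := by
          simp only [stepSum, Finset.mul_sum]
          exact Finset.sum_congr rfl fun i _ => Finset.sum_congr rfl fun j _ => by ring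
        have e3 : ∑ i, (l i : ℝ) * (c / 2 * (∑ j, (l j : ℝ) * a i j ^ 2) +
            (3 * stepCol l a i ^ 2 + ∑ j, (l j : ℝ) * a i j ^ 4) / (2 * c)) =
            c / 2 * v + (3 * ∑ i, (l i : ℝ) * stepCol l a i ^ 2 +
              stepSum l (fun i j => a i j ^ 4)) / (2 * c) := by
          rw [e1, e2, Finset.mul_sum, Finset.mul_sum, ← Finset.sum_add_distrib,
            Finset.sum_div, ← Finset.sum_add_distrib]
          exact Finset.sum_congr rfl fun i _ => by ring
        rw [e3]
        field_simp
        ring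

end FiniteCLT

end

noncomputable section

/-! ### Points of a counting measure on a space whose singletons need not be measurable. -/

section Diagonal

variable {Z : Type*} [MeasurableSpace Z]

lemma measurable_prodMk_self : Measurable (fun x : Z => (x, x)) :=
  measurable_id.prodMk measurable_id

lemma natMeasure_isFiniteMeasure {μ : Measure Z}
    (hμ : ∀ B : Set Z, MeasurableSet B → ∃ k : ℕ, μ B = (k : ℝ≥0∞)) : IsFiniteMeasure μ := by
  obtain ⟨k, hk⟩ := hμ Set.univ .univ
  exact ⟨by simp [hk]⟩

/-- For an `ℕ`-valued measure, the image on the diagonal is dominated by the product measure. -/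
lemma natMeasure_diag_le_prod {μ : Measure Z}
    (hμ : ∀ B : Set Z, MeasurableSet B → ∃ k : ℕ, μ B = (k : ℝ≥0∞)) {E : Set (Z × Z)}
    (hE : MeasurableSet E) : μ ((fun x => (x, x)) ⁻¹' E) ≤ (μ.prod μ) E := by
  obtain ⟨k, hk⟩ := hμ Set.univ .univ
  induction k using Nat.strong_induction_on generalizing μ with
  | _ k ih =>
  have hfin := natMeasure_isFiniteMeasure hμ
  -- Induction on the total mass. If some set carries part but not all of the mass, both
  -- restrictions have smaller mass and their squares `A × A` and `Aᶜ × Aᶜ` are disjoint.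
  by_cases hsplit : ∃ A, MeasurableSet A ∧ μ A ≠ 0 ∧ μ Aᶜ ≠ 0
  · obtain ⟨A, hA, hA1, hA2⟩ := hsplit
    have hstep : ∀ D, MeasurableSet D → μ Dᶜ ≠ 0 →
        μ ((fun x => (x, x)) ⁻¹' E ∩ D) ≤ (μ.prod μ) (E ∩ D ×ˢ D) := by
      intro D hD hDc
      have hμD : ∀ B : Set Z, MeasurableSet B → ∃ k : ℕ, μ.restrict D B = (k : ℝ≥0∞) := fun B hB => by
        rw [Measure.restrict_apply hB]
        exact hμ _ (hB.inter hD)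
      obtain ⟨j, hj⟩ := hμD Set.univ .univ
      have hjk : j < k := by
        have h1 : μ D + μ Dᶜ = k := by rw [measure_add_measure_compl hD, hk]
        rw [Measure.restrict_apply .univ, Set.univ_inter] at hj
        obtain ⟨i, hi⟩ := hμ _ hD.compl
        rw [hj, hi] at h1
        rw [hi] at hDc
        norm_cast at h1 hDc
        omega
      have h2 := ih j hjk hμD hj
      rwa [Measure.restrict_apply (measurable_prodMk_self hE), Measure.prod_restrict,
        Measure.restrict_apply hE] at h2
    have h1 := hstep A hA hA2
    have h2 := hstep Aᶜ hA.compl (by rwa [compl_compl])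
    rw [← measure_inter_add_sdiff ((fun x => (x, x)) ⁻¹' E) hA, Set.sdiff_eq]
    refine (add_le_add h1 h2).trans ?_
    rw [← measure_union _ (hE.inter (hA.compl.prod hA.compl))]
    · exact measure_mono (Set.union_subset Set.inter_subset_left Set.inter_subset_left)
    · refine Set.disjoint_left.2 fun p hp hq => hq.2.1 hp.2.1
  · push Not at hsplit
    rcases Nat.eq_zero_or_pos k with rfl | hkpos
    · have : μ = 0 := by simpa using hk
      simp [this]
    -- In the unsplittable case each measurable set has mass `0` or `k`, as for `k` copies of a
    -- Dirac mass, and the product measure lives on the diagonal with weight `k ≥ 1`.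
    · have hprod : μ.prod μ = (k : ℝ≥0∞) • μ.map (fun x => (x, x)) := by
        refine Measure.prod_eq fun s t hs ht => ?_
        rw [Measure.smul_apply, Measure.map_apply measurable_prodMk_self (hs.prod ht), smul_eq_mul]
        have hpre : (fun x : Z => (x, x)) ⁻¹' s ×ˢ t = s ∩ t := by ext x; simp
        rw [hpre]
        by_cases h1 : μ s = 0
        · rw [measure_mono_null Set.inter_subset_left h1, h1]; simp
        by_cases h2 : μ t = 0
        · rw [measure_mono_null Set.inter_subset_right h2, h2]; simp
        have h3 := hsplit s hs h1
        have h4 := hsplit t ht h2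
        have full : ∀ u, MeasurableSet u → μ uᶜ = 0 → μ u = k := fun u hu hc => by
          rw [← hk, ← measure_add_measure_compl hu, hc, add_zero]
        rw [full s hs h3, full t ht h4, full _ (hs.inter ht)]
        rw [Set.compl_inter]
        exact measure_union_null h3 h4
      rw [hprod, Measure.smul_apply, Measure.map_apply measurable_prodMk_self hE, smul_eq_mul]
      exact le_mul_of_one_le_left (zero_le) (by exact_mod_cast hkpos)

/-- With measurable singletons this would be the contribution of the atom `x`. In general, almost
every `x` with `(x, x) ∈ E` has a section of `E` of nonzero, hence integral mass at least one; this
is applied to superlevel sets at rational levels. -/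
lemma natMeasure_ae_diag_le_lintegral {μ : Measure Z}
    (hμ : ∀ B : Set Z, MeasurableSet B → ∃ k : ℕ, μ B = (k : ℝ≥0∞)) {f : Z × Z → ℝ≥0∞}
    (hf : Measurable f) : ∀ᵐ x ∂μ, f (x, x) ≤ ∫⁻ y, f (x, y) ∂μ := by
  have hfin := natMeasure_isFiniteMeasure hμ
  have hset : ∀ E : Set (Z × Z), MeasurableSet E →
      ∀ᵐ x ∂μ, (x, x) ∈ E → μ (Prod.mk x ⁻¹' E) ≠ 0 := by
    intro E hE
    set N : Set Z := {x | (x, x) ∈ E ∧ μ (Prod.mk x ⁻¹' E) = 0} with hN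
    have hNm : MeasurableSet N := (measurable_prodMk_self hE).inter
      (measurable_measure_prodMk_left hE (measurableSet_singleton 0))
    have h1 : (μ.prod μ) (E ∩ N ×ˢ Set.univ) = 0 := by
      rw [Measure.prod_apply (hE.inter (hNm.prod .univ))]
      refine (lintegral_eq_zero_iff (measurable_measure_prodMk_left
        (hE.inter (hNm.prod .univ)))).2 (ae_of_all _ fun x => ?_)
      by_cases hx : x ∈ N
      · exact measure_mono_null (fun y hy => hy.1) hx.2
      · have : Prod.mk x ⁻¹' (E ∩ N ×ˢ Set.univ) = ∅ := by
          ext y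
          simp [hx]
        simp [this]
    have h2 := natMeasure_diag_le_prod hμ (hE.inter (hNm.prod .univ))
    rw [h1, nonpos_iff_eq_zero] at h2
    have h3 : μ N = 0 := by
      refine measure_mono_null ?_ h2
      exact fun x hx => ⟨hx.1, hx, trivial⟩
    rw [ae_iff]
    refine measure_mono_null (fun x hx => ?_) h3
    simpa [hN] using hx
  have hall : ∀ᵐ x ∂μ, ∀ r : ℚ, (x, x) ∈ {p | ((Real.toNNReal r : ℝ≥0) : ℝ≥0∞) < f p} →
      μ (Prod.mk x ⁻¹' {p | ((Real.toNNReal r : ℝ≥0) : ℝ≥0∞) < f p}) ≠ 0 :=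
    ae_all_iff.2 fun r => hset _ (measurableSet_lt measurable_const hf)
  filter_upwards [hall] with x hx
  by_contra! hlt
  obtain ⟨r, hr0, hr1, hr2⟩ := ENNReal.lt_iff_exists_rat_btwn.1 hlt
  refine hx r hr2 ?_
  set A := Prod.mk x ⁻¹' {p | ((Real.toNNReal r : ℝ≥0) : ℝ≥0∞) < f p} with hA
  have hAm : MeasurableSet A := measurable_prodMk_left (measurableSet_lt measurable_const hf)
  obtain ⟨k, hk⟩ := hμ A hAm
  rw [hk]
  by_contra hne
  have hk1 : (1 : ℝ≥0∞) ≤ k := by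
    have : k ≠ 0 := by simpa using hne
    exact_mod_cast Nat.one_le_iff_ne_zero.2 this
  have h4 : ((Real.toNNReal r : ℝ≥0) : ℝ≥0∞) * μ A ≤ ∫⁻ y, f (x, y) ∂μ := by
    rw [← setLIntegral_const]
    refine (setLIntegral_mono (hf.comp measurable_prodMk_left) fun y hy => ?_).trans
      (setLIntegral_le_lintegral _ _)
    exact le_of_lt hy
  rw [hk] at h4
  exact absurd (((le_mul_of_one_le_right (zero_le) hk1).trans h4)) (not_le.2 hr1)

lemma IsCountableSumOfNatMeasures.sFinite {m : Measure Z} (hm : IsCountableSumOfNatMeasures m) :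
    SFinite m := by
  obtain ⟨μ, hμ, rfl⟩ := hm
  have := fun i => natMeasure_isFiniteMeasure (hμ i)
  infer_instance

lemma IsCountableSumOfNatMeasures.ae_diag_le_lintegral {m : Measure Z}
    (hm : IsCountableSumOfNatMeasures m) {f : Z × Z → ℝ≥0∞} (hf : Measurable f) :
    ∀ᵐ x ∂m, f (x, x) ≤ ∫⁻ y, f (x, y) ∂m := by
  obtain ⟨μ, hμ, rfl⟩ := hm
  rw [Measure.ae_sum_iff]
  intro i
  filter_upwards [natMeasure_ae_diag_le_lintegral (hμ i) hf] with x hx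
  exact hx.trans (lintegral_mono' (Measure.le_sum μ i) le_rfl)

end Diagonal

end

noncomputable section

/-! ### Absolute convergence and additivity of the double integral along one configuration. -/

section Pathwise

variable {Z : Type*} [MeasurableSpace Z]

/-- `∫ |f|` against the second factorial measure of `m`. -/
def factorialNorm (m : Measure Z) (f : Z × Z → ℝ) : ℝ≥0∞ :=
  ∫⁻ x, ((∫⁻ y, ‖f (x, y)‖ₑ ∂m) - ‖f (x, x)‖ₑ) ∂m

/-- The sum of the absolute versions of the four terms of the double Poisson integral. -/
def doubleNorm (m ν : Measure Z) (f : Z × Z → ℝ) : ℝ≥0∞ :=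
  factorialNorm m f + ∫⁻ x, ∫⁻ y, ‖f (x, y)‖ₑ ∂ν ∂m + ∫⁻ x, ∫⁻ y, ‖f (x, y)‖ₑ ∂m ∂ν +
    ∫⁻ p, ‖f p‖ₑ ∂(ν.prod ν)

/-- The double Poisson integral along a fixed point configuration `m`. -/
def doubleInt (m ν : Measure Z) (f : Z × Z → ℝ) : ℝ :=
  (∫ x, ((∫ y, f (x, y) ∂m) - f (x, x)) ∂m) - (∫ x, (∫ y, f (x, y) ∂ν) ∂m)
    - (∫ x, (∫ y, f (x, y) ∂m) ∂ν) + ∫ p, f p ∂(ν.prod ν)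

variable {m ν : Measure Z} {f g : Z × Z → ℝ}

lemma lintegral_enorm_ne_top_of_factorialNorm (hf : Measurable f)
    [SFinite m] (h : factorialNorm m f ≠ ∞) :
    ∀ᵐ x ∂m, ∫⁻ y, ‖f (x, y)‖ₑ ∂m ≠ ∞ := by
  have hmeas : Measurable fun x => (∫⁻ y, ‖f (x, y)‖ₑ ∂m) - ‖f (x, x)‖ₑ :=
    (Measurable.lintegral_prod_right' hf.enorm).sub
      (hf.comp measurable_prodMk_self).enorm
  filter_upwards [ae_lt_top hmeas h] with x hx htop
  -- Subtracting the finite diagonal value from `∞` leaves `∞`, so a finite factorial norm forces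
  -- the inner integral to be finite.
  rw [htop, ENNReal.top_sub enorm_ne_top] at hx
  exact lt_irrefl _ hx

lemma measurable_integral_sub_diag (hf : Measurable f) [SFinite m] :
    StronglyMeasurable fun x => (∫ y, f (x, y) ∂m) - f (x, x) :=
  (hf.stronglyMeasurable.integral_prod_right').sub
    (hf.comp measurable_prodMk_self).stronglyMeasurable

/-- The triangle inequality alone would put a plus sign in front of the diagonal term. Positive and
negative parts are treated separately: in each, the diagonal value is dominated by the inner
integral and can be subtracted. -/
lemma IsCountableSumOfNatMeasures.enorm_integral_sub_diag_le (hm : IsCountableSumOfNatMeasures m)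
    (hf : Measurable f) (h : factorialNorm m f ≠ ∞) :
    ∀ᵐ x ∂m, ‖(∫ y, f (x, y) ∂m) - f (x, x)‖ₑ ≤ (∫⁻ y, ‖f (x, y)‖ₑ ∂m) - ‖f (x, x)‖ₑ := by
  have := hm.sFinite
  have hpos := hm.ae_diag_le_lintegral (f := fun p => ENNReal.ofReal (f p)) hf.ennreal_ofReal
  have hneg := hm.ae_diag_le_lintegral (f := fun p => ENNReal.ofReal (-f p))
    hf.neg.ennreal_ofReal
  filter_upwards [hpos, hneg, lintegral_enorm_ne_top_of_factorialNorm hf h] with x h1 h2 h3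
  have hfx : Measurable fun y => f (x, y) := hf.comp measurable_prodMk_left
  have hint : Integrable (fun y => f (x, y)) m := ⟨hfx.aestronglyMeasurable, h3.lt_top⟩
  have e1 : ∀ r : ℝ, ENNReal.ofReal r + ENNReal.ofReal (-r) = ‖r‖ₑ := by
    intro r
    rw [Real.enorm_eq_ofReal_abs]
    rcases le_total 0 r with hr | hr
    · rw [ENNReal.ofReal_of_nonpos (neg_nonpos.2 hr), add_zero, abs_of_nonneg hr]
    · rw [ENNReal.ofReal_of_nonpos hr, zero_add, abs_of_nonpos hr]
  have hle : ∀ r : ℝ, ENNReal.ofReal r ≤ ‖r‖ₑ := fun r => by rw [← e1]; exact le_self_add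
  have hle' : ∀ r : ℝ, ENNReal.ofReal (-r) ≤ ‖r‖ₑ := fun r => by rw [← e1]; exact le_add_self
  set A := ∫⁻ y, ENNReal.ofReal (f (x, y)) ∂m with hA
  set B := ∫⁻ y, ENNReal.ofReal (-f (x, y)) ∂m with hB
  have hAB : ∫⁻ y, ‖f (x, y)‖ₑ ∂m = A + B := by
    rw [hA, hB, ← lintegral_add_left hfx.ennreal_ofReal]
    simp_rw [e1]
  have hAt : A ≠ ∞ := ne_top_of_le_ne_top h3 (hAB ▸ le_self_add)
  have hBt : B ≠ ∞ := ne_top_of_le_ne_top h3 (hAB ▸ le_add_self)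
  have e2 : ∀ r : ℝ, r = (ENNReal.ofReal r).toReal - (ENNReal.ofReal (-r)).toReal := by
    intro r
    rw [ENNReal.toReal_ofReal', ENNReal.toReal_ofReal', max_zero_sub_max_neg_zero_eq_self]
  rw [integral_eq_lintegral_pos_part_sub_lintegral_neg_part hint, hAB, ← hA, ← hB, ← e1 (f (x, x))]
  set a := ENNReal.ofReal (f (x, x)) with ha
  set b := ENNReal.ofReal (-f (x, x)) with hb
  have hat : a ≠ ∞ := ENNReal.ofReal_ne_top
  have hbt : b ≠ ∞ := ENNReal.ofReal_ne_top
  rw [e2 (f (x, x)), ← ha, ← hb]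
  have e3 : A.toReal - B.toReal - (a.toReal - b.toReal) = (A - a).toReal - (B - b).toReal := by
    rw [ENNReal.toReal_sub_of_le h1 hAt, ENNReal.toReal_sub_of_le h2 hBt]
    ring
  have e4 : A + B - (a + b) = (A - a) + (B - b) := by
    refine ENNReal.sub_eq_of_eq_add (by finiteness) ?_
    nth_rewrite 1 [← tsub_add_cancel_of_le h1, ← tsub_add_cancel_of_le h2]
    ring
  rw [e3, e4]
  refine (enorm_sub_le).trans (add_le_add ?_ ?_)
  · rw [Real.enorm_of_nonneg ENNReal.toReal_nonneg]
    exact ENNReal.ofReal_toReal_le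
  · rw [Real.enorm_of_nonneg ENNReal.toReal_nonneg]
    exact ENNReal.ofReal_toReal_le

lemma doubleNorm_ne_top [SFinite m] [SFinite ν] (hf : Measurable f) (h : doubleNorm m ν f ≠ ∞) :
    factorialNorm m f ≠ ∞ ∧ Integrable f (m.prod ν) ∧ Integrable f (ν.prod m) ∧
      Integrable f (ν.prod ν) := by
  simp only [doubleNorm, ne_eq, ENNReal.add_eq_top, not_or] at h
  obtain ⟨⟨⟨h1, h2⟩, h3⟩, h4⟩ := h
  refine ⟨h1, ⟨hf.aestronglyMeasurable, ?_⟩, ⟨hf.aestronglyMeasurable, ?_⟩,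
    ⟨hf.aestronglyMeasurable, ?_⟩⟩ <;> rw [hasFiniteIntegral_iff_enorm]
  · rw [lintegral_prod _ hf.enorm.aemeasurable]; exact Ne.lt_top h2
  · rw [lintegral_prod _ hf.enorm.aemeasurable]; exact Ne.lt_top h3
  · exact Ne.lt_top h4

lemma IsCountableSumOfNatMeasures.integrable_integral_sub_diag
    (hm : IsCountableSumOfNatMeasures m)
    (hf : Measurable f) (h : factorialNorm m f ≠ ∞) :
    Integrable (fun x => (∫ y, f (x, y) ∂m) - f (x, x)) m := by
  have := hm.sFinite
  refine ⟨(measurable_integral_sub_diag hf).aestronglyMeasurable, ?_⟩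
  rw [hasFiniteIntegral_iff_enorm]
  exact (lintegral_mono_ae (hm.enorm_integral_sub_diag_le hf h)).trans_lt (Ne.lt_top h)

lemma IsCountableSumOfNatMeasures.enorm_doubleInt_le [SFinite ν]
    (hm : IsCountableSumOfNatMeasures m)
    (hf : Measurable f) (h : doubleNorm m ν f ≠ ∞) : ‖doubleInt m ν f‖ₑ ≤ doubleNorm m ν f := by
  have := hm.sFinite
  obtain ⟨h1, h2, h3, h4⟩ := doubleNorm_ne_top hf h
  rw [doubleInt, doubleNorm]
  refine (enorm_add_le _ _).trans (add_le_add ?_ (enorm_integral_le_lintegral_enorm _))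
  refine (enorm_sub_le).trans (add_le_add ?_ ?_)
  · refine (enorm_sub_le).trans (add_le_add ?_ ?_)
    · exact (enorm_integral_le_lintegral_enorm _).trans
        (lintegral_mono_ae (hm.enorm_integral_sub_diag_le hf h1))
    · exact (enorm_integral_le_lintegral_enorm _).trans
        (lintegral_mono fun x => enorm_integral_le_lintegral_enorm _)
  · exact (enorm_integral_le_lintegral_enorm _).trans
      (lintegral_mono fun x => enorm_integral_le_lintegral_enorm _)

lemma IsCountableSumOfNatMeasures.doubleInt_sub [SFinite ν] (hm : IsCountableSumOfNatMeasures m)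
    (hf : Measurable f) (hg : Measurable g) (h : doubleNorm m ν f ≠ ∞)
    (h' : doubleNorm m ν g ≠ ∞) :
    doubleInt m ν (f - g) = doubleInt m ν f - doubleInt m ν g := by
  have := hm.sFinite
  obtain ⟨h1, h2, h3, h4⟩ := doubleNorm_ne_top hf h
  obtain ⟨h1', h2', h3', h4'⟩ := doubleNorm_ne_top hg h'
  have e1 : ∫ x, ((∫ y, (f - g) (x, y) ∂m) - (f - g) (x, x)) ∂m =
      (∫ x, ((∫ y, f (x, y) ∂m) - f (x, x)) ∂m) - ∫ x, ((∫ y, g (x, y) ∂m) - g (x, x)) ∂m := by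
    rw [← integral_sub (hm.integrable_integral_sub_diag hf h1)
      (hm.integrable_integral_sub_diag hg h1')]
    refine integral_congr_ae ?_
    filter_upwards [lintegral_enorm_ne_top_of_factorialNorm hf h1,
      lintegral_enorm_ne_top_of_factorialNorm hg h1'] with x hx hx'
    have i1 : Integrable (fun y => f (x, y)) m :=
      ⟨(hf.comp measurable_prodMk_left).aestronglyMeasurable, hx.lt_top⟩
    have i2 : Integrable (fun y => g (x, y)) m :=
      ⟨(hg.comp measurable_prodMk_left).aestronglyMeasurable, hx'.lt_top⟩
    simp only [Pi.sub_apply]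
    rw [integral_sub i1 i2]
    ring
  have e2 : ∀ (a b : Measure Z) [SFinite a] [SFinite b], Integrable f (a.prod b) →
      Integrable g (a.prod b) → ∫ x, ∫ y, (f - g) (x, y) ∂b ∂a =
      (∫ x, ∫ y, f (x, y) ∂b ∂a) - ∫ x, ∫ y, g (x, y) ∂b ∂a := by
    intro a b _ _ hfi hgi
    rw [← integral_prod _ (hfi.sub hgi), ← integral_prod _ hfi, ← integral_prod _ hgi]
    exact integral_sub hfi hgi
  rw [doubleInt, e1, e2 m ν h2 h2', e2 ν m h3 h3', doubleInt, doubleInt]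
  simp only [Pi.sub_apply]
  rw [integral_sub h4 h4']
  ring

end Pathwise

end

noncomputable section

/-! ### Finite-dimensional laws and the first two moment measures of a Poisson process. -/

section PoissonProcess

variable {Ω Z : Type*} [MeasurableSpace Ω] [MeasurableSpace Z] {P : Measure Ω}
  {ν : Measure Z} {η : Ω → Measure Z}

/-- The intensities of finitely many cells. -/
def cellMass {Z : Type*} [MeasurableSpace Z] (ν : Measure Z) {ι : Type*} (B : ι → Set Z) (i : ι) :
    ℝ≥0 := (ν (B i)).toNNReal

lemma IsPoissonPointProcess.measurable_apply (hη : IsPoissonPointProcess η ν P) {B : Set Z}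
    (hB : MeasurableSet B) : Measurable fun ω => η ω B :=
  (Measure.measurable_coe hB).comp hη.measurable

lemma IsPoissonPointProcess.iIndepFun_cells (hη : IsPoissonPointProcess η ν P)
    {ι : Type*} [Fintype ι] {B : ι → Set Z} (hB : ∀ i, MeasurableSet (B i))
    (hd : Pairwise (fun i j => Disjoint (B i) (B j))) : iIndepFun (fun i ω => η ω (B i)) P := by
  have e := Fintype.equivFin ι
  have := (hη.indep (Fintype.card ι) (fun k => B (e.symm k)) (fun k => hB _)
    fun i j hij => hd (fun h => hij (e.symm.injective h))).precomp e.injective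
  simpa using this

lemma IsPoissonPointProcess.map_cells [IsProbabilityMeasure P]
    (hη : IsPoissonPointProcess η ν P)
    {ι : Type*} [Fintype ι] {B : ι → Set Z} (hB : ∀ i, MeasurableSet (B i))
    (hd : Pairwise (fun i j => Disjoint (B i) (B j))) (hfin : ∀ i, ν (B i) < ∞) :
    P.map (fun ω i => η ω (B i)) =
      (poissonVec (cellMass ν B)).map (fun n i => (n i : ℝ≥0∞)) := by
  rw [(iIndepFun_iff_map_fun_eq_pi_map fun i => (hη.measurable_apply (hB i)).aemeasurable).1
    (hη.iIndepFun_cells hB hd)]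
  have : ∀ i, P.map (fun ω => η ω (B i)) =
      (poissonMeasure (cellMass ν B i)).map (fun k : ℕ => (k : ℝ≥0∞)) :=
    fun i => hη.poisson (B i) (hB i) (hfin i)
  simp_rw [this]
  rw [Measure.pi_map_pi fun i => Measurable.of_discrete.aemeasurable]

lemma IsPoissonPointProcess.lintegral_cells [IsProbabilityMeasure P]
    (hη : IsPoissonPointProcess η ν P)
    {ι : Type*} [Fintype ι] {B : ι → Set Z} (hB : ∀ i, MeasurableSet (B i))
    (hd : Pairwise (fun i j => Disjoint (B i) (B j))) (hfin : ∀ i, ν (B i) < ∞)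
    {Φ : (ι → ℝ≥0∞) → ℝ≥0∞} (hΦ : Measurable Φ) :
    ∫⁻ ω, Φ (fun i => η ω (B i)) ∂P =
      ∫⁻ n, Φ (fun i => (n i : ℝ≥0∞)) ∂(poissonVec (cellMass ν B)) := by
  have hm : Measurable fun ω i => η ω (B i) :=
    measurable_pi_lambda _ fun i => hη.measurable_apply (hB i)
  rw [← lintegral_map hΦ hm, hη.map_cells hB hd hfin, lintegral_map hΦ .of_discrete]

lemma IsPoissonPointProcess.integral_cells [IsProbabilityMeasure P] {E : Type*} [NormedAddCommGroup E] [NormedSpace ℝ E]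
    (hη : IsPoissonPointProcess η ν P)
    {ι : Type*} [Fintype ι] {B : ι → Set Z} (hB : ∀ i, MeasurableSet (B i))
    (hd : Pairwise (fun i j => Disjoint (B i) (B j))) (hfin : ∀ i, ν (B i) < ∞)
    {Φ : (ι → ℝ≥0∞) → E} (hΦ : StronglyMeasurable Φ) :
    ∫ ω, Φ (fun i => η ω (B i)) ∂P =
      ∫ n, Φ (fun i => (n i : ℝ≥0∞)) ∂(poissonVec (cellMass ν B)) := by
  have hm : Measurable fun ω i => η ω (B i) :=
    measurable_pi_lambda _ fun i => hη.measurable_apply (hB i)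
  rw [← integral_map hm.aemeasurable hΦ.aestronglyMeasurable, hη.map_cells hB hd hfin,
    integral_map Measurable.of_discrete.aemeasurable hΦ.aestronglyMeasurable]

lemma lintegral_poissonVec_coord_mul {ι : Type*} [Fintype ι] [DecidableEq ι] (l : ι → ℝ≥0) (i : ι)
    (G : (ι → ℕ) → ℝ≥0∞) :
    ∫⁻ n, (n i : ℝ≥0∞) * G n ∂(poissonVec l) =
      l i * ∫⁻ n, G (n + Pi.single i 1) ∂(poissonVec l) := by
  have h1 := congrArg (fun μ : Measure (ι → ℕ) => ∫⁻ n, G n ∂μ) (poissonVec_withDensity_coord l i)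
  rw [lintegral_smul_measure, lintegral_map .of_discrete .of_discrete,
    lintegral_withDensity_eq_lintegral_mul _ .of_discrete .of_discrete] at h1
  simpa using h1

lemma lintegral_poissonVec_coord {ι : Type*} [Fintype ι] (l : ι → ℝ≥0) (i : ι) :
    ∫⁻ n, (n i : ℝ≥0∞) ∂(poissonVec l) = l i := by
  classical
  have := lintegral_poissonVec_coord_mul l i (fun _ => 1)
  simpa using this

lemma lintegral_poissonVec_coord_mul_coord {ι : Type*} [Fintype ι] [DecidableEq ι] (l : ι → ℝ≥0)
    (i j : ι) :
    ∫⁻ n, (n i : ℝ≥0∞) * (n j : ℝ≥0∞) ∂(poissonVec l) = l i * (l j + if j = i then 1 else 0) := by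
  rw [lintegral_poissonVec_coord_mul]
  congr 1
  have : ∀ n : ι → ℕ, (((n + Pi.single i 1 : ι → ℕ) j : ℕ) : ℝ≥0∞) =
      n j + if j = i then 1 else 0 := by
    intro n
    by_cases h : j = i
    · subst h; simp
    · simp [h]
  simp_rw [this]
  rw [lintegral_add_left .of_discrete, lintegral_poissonVec_coord]
  simp

lemma IsPoissonPointProcess.lintegral_apply [IsProbabilityMeasure P] (hη : IsPoissonPointProcess η ν P) {B : Set Z}
    (hB : MeasurableSet B) (hfin : ν B < ∞) : ∫⁻ ω, η ω B ∂P = ν B := by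
  have := hη.lintegral_cells (ι := Unit) (B := fun _ => B) (fun _ => hB)
    (fun i j h => (h rfl).elim) (fun _ => hfin) (Φ := fun x => x ()) (measurable_pi_apply _)
  rw [this, lintegral_poissonVec_coord]
  exact ENNReal.coe_toNNReal hfin.ne

lemma IsPoissonPointProcess.ae_apply_lt_top [IsProbabilityMeasure P] (hη : IsPoissonPointProcess η ν P) {B : Set Z}
    (hB : MeasurableSet B) (hfin : ν B < ∞) : ∀ᵐ ω ∂P, η ω B < ∞ :=
  ae_lt_top (hη.measurable_apply hB) (by rw [hη.lintegral_apply hB hfin]; exact hfin.ne)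

/-- `A` and `B` are cut into three disjoint cells with independent counts. Only the square of the
count in the common cell brings in the extra term. -/
lemma IsPoissonPointProcess.lintegral_apply_mul_apply [IsProbabilityMeasure P]
    (hη : IsPoissonPointProcess η ν P)
    {A B : Set Z} (hA : MeasurableSet A) (hB : MeasurableSet B) (hfA : ν A < ∞) (hfB : ν B < ∞) :
    ∫⁻ ω, η ω A * η ω B ∂P = ν A * ν B + ν (A ∩ B) := by
  let C : Fin 3 → Set Z := ![A \ B, A ∩ B, B \ A]
  have hC : ∀ i, MeasurableSet (C i) := by
    intro i
    fin_cases i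
    · exact hA.diff hB
    · exact hA.inter hB
    · exact hB.diff hA
  have hCf : ∀ i, ν (C i) < ∞ := by
    intro i
    fin_cases i
    · exact (measure_mono Set.sdiff_subset).trans_lt hfA
    · exact (measure_mono Set.inter_subset_left).trans_lt hfA
    · exact (measure_mono Set.sdiff_subset).trans_lt hfB
  have d01 : Disjoint (A \ B) (A ∩ B) := Set.disjoint_left.2 fun x h h' => h.2 h'.2
  have d02 : Disjoint (A \ B) (B \ A) := Set.disjoint_left.2 fun x h h' => h.2 h'.1
  have d12 : Disjoint (A ∩ B) (B \ A) := Set.disjoint_left.2 fun x h h' => h'.2 h.1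
  have hCd : Pairwise fun i j => Disjoint (C i) (C j) := by
    intro i j hij
    fin_cases i <;> fin_cases j <;> first | exact absurd rfl hij | skip
    · exact d01
    · exact d02
    · exact d01.symm
    · exact d12
    · exact d02.symm
    · exact d12.symm
  have hsplit : ∀ m : Measure Z, m A = m (C 0) + m (C 1) ∧ m B = m (C 1) + m (C 2) := by
    intro m
    refine ⟨?_, ?_⟩
    · rw [add_comm]; exact (measure_inter_add_sdiff A hB).symm
    · rw [show C 1 = B ∩ A from Set.inter_comm _ _]
      exact (measure_inter_add_sdiff B hA).symm
  have h1 : ∀ ω, η ω A * η ω B = (η ω (C 0) + η ω (C 1)) * (η ω (C 1) + η ω (C 2)) := fun ω => by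
    rw [(hsplit (η ω)).1, (hsplit (η ω)).2]
  simp_rw [h1]
  rw [hη.lintegral_cells hC hCd hCf
    (Φ := fun x => (x 0 + x 1) * (x 1 + x 2)) (by fun_prop)]
  have h2 : ∀ n : Fin 3 → ℕ, ((n 0 : ℝ≥0∞) + n 1) * (n 1 + n 2) =
      n 0 * n 1 + (n 0 * n 2 + (n 1 * n 1 + n 1 * n 2)) := fun n => by ring
  simp_rw [h2]
  rw [lintegral_add_left .of_discrete, lintegral_add_left .of_discrete,
    lintegral_add_left .of_discrete, lintegral_poissonVec_coord_mul_coord,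
    lintegral_poissonVec_coord_mul_coord, lintegral_poissonVec_coord_mul_coord,
    lintegral_poissonVec_coord_mul_coord]
  have hl : ∀ i, ((cellMass ν C i : ℝ≥0) : ℝ≥0∞) = ν (C i) := fun i =>
    ENNReal.coe_toNNReal (hCf i).ne
  simp only [hl]
  rw [(hsplit ν).1, (hsplit ν).2, show A ∩ B = C 1 from rfl]
  simp
  ring

/-- A Poisson process agrees almost surely with an s-finite kernel. -/
lemma IsPoissonPointProcess.exists_kernel [IsProbabilityMeasure P] [SigmaFinite ν]
    (hη : IsPoissonPointProcess η ν P) :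
    ∃ κ : Kernel Ω Z, IsSFiniteKernel κ ∧ ∀ᵐ ω ∂P, κ ω = η ω := by
  set D : ℕ → Set Z := disjointed (spanningSets ν) with hD
  have hDm : ∀ i, MeasurableSet (D i) := MeasurableSet.disjointed fun i => measurableSet_spanningSets ν i
  have hDf : ∀ i, ν (D i) < ∞ := fun i =>
    (measure_mono (disjointed_subset _ _)).trans_lt (measure_spanningSets_lt_top ν i)
  let K : Kernel Ω Z := ⟨η, hη.measurable⟩
  have hS : ∀ i j : ℕ, MeasurableSet {ω | η ω (D i) ≠ ∞ ∧ ⌊(η ω (D i)).toReal⌋₊ = j} := by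
    intro i j
    have h1 := hη.measurable_apply (hDm i)
    exact (h1 (measurableSet_singleton ∞).compl).inter
      ((Nat.measurable_floor.comp h1.ennreal_toReal) (measurableSet_singleton j))
  -- A finite kernel needs a bound uniform in `ω`. Hence `Ω` is cut according to the integer part
  -- `j` of the mass of `D i`; the event of infinite mass is null and is dropped.
  let κ' : ℕ → ℕ → Kernel Ω Z := fun i j => Kernel.piecewise (hS i j) (K.restrict (hDm i)) 0
  have hfin : ∀ i j, IsFiniteKernel (κ' i j) := by
    intro i j
    refine ⟨⟨(j + 1 : ℕ), ENNReal.natCast_lt_top _, fun ω => ?_⟩⟩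
    rw [Kernel.piecewise_apply']
    split_ifs with h
    · rw [Kernel.restrict_apply, Measure.restrict_apply_univ]
      change η ω (D i) ≤ _
      rw [← ENNReal.ofReal_toReal h.1, ← ENNReal.ofReal_natCast]
      refine ENNReal.ofReal_le_ofReal ?_
      rw [← h.2]
      push_cast
      exact (Nat.lt_floor_add_one _).le
    · simp
  refine ⟨Kernel.sum fun i => Kernel.sum fun j => κ' i j,
    inferInstance, ?_⟩
  have hae : ∀ᵐ ω ∂P, ∀ i, η ω (D i) < ∞ := ae_all_iff.2 fun i => hη.ae_apply_lt_top (hDm i) (hDf i)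
  filter_upwards [hae] with ω hω
  rw [Kernel.sum_apply]
  have : ∀ i, (Kernel.sum fun j => κ' i j) ω = (η ω).restrict (D i) := by
    intro i
    ext s hs
    rw [Kernel.sum_apply' _ _ hs, tsum_eq_single ⌊(η ω (D i)).toReal⌋₊]
    · rw [Kernel.piecewise_apply', if_pos ⟨(hω i).ne, rfl⟩, Kernel.restrict_apply]
      rfl
    · intro j hj
      rw [Kernel.piecewise_apply', if_neg fun h => hj h.2.symm]
      rfl
  simp_rw [this]
  rw [← Measure.restrict_iUnion (disjoint_disjointed _) hDm, iUnion_disjointed, iUnion_spanningSets,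
    Measure.restrict_univ]

lemma generateFrom_measurableSet_lt_top (ν : Measure Z) [SigmaFinite ν] :
    MeasurableSpace.generateFrom {B : Set Z | MeasurableSet B ∧ ν B < ∞} = ‹MeasurableSpace Z› := by
  refine le_antisymm (MeasurableSpace.generateFrom_le fun B hB => hB.1) fun B hB => ?_
  have : B = ⋃ i, B ∩ spanningSets ν i := by
    rw [← Set.inter_iUnion, iUnion_spanningSets, Set.inter_univ]
  rw [this]
  refine MeasurableSet.iUnion fun i => MeasurableSpace.measurableSet_generateFrom
    ⟨MeasurableSet.inter hB (measurableSet_spanningSets ν i), ?_⟩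
  exact (measure_mono Set.inter_subset_right).trans_lt (measure_spanningSets_lt_top ν i)

lemma isPiSystem_measurableSet_lt_top (ν : Measure Z) :
    IsPiSystem {B : Set Z | MeasurableSet B ∧ ν B < ∞} := fun _ hA _ hB _ =>
  ⟨hA.1.inter hB.1, (measure_mono Set.inter_subset_left).trans_lt hA.2⟩

/-- Campbell's formula. -/
lemma IsPoissonPointProcess.lintegral_lintegral [IsProbabilityMeasure P] [SigmaFinite ν]
    (hη : IsPoissonPointProcess η ν P)
    {f : Z → ℝ≥0∞} (hf : Measurable f) : ∫⁻ ω, ∫⁻ x, f x ∂(η ω) ∂P = ∫⁻ x, f x ∂ν := by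
  have h : P.bind η = ν := by
    symm
    refine Measure.ext_of_generateFrom_of_iUnion _ (spanningSets ν)
      (generateFrom_measurableSet_lt_top ν).symm (isPiSystem_measurableSet_lt_top ν)
      (iUnion_spanningSets ν) (fun i => ⟨measurableSet_spanningSets ν i,
        measure_spanningSets_lt_top ν i⟩) (fun i => (measure_spanningSets_lt_top ν i).ne) ?_
    intro B hB
    rw [Measure.bind_apply hB.1 hη.measurable.aemeasurable, hη.lintegral_apply hB.1 hB.2]
  rw [← Measure.lintegral_bind hη.measurable.aemeasurable hf.aemeasurable, h]

/-- The second moment measure of a Poisson process. -/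
lemma IsPoissonPointProcess.lintegral_lintegral_lintegral [IsProbabilityMeasure P]
    [SigmaFinite ν]
    (hη : IsPoissonPointProcess η ν P) {f : Z × Z → ℝ≥0∞} (hf : Measurable f) :
    ∫⁻ ω, ∫⁻ x, ∫⁻ y, f (x, y) ∂(η ω) ∂(η ω) ∂P =
      ∫⁻ p, f p ∂(ν.prod ν) + ∫⁻ x, f (x, x) ∂ν := by
  obtain ⟨κ, hκ, hκη⟩ := hη.exists_kernel
  have h : P.bind (κ ×ₖ κ) = ν.prod ν + ν.map fun x => (x, x) := by
    set C := {B : Set Z | MeasurableSet B ∧ ν B < ∞} with hC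
    have hspan : IsCountablySpanning C := ⟨spanningSets ν, fun i =>
      ⟨measurableSet_spanningSets ν i, measure_spanningSets_lt_top ν i⟩, iUnion_spanningSets ν⟩
    symm
    refine Measure.ext_of_generateFrom_of_iUnion (Set.image2 (· ×ˢ ·) C C)
      (fun i => spanningSets ν i ×ˢ spanningSets ν i)
      (generateFrom_eq_prod (generateFrom_measurableSet_lt_top ν)
        (generateFrom_measurableSet_lt_top ν) hspan hspan).symm
      ((isPiSystem_measurableSet_lt_top ν).prod (isPiSystem_measurableSet_lt_top ν)) ?_
      (fun i => ⟨_, ⟨measurableSet_spanningSets ν i, measure_spanningSets_lt_top ν i⟩, _,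
        ⟨measurableSet_spanningSets ν i, measure_spanningSets_lt_top ν i⟩, rfl⟩) ?_ ?_
    · rw [Set.iUnion_prod_of_monotone (monotone_spanningSets ν) (monotone_spanningSets ν),
        iUnion_spanningSets, Set.univ_prod_univ]
    · intro i
      have hi := measure_spanningSets_lt_top ν i
      rw [Measure.add_apply, Measure.prod_prod, Measure.map_apply measurable_prodMk_self
        ((measurableSet_spanningSets ν i).prod (measurableSet_spanningSets ν i))]
      refine ENNReal.add_ne_top.2 ⟨ENNReal.mul_ne_top hi.ne hi.ne, ?_⟩
      exact ((measure_mono fun x hx => hx.1).trans_lt hi).ne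
    · rintro _ ⟨A, hA, B, hB, rfl⟩
      rw [Measure.bind_apply (hA.1.prod hB.1) (Kernel.aemeasurable _), Measure.add_apply,
        Measure.prod_prod, Measure.map_apply measurable_prodMk_self (hA.1.prod hB.1)]
      have hpre : (fun x : Z => (x, x)) ⁻¹' A ×ˢ B = A ∩ B := by ext x; simp
      rw [hpre, ← hη.lintegral_apply_mul_apply hA.1 hB.1 hA.2 hB.2]
      refine lintegral_congr_ae ?_
      filter_upwards [hκη] with ω hω
      rw [Kernel.prod_apply, Measure.prod_prod, hω]
  have h2 := Measure.lintegral_bind (m := P) (κ ×ₖ κ).aemeasurable (hf.aemeasurable)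
  rw [h, lintegral_add_measure, lintegral_map hf measurable_prodMk_self] at h2
  rw [h2]
  refine lintegral_congr_ae ?_
  filter_upwards [hκη] with ω hω
  rw [Kernel.lintegral_prod _ _ _ hf, hω]

end PoissonProcess

end

noncomputable section

/-! ### Expectations of the absolute versions of the four terms. -/

section DoubleNorm

variable {Ω Z : Type*} [MeasurableSpace Ω] [MeasurableSpace Z] {P : Measure Ω}
  {ν : Measure Z} {η : Ω → Measure Z} {f : Z × Z → ℝ}

lemma measurable_lintegral_kernel_snd (κ : Kernel Ω Z) [IsSFiniteKernel κ] {F : Z × Z → ℝ≥0∞}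
    (hF : Measurable F) : Measurable fun a : Ω × Z => ∫⁻ y, F (a.2, y) ∂(κ a.1) := by
  have := Measurable.lintegral_kernel_prod_right' (κ := Kernel.prodMkRight Z κ)
    (f := fun q : (Ω × Z) × Z => F (q.1.2, q.2)) (by fun_prop)
  exact this

lemma measurable_setLIntegral_sub_diag (κ : Kernel Ω Z) [IsSFiniteKernel κ] (hf : Measurable f)
    {D : Set Z} (hD : MeasurableSet D) :
    Measurable fun ω => ∫⁻ x in D, ((∫⁻ y, ‖f (x, y)‖ₑ ∂(κ ω)) - ‖f (x, x)‖ₑ) ∂(κ ω) := by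
  have h1 := measurable_lintegral_kernel_snd κ hf.enorm
  have h2 : Measurable fun x : Z => ‖f (x, x)‖ₑ := (hf.comp measurable_prodMk_self).enorm
  have h3 : Measurable fun a : Ω × Z => (Set.univ ×ˢ D).indicator
      (fun a => (∫⁻ y, ‖f (a.2, y)‖ₑ ∂(κ a.1)) - ‖f (a.2, a.2)‖ₑ) a :=
    (h1.sub (h2.comp measurable_snd)).indicator (MeasurableSet.univ.prod hD)
  have := h3.lintegral_kernel_prod_right' (κ := κ)
  convert this using 2 with ω
  rw [← lintegral_indicator hD]
  refine lintegral_congr fun x => ?_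
  by_cases hx : x ∈ D <;> simp [hx]

/-- The second moment measure is `ν²` plus the diagonal, and Campbell's formula computes the
diagonal separately. The finiteness assumption is what permits cancellation in `ℝ≥0∞`. -/
lemma IsPoissonPointProcess.lintegral_setLIntegral_sub_diag [IsProbabilityMeasure P]
    [SigmaFinite ν] (hη : IsPoissonPointProcess η ν P) (hf : Measurable f)
    {D : Set Z} (hD : MeasurableSet D) (hDf : ∫⁻ x in D, ‖f (x, x)‖ₑ ∂ν ≠ ∞) :
    ∫⁻ ω, ∫⁻ x in D, ((∫⁻ y, ‖f (x, y)‖ₑ ∂(η ω)) - ‖f (x, x)‖ₑ) ∂(η ω) ∂P =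
      ∫⁻ x in D, ∫⁻ y, ‖f (x, y)‖ₑ ∂ν ∂ν := by
  obtain ⟨κ, hκ, hκη⟩ := hη.exists_kernel
  have hd : Measurable fun x : Z => ‖f (x, x)‖ₑ := (hf.comp measurable_prodMk_self).enorm
  have hDF : Measurable ((D ×ˢ Set.univ).indicator fun p : Z × Z => ‖f p‖ₑ) :=
    hf.enorm.indicator (hD.prod .univ)
  have hindD : ∀ x, (D ×ˢ Set.univ).indicator (fun p : Z × Z => ‖f p‖ₑ) (x, x) =
      D.indicator (fun x => ‖f (x, x)‖ₑ) x := fun x => by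
    by_cases hx : x ∈ D <;> simp [hx]
  have hindI : ∀ (m : Measure Z) x, ∫⁻ y, (D ×ˢ Set.univ).indicator (fun p : Z × Z => ‖f p‖ₑ) (x, y)
      ∂m = D.indicator (fun x => ∫⁻ y, ‖f (x, y)‖ₑ ∂m) x := fun m x => by
    by_cases hx : x ∈ D <;> simp [hx]
  have h1 := hη.lintegral_lintegral_lintegral hDF
  rw [lintegral_prod _ hDF.aemeasurable] at h1
  simp_rw [hindI, hindD, lintegral_indicator hD] at h1
  rw [← ENNReal.add_left_inj hDf, ← h1]
  have h2 := hη.lintegral_lintegral (hd.indicator hD)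
  simp_rw [lintegral_indicator hD] at h2
  rw [← h2, ← lintegral_add_left']
  · refine lintegral_congr fun ω => ?_
    have hs := (hη.counting ω).sFinite
    rw [← lintegral_add_right _ hd]
    refine lintegral_congr_ae ?_
    filter_upwards [ae_restrict_of_ae ((hη.counting ω).ae_diag_le_lintegral hf.enorm)] with x hx
    exact tsub_add_cancel_of_le hx
  · refine (measurable_setLIntegral_sub_diag κ hf hD).aemeasurable.congr ?_
    filter_upwards [hκη] with ω hω
    rw [hω]

/-- An integrable kernel may have a non-integrable diagonal, so `Z` is cut into countably many
pieces of finite intensity on which `f (x, x)` is bounded. The diagonal cancels on each piece, and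
the results are summed. -/
lemma IsPoissonPointProcess.lintegral_factorialNorm [IsProbabilityMeasure P]
    [SigmaFinite ν] (hη : IsPoissonPointProcess η ν P) (hf : Measurable f) :
    AEMeasurable (fun ω => factorialNorm (η ω) f) P ∧
    ∫⁻ ω, factorialNorm (η ω) f ∂P = ∫⁻ p, ‖f p‖ₑ ∂(ν.prod ν) := by
  obtain ⟨κ, hκ, hκη⟩ := hη.exists_kernel
  have hd : Measurable fun x : Z => |f (x, x)| := (hf.comp measurable_prodMk_self).norm
  have hmeas : AEMeasurable (fun ω => factorialNorm (η ω) f) P := by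
    refine (measurable_setLIntegral_sub_diag κ hf .univ).aemeasurable.congr ?_
    filter_upwards [hκη] with ω hω
    rw [hω, factorialNorm, Measure.restrict_univ]
  refine ⟨hmeas, ?_⟩
  set D : ℕ × ℕ → Set Z := fun q => disjointed (spanningSets ν) q.1 ∩
    {x | ⌊|f (x, x)|⌋₊ = q.2} with hD
  have hDm : ∀ q, MeasurableSet (D q) := fun q =>
    (MeasurableSet.disjointed (fun i => measurableSet_spanningSets ν i) q.1).inter
      ((Nat.measurable_floor.comp hd) (measurableSet_singleton q.2))
  have hDd : Pairwise (Function.onFun Disjoint D) := by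
    intro q r hqr
    refine Set.disjoint_left.2 fun x hx hx' => hqr ?_
    refine Prod.ext ?_ (hx.2.symm.trans hx'.2)
    by_contra hne
    exact Set.disjoint_left.1 (disjoint_disjointed (spanningSets ν) hne) hx.1 hx'.1
  have hDu : ⋃ q, D q = Set.univ := by
    refine Set.eq_univ_of_forall fun x => ?_
    have : x ∈ ⋃ i, disjointed (spanningSets ν) i := by
      rw [iUnion_disjointed, iUnion_spanningSets]; trivial
    obtain ⟨i, hi⟩ := Set.mem_iUnion.1 this
    exact Set.mem_iUnion.2 ⟨(i, _), hi, rfl⟩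
  have hDf : ∀ q, ∫⁻ x in D q, ‖f (x, x)‖ₑ ∂ν ≠ ∞ := by
    intro q
    refine ne_top_of_le_ne_top (b := ((q.2 + 1 : ℕ) : ℝ≥0∞) * ν (D q)) ?_ ?_
    · refine ENNReal.mul_ne_top (ENNReal.natCast_ne_top _) ?_
      exact ((measure_mono (Set.inter_subset_left.trans (disjointed_subset _ _))).trans_lt
        (measure_spanningSets_lt_top ν q.1)).ne
    · rw [← setLIntegral_const]
      refine setLIntegral_mono measurable_const fun x hx => ?_
      rw [Real.enorm_eq_ofReal_abs, ← ENNReal.ofReal_natCast]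
      refine ENNReal.ofReal_le_ofReal ?_
      have := Nat.lt_floor_add_one |f (x, x)|
      rw [hx.2] at this
      push_cast
      exact this.le
  have hsum : ∀ (m : Measure Z) (g : Z → ℝ≥0∞), ∫⁻ x, g x ∂m = ∑' q, ∫⁻ x in D q, g x ∂m := by
    intro m g
    rw [← lintegral_iUnion hDm hDd, hDu, Measure.restrict_univ]
  calc ∫⁻ ω, factorialNorm (η ω) f ∂P
      = ∫⁻ ω, ∑' q, ∫⁻ x in D q, ((∫⁻ y, ‖f (x, y)‖ₑ ∂(η ω)) - ‖f (x, x)‖ₑ) ∂(η ω) ∂P :=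
        lintegral_congr fun ω => hsum _ _
    _ = ∑' q, ∫⁻ ω, ∫⁻ x in D q, ((∫⁻ y, ‖f (x, y)‖ₑ ∂(η ω)) - ‖f (x, x)‖ₑ) ∂(η ω) ∂P := by
        refine lintegral_tsum fun q => ?_
        refine (measurable_setLIntegral_sub_diag κ hf (hDm q)).aemeasurable.congr ?_
        filter_upwards [hκη] with ω hω
        rw [hω]
    _ = ∑' q, ∫⁻ x in D q, ∫⁻ y, ‖f (x, y)‖ₑ ∂ν ∂ν :=
        tsum_congr fun q => hη.lintegral_setLIntegral_sub_diag hf (hDm q) (hDf q)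
    _ = _ := by rw [← hsum, lintegral_prod _ hf.enorm.aemeasurable]

/-- Each of the four terms has expectation the `L¹` norm of `f`. So for integrable kernels the
pathwise double integral converges absolutely almost surely, with `L¹` control. -/
lemma IsPoissonPointProcess.lintegral_doubleNorm [IsProbabilityMeasure P]
    [SigmaFinite ν] (hη : IsPoissonPointProcess η ν P) (hf : Measurable f) :
    AEMeasurable (fun ω => doubleNorm (η ω) ν f) P ∧
    ∫⁻ ω, doubleNorm (η ω) ν f ∂P = 4 * ∫⁻ p, ‖f p‖ₑ ∂(ν.prod ν) := by
  obtain ⟨κ, hκ, hκη⟩ := hη.exists_kernel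
  obtain ⟨hm1, h1⟩ := hη.lintegral_factorialNorm hf
  have hF : Measurable fun x => ∫⁻ y, ‖f (x, y)‖ₑ ∂ν := hf.enorm.lintegral_prod_right'
  have hm2 : Measurable fun ω => ∫⁻ x, ∫⁻ y, ‖f (x, y)‖ₑ ∂ν ∂(η ω) :=
    (Measure.measurable_lintegral hF).comp hη.measurable
  have h2 : ∫⁻ ω, ∫⁻ x, ∫⁻ y, ‖f (x, y)‖ₑ ∂ν ∂(η ω) ∂P = ∫⁻ p, ‖f p‖ₑ ∂(ν.prod ν) := by
    rw [hη.lintegral_lintegral hF, lintegral_prod _ hf.enorm.aemeasurable]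
  have hk := measurable_lintegral_kernel_snd κ hf.enorm
  have hm3 : AEMeasurable (fun ω => ∫⁻ x, ∫⁻ y, ‖f (x, y)‖ₑ ∂(η ω) ∂ν) P := by
    refine (hk.lintegral_prod_right' (ν := ν)).aemeasurable.congr ?_
    filter_upwards [hκη] with ω hω
    rw [hω]
  have h3 : ∫⁻ ω, ∫⁻ x, ∫⁻ y, ‖f (x, y)‖ₑ ∂(η ω) ∂ν ∂P = ∫⁻ p, ‖f p‖ₑ ∂(ν.prod ν) := by
    have : ∫⁻ ω, ∫⁻ x, ∫⁻ y, ‖f (x, y)‖ₑ ∂(η ω) ∂ν ∂P =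
        ∫⁻ ω, ∫⁻ x, ∫⁻ y, ‖f (x, y)‖ₑ ∂(κ ω) ∂ν ∂P := by
      refine lintegral_congr_ae ?_
      filter_upwards [hκη] with ω hω
      rw [hω]
    rw [this, lintegral_lintegral_swap hk.aemeasurable, lintegral_prod _ hf.enorm.aemeasurable]
    refine lintegral_congr fun x => ?_
    have hfx : Measurable fun y => ‖f (x, y)‖ₑ := hf.enorm.comp measurable_prodMk_left
    rw [← hη.lintegral_lintegral hfx]
    refine lintegral_congr_ae ?_
    filter_upwards [hκη] with ω hω
    rw [hω]
  refine ⟨((hm1.add hm2.aemeasurable).add hm3).add aemeasurable_const, ?_⟩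
  simp only [doubleNorm]
  rw [lintegral_add_right _ measurable_const, lintegral_add_right' _ hm3,
    lintegral_add_right _ hm2, h1, h2, h3]
  simp
  ring

end DoubleNorm

end

noncomputable section

/-! ### Double integrals of step kernels as quadratic forms in the cell counts. -/

section StepKernel

variable {Z : Type*} [MeasurableSpace Z] {ν : Measure Z}

/-- A finite family of disjoint measurable sets of finite measure. -/
structure IsCells {Z : Type*} [MeasurableSpace Z] (ν : Measure Z) {ι : Type*} (B : ι → Set Z) :
    Prop where
  meas : ∀ i, MeasurableSet (B i)
  disj : Pairwise (fun i j => Disjoint (B i) (B j))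
  fin : ∀ i, ν (B i) < ∞

/-- The kernel with value `a i j` on `B i × B j`, and zero elsewhere. -/
def stepKernel {Z : Type*} {ι : Type*} [Fintype ι] (B : ι → Set Z) (a : ι → ι → ℝ) : Z × Z → ℝ :=
  fun p => ∑ i, ∑ j, (B i ×ˢ B j).indicator (fun _ => a i j) p

variable {ι : Type*} [Fintype ι] {B : ι → Set Z} {a : ι → ι → ℝ}

lemma IsCells.measurable_stepKernel (hB : IsCells ν B) : Measurable (stepKernel B a) :=
  Finset.measurable_sum _ fun i _ => Finset.measurable_sum _ fun j _ =>
    measurable_const.indicator ((hB.meas i).prod (hB.meas j))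

lemma IsCells.memLp_stepKernel [SFinite ν] (hB : IsCells ν B) (p : ℝ≥0∞) :
    MemLp (stepKernel B a) p (ν.prod ν) := by
  refine memLp_finsetSum _ fun i _ => memLp_finsetSum _ fun j _ => ?_
  refine memLp_indicator_const p ((hB.meas i).prod (hB.meas j)) _ (Or.inr ?_)
  rw [Measure.prod_prod]
  exact ENNReal.mul_ne_top (hB.fin i).ne (hB.fin j).ne

lemma IsCells.eq_of_mem (hB : IsCells ν B) {i j : ι} {x : Z} (hi : x ∈ B i) (hj : x ∈ B j) :
    i = j := by
  by_contra h
  exact Set.disjoint_left.1 (hB.disj h) hi hj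

lemma IsCells.stepKernel_apply (hB : IsCells ν B) {i j : ι} {p : Z × Z} (hi : p.1 ∈ B i)
    (hj : p.2 ∈ B j) : stepKernel B a p = a i j := by
  rw [stepKernel, Finset.sum_eq_single i, Finset.sum_eq_single j]
  · rw [Set.indicator_of_mem (Set.mk_mem_prod hi hj)]
  · intro k _ hk
    exact Set.indicator_of_notMem (fun h => hk (hB.eq_of_mem h.2 hj)) _
  · simp
  · intro k _ hk
    exact Finset.sum_eq_zero fun l _ =>
      Set.indicator_of_notMem (fun h => hk (hB.eq_of_mem h.1 hi)) _
  · simp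

lemma stepKernel_eq_zero {p : Z × Z} (h : ¬ ((∃ i, p.1 ∈ B i) ∧ ∃ j, p.2 ∈ B j)) :
    stepKernel B a p = 0 :=
  Finset.sum_eq_zero fun i _ => Finset.sum_eq_zero fun j _ =>
    Set.indicator_of_notMem (fun hp => h ⟨⟨i, hp.1⟩, ⟨j, hp.2⟩⟩) _

lemma IsCells.comp_stepKernel (hB : IsCells ν B) {Φ : ℝ → ℝ} (hΦ : Φ 0 = 0) (p : Z × Z) :
    Φ (stepKernel B a p) = stepKernel B (fun i j => Φ (a i j)) p := by
  by_cases h : (∃ i, p.1 ∈ B i) ∧ ∃ j, p.2 ∈ B j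
  · obtain ⟨⟨i, hi⟩, j, hj⟩ := h
    rw [hB.stepKernel_apply hi hj, hB.stepKernel_apply hi hj]
  · rw [stepKernel_eq_zero h, stepKernel_eq_zero h, hΦ]

lemma IsCells.integral_indicator_sum (hB : IsCells ν B) {m : Measure Z} (hm : ∀ i, m (B i) < ∞)
    (c : ι → ℝ) :
    ∫ x, ∑ i, (B i).indicator (fun _ => c i) x ∂m = ∑ i, m.real (B i) * c i := by
  rw [integral_finsetSum]
  · refine Finset.sum_congr rfl fun i _ => ?_
    rw [integral_indicator (hB.meas i), setIntegral_const, smul_eq_mul]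
  · intro i _
    exact (integrable_indicator_iff (hB.meas i)).2 (integrableOn_const (hm i).ne)

lemma stepKernel_apply_eq_left (x y : Z) :
    stepKernel B a (x, y) =
      ∑ i, (B i).indicator (fun _ => ∑ j, (B j).indicator (fun _ => a i j) y) x := by
  refine Finset.sum_congr rfl fun i _ => ?_
  by_cases hx : x ∈ B i
  · rw [Set.indicator_of_mem hx]
    refine Finset.sum_congr rfl fun j _ => ?_
    by_cases hy : y ∈ B j <;> simp [hx, hy]
  · simp [hx]

lemma stepKernel_apply_eq_right (x y : Z) :
    stepKernel B a (x, y) =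
      ∑ j, (B j).indicator (fun _ => ∑ i, (B i).indicator (fun _ => a i j) x) y := by
  rw [stepKernel, Finset.sum_comm]
  refine Finset.sum_congr rfl fun j _ => ?_
  by_cases hy : y ∈ B j
  · rw [Set.indicator_of_mem hy]
    refine Finset.sum_congr rfl fun i _ => ?_
    by_cases hx : x ∈ B i <;> simp [hx, hy]
  · simp [hy]

lemma IsCells.integral_stepKernel_right (hB : IsCells ν B) {m : Measure Z}
    (hm : ∀ i, m (B i) < ∞) (x : Z) :
    ∫ y, stepKernel B a (x, y) ∂m =
      ∑ i, (B i).indicator (fun _ => ∑ j, m.real (B j) * a i j) x := by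
  simp_rw [stepKernel_apply_eq_right]
  rw [hB.integral_indicator_sum hm]
  simp_rw [Finset.mul_sum]
  rw [Finset.sum_comm]
  refine Finset.sum_congr rfl fun i _ => ?_
  by_cases hx : x ∈ B i <;> simp [hx]

lemma IsCells.integral_integral_stepKernel (hB : IsCells ν B) {m m' : Measure Z}
    (hm : ∀ i, m (B i) < ∞) (hm' : ∀ i, m' (B i) < ∞) :
    ∫ x, ∫ y, stepKernel B a (x, y) ∂m' ∂m =
      ∑ i, ∑ j, m.real (B i) * m'.real (B j) * a i j := by
  simp_rw [hB.integral_stepKernel_right hm']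
  rw [hB.integral_indicator_sum hm]
  simp_rw [Finset.mul_sum, mul_assoc]

lemma measureReal_eq_cellMass (i : ι) : ν.real (B i) = cellMass ν B i := rfl

lemma IsCells.integral_stepKernel [SFinite ν] (hB : IsCells ν B) :
    ∫ p, stepKernel B a p ∂(ν.prod ν) = stepSum (cellMass ν B) a := by
  rw [integral_prod _ (memLp_one_iff_integrable.1 (hB.memLp_stepKernel 1)),
    hB.integral_integral_stepKernel hB.fin hB.fin]
  rfl

/-- The double Poisson integral of a step kernel as a function of the masses of the cells. -/
def stepQuad {ι : Type*} [Fintype ι] (l : ι → ℝ≥0) (a : ι → ι → ℝ) (x : ι → ℝ≥0∞) : ℝ :=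
  ∑ i, (((x i).toReal - l i) * ∑ j, a i j * ((x j).toReal - l j) - a i i * (x i).toReal)

lemma stepQuad_natCast (l : ι → ℝ≥0) (a : ι → ι → ℝ) (n : ι → ℕ) :
    stepQuad l a (fun i => (n i : ℝ≥0∞)) = poissonQuad l a n := by
  simp [stepQuad, poissonQuad, poissonLin]

lemma measurable_stepQuad (l : ι → ℝ≥0) (a : ι → ι → ℝ) : Measurable (stepQuad l a) := by
  unfold stepQuad
  fun_prop

/-- This links the pathwise definition to the finite model: the four terms recombine into products
of compensated counts, and removing the diagonal becomes the correction `a i i`. -/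
lemma IsCells.doubleInt_stepKernel [SFinite ν] (hB : IsCells ν B) {m : Measure Z}
    (hm : ∀ i, m (B i) < ∞) :
    doubleInt m ν (stepKernel B a) = stepQuad (cellMass ν B) a (fun i => m (B i)) := by
  have hdiag : ∀ x, stepKernel B a (x, x) = ∑ i, (B i).indicator (fun _ => a i i) x := by
    intro x
    rw [stepKernel_apply_eq_left]
    refine Finset.sum_congr rfl fun i _ => ?_
    by_cases hx : x ∈ B i
    · rw [Set.indicator_of_mem hx, Set.indicator_of_mem hx, Finset.sum_eq_single i]
      · rw [Set.indicator_of_mem hx]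
      · intro j _ hj
        exact Set.indicator_of_notMem (fun h => hj (hB.eq_of_mem h hx)) _
      · simp
    · simp [hx]
  have h1 : ∫ x, ((∫ y, stepKernel B a (x, y) ∂m) - stepKernel B a (x, x)) ∂m =
      ∑ i, m.real (B i) * ((∑ j, m.real (B j) * a i j) - a i i) := by
    rw [← hB.integral_indicator_sum hm]
    refine integral_congr_ae (ae_of_all _ fun x => ?_)
    simp only
    rw [hB.integral_stepKernel_right hm, hdiag, ← Finset.sum_sub_distrib]
    refine Finset.sum_congr rfl fun i _ => ?_
    by_cases hx : x ∈ B i <;> simp [hx]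
  rw [doubleInt, h1, hB.integral_integral_stepKernel hm hB.fin,
    hB.integral_integral_stepKernel hB.fin hm, hB.integral_stepKernel, stepSum, stepQuad]
  rw [← Finset.sum_sub_distrib, ← Finset.sum_sub_distrib, ← Finset.sum_add_distrib]
  refine Finset.sum_congr rfl fun i _ => ?_
  simp only [measureReal_eq_cellMass, ← measureReal_def]
  rw [mul_sub, Finset.mul_sum, Finset.mul_sum]
  have : ∀ A C D E : ι → ℝ, ∀ q : ℝ, (∑ j, A j - q) - ∑ j, C j - ∑ j, D j + ∑ j, E j =
      ∑ j, (A j - C j - D j + E j) - q := by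
    intro A C D E q
    simp only [Finset.sum_add_distrib, Finset.sum_sub_distrib]
    ring
  rw [this]
  congr 1
  · exact Finset.sum_congr rfl fun j _ => by ring
  · ring

lemma poissonQuad_symm (l : ι → ℝ≥0) (a : ι → ι → ℝ) (n : ι → ℕ) :
    poissonQuad l a n = poissonQuad l (fun i j => (a i j + a j i) / 2) n := by
  have h : ∀ b : ι → ι → ℝ, poissonQuad l b n =
      (∑ i, ∑ j, b i j * (((n i : ℝ) - l i) * ((n j : ℝ) - l j))) - ∑ i, b i i * n i := by
    intro b
    rw [poissonQuad, Finset.sum_sub_distrib]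
    congr 1
    refine Finset.sum_congr rfl fun i _ => ?_
    rw [poissonLin, Finset.mul_sum]
    exact Finset.sum_congr rfl fun j _ => by ring
  rw [h, h]
  congr 1
  · have h2 : ∑ i, ∑ j, a j i * (((n i : ℝ) - l i) * ((n j : ℝ) - l j)) =
        ∑ i, ∑ j, a i j * (((n i : ℝ) - l i) * ((n j : ℝ) - l j)) := by
      rw [Finset.sum_comm]
      exact Finset.sum_congr rfl fun i _ => Finset.sum_congr rfl fun j _ => by ring
    have h3 : ∀ i j, (a i j + a j i) / 2 * (((n i : ℝ) - l i) * ((n j : ℝ) - l j)) =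
        (1 / 2) * (a i j * (((n i : ℝ) - l i) * ((n j : ℝ) - l j))) +
        (1 / 2) * (a j i * (((n i : ℝ) - l i) * ((n j : ℝ) - l j))) := fun i j => by ring
    simp_rw [h3, Finset.sum_add_distrib, ← Finset.mul_sum, h2]
    ring
  · exact Finset.sum_congr rfl fun i _ => by ring

/-- The quadratic form only sees the symmetrized coefficients, and symmetrizing does not increase
the `L²` norm. Without symmetry the isometry becomes this inequality. -/
lemma integral_poissonQuad_sq_le (l : ι → ℝ≥0) (a : ι → ι → ℝ) :
    ∫ n, poissonQuad l a n ^ 2 ∂(poissonVec l) ≤ 2 * stepSum l (fun i j => a i j ^ 2) := by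
  simp_rw [poissonQuad_symm l a]
  rw [integral_poissonQuad_sq l fun i j => by ring]
  refine mul_le_mul_of_nonneg_left ?_ zero_le_two
  have h2 : ∑ i, ∑ j, (l i : ℝ) * l j * a j i ^ 2 = ∑ i, ∑ j, (l i : ℝ) * l j * a i j ^ 2 := by
    rw [Finset.sum_comm]
    exact Finset.sum_congr rfl fun i _ => Finset.sum_congr rfl fun j _ => by ring
  calc ∑ i, ∑ j, (l i : ℝ) * l j * ((a i j + a j i) / 2) ^ 2
      ≤ ∑ i, ∑ j, ((1 / 2) * ((l i : ℝ) * l j * a i j ^ 2) +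
          (1 / 2) * ((l i : ℝ) * l j * a j i ^ 2)) := by
        refine Finset.sum_le_sum fun i _ => Finset.sum_le_sum fun j _ => ?_
        have : (0 : ℝ) ≤ (l i : ℝ) * l j := by positivity
        nlinarith [mul_nonneg this (sq_nonneg (a i j - a j i))]
    _ = _ := by
        simp_rw [Finset.sum_add_distrib, ← Finset.mul_sum, h2, stepSum]
        ring

variable {Ω : Type*} [MeasurableSpace Ω] {P : Measure Ω} {η : Ω → Measure Z}

lemma IsPoissonPointProcess.doubleInt_stepKernel_ae [IsProbabilityMeasure P] [SFinite ν]
    (hη : IsPoissonPointProcess η ν P) (hB : IsCells ν B) :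
    ∀ᵐ ω ∂P, pathwiseDoubleIntegral η ν (stepKernel B a) ω =
      stepQuad (cellMass ν B) a (fun i => η ω (B i)) := by
  have : ∀ᵐ ω ∂P, ∀ i, η ω (B i) < ∞ :=
    ae_all_iff.2 fun i => hη.ae_apply_lt_top (hB.meas i) (hB.fin i)
  filter_upwards [this] with ω hω
  exact hB.doubleInt_stepKernel hω

lemma IsPoissonPointProcess.lintegral_stepQuad_sq_le [IsProbabilityMeasure P] [SFinite ν]
    (hη : IsPoissonPointProcess η ν P) (hB : IsCells ν B) :
    ∫⁻ ω, ‖stepQuad (cellMass ν B) a (fun i => η ω (B i))‖ₑ ^ 2 ∂P ≤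
      2 * ∫⁻ p, ‖stepKernel B a p‖ₑ ^ 2 ∂(ν.prod ν) := by
  have hsq : ∀ r : ℝ, ‖r‖ₑ ^ 2 = ENNReal.ofReal (r ^ 2) := fun r => by
    rw [Real.enorm_eq_ofReal_abs, ← ENNReal.ofReal_pow (abs_nonneg _), sq_abs]
  rw [hη.lintegral_cells hB.meas hB.disj hB.fin
    (Φ := fun x => ‖stepQuad (cellMass ν B) a x‖ₑ ^ 2)
    ((measurable_stepQuad _ _).enorm.pow_const 2)]
  simp_rw [stepQuad_natCast, hsq]
  rw [← ofReal_integral_eq_lintegral_ofReal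
    (((expBounded_poissonQuad _ a).pow 2).integrable _) (ae_of_all _ fun n => sq_nonneg _)]
  have h1 : ∀ p, stepKernel B a p ^ 2 = stepKernel B (fun i j => a i j ^ 2) p := fun p =>
    hB.comp_stepKernel (Φ := fun r => r ^ 2) (by simp) p
  rw [← ofReal_integral_eq_lintegral_ofReal ((hB.memLp_stepKernel 2).integrable_sq)
    (ae_of_all _ fun n => sq_nonneg _)]
  simp_rw [h1]
  rw [hB.integral_stepKernel]
  have : (2 : ℝ≥0∞) = ENNReal.ofReal 2 := by simp
  rw [this, ← ENNReal.ofReal_mul zero_le_two]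
  exact ENNReal.ofReal_le_ofReal (integral_poissonQuad_sq_le _ a)

end StepKernel

end

noncomputable section

/-! ### Atoms of finite families of sets, and refinement of step kernels. -/

section Traces

variable {Z : Type*} [MeasurableSpace Z] {ν : Measure Z}

/-- The nonempty traces of a finite family of sets. -/
abbrev Trace {Z : Type*} (𝒜 : Finset (Set Z)) : Type _ := {S : Set 𝒜 // S.Nonempty}

instance {Z : Type*} (𝒜 : Finset (Set Z)) : Fintype (Trace 𝒜) := Fintype.ofFinite _

/-- The atom of the finite family `𝒜` that consists of the points with trace `S`. -/
def atom {Z : Type*} (𝒜 : Finset (Set Z)) (S : Trace 𝒜) : Set Z := {x | ∀ A : 𝒜, x ∈ A.1 ↔ A ∈ S.1}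

/-- All members of the finite family are measurable and have finite measure. -/
def IsFiniteFamily {Z : Type*} [MeasurableSpace Z] (ν : Measure Z) (𝒜 : Finset (Set Z)) : Prop :=
  ∀ A ∈ 𝒜, MeasurableSet A ∧ ν A < ∞

lemma mem_iff_mem_trace {Z : Type*} {𝒜 : Finset (Set Z)} {S : Trace 𝒜} {x : Z} (hx : x ∈ atom 𝒜 S) (A : 𝒜) :
    x ∈ A.1 ↔ A ∈ S.1 := hx A

lemma exists_mem_atom {Z : Type*} {𝒜 : Finset (Set Z)} {A : 𝒜} {x : Z} (hx : x ∈ A.1) :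
    ∃ S : Trace 𝒜, A ∈ S.1 ∧ x ∈ atom 𝒜 S :=
  ⟨⟨{A' | x ∈ A'.1}, ⟨A, hx⟩⟩, hx, fun _ => Iff.rfl⟩

lemma IsFiniteFamily.isCells {𝒜 : Finset (Set Z)} (h : IsFiniteFamily ν 𝒜) :
    IsCells ν (atom 𝒜) where
  meas S := by
    have : atom 𝒜 S = ⋂ A : 𝒜, {x | x ∈ A.1 ↔ A ∈ S.1} := by
      ext x
      simp [atom]
    rw [this]
    refine MeasurableSet.iInter fun A => ?_
    by_cases hA : A ∈ S.1
    · simpa [hA] using (h A.1 A.2).1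
    · have : {x | x ∈ A.1 ↔ A ∈ S.1} = A.1ᶜ := by
        ext x
        simp [hA]
      rw [this]
      exact (h A.1 A.2).1.compl
  disj S T hST := by
    refine Set.disjoint_left.2 fun x hx hx' => hST (Subtype.ext (Set.ext fun A => ?_))
    rw [← mem_iff_mem_trace hx, mem_iff_mem_trace hx']
  fin S := by
    -- A nonempty trace places the atom inside a member of the family; the empty trace, excluded,
    -- would give the possibly infinite complement.
    obtain ⟨A, hA⟩ := S.2
    exact (measure_mono fun x hx => (mem_iff_mem_trace hx A).2 hA).trans_lt (h A.1 A.2).2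

lemma measure_eq_sum_atoms {𝒜 : Finset (Set Z)} (h : IsFiniteFamily ν 𝒜) (m : Measure Z) (A : 𝒜) :
    m A.1 = ∑ S : Trace 𝒜, open Classical in if A ∈ S.1 then m (atom 𝒜 S) else 0 := by
  classical
  rw [← Finset.sum_filter, ← measure_biUnion_finset]
  · congr 1
    ext x
    simp only [Set.mem_iUnion, Finset.mem_filter, Finset.mem_univ, true_and, exists_prop]
    constructor
    · exact exists_mem_atom
    · rintro ⟨S, hS, hx⟩
      exact (mem_iff_mem_trace hx A).2 hS
  · intro S _ T _ hST
    exact h.isCells.disj hST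
  · exact fun S _ => h.isCells.meas S

lemma indicator_prod_eq_stepKernel {𝒜 : Finset (Set Z)} (h : IsFiniteFamily ν 𝒜) (A A' : 𝒜) :
    ((A.1 ×ˢ A'.1).indicator fun _ => (1 : ℝ)) = stepKernel (atom 𝒜)
      (fun S T => open Classical in if A ∈ S.1 ∧ A' ∈ T.1 then 1 else 0) := by
  classical
  ext p
  by_cases hp : (∃ S, p.1 ∈ atom 𝒜 S) ∧ ∃ T, p.2 ∈ atom 𝒜 T
  · obtain ⟨⟨S, hS⟩, T, hT⟩ := hp
    rw [h.isCells.stepKernel_apply hS hT, Set.indicator_apply]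
    refine if_congr ?_ rfl rfl
    rw [Set.mem_prod, mem_iff_mem_trace hS, mem_iff_mem_trace hT]
  · rw [stepKernel_eq_zero hp, Set.indicator_of_notMem]
    intro hpA
    obtain ⟨S, -, hS⟩ := exists_mem_atom (A := A) hpA.1
    obtain ⟨T, -, hT⟩ := exists_mem_atom (A := A') hpA.2
    exact hp ⟨⟨S, hS⟩, T, hT⟩

/-- `s` is a step kernel over every finite family that contains a certain finite family. -/
def IsStepOver {Z : Type*} [MeasurableSpace Z] (ν : Measure Z) (s : Z × Z → ℝ) : Prop :=
  ∃ 𝒜 : Finset (Set Z), IsFiniteFamily ν 𝒜 ∧ ∀ 𝒜', 𝒜 ⊆ 𝒜' → IsFiniteFamily ν 𝒜' →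
    ∃ a, s = stepKernel (atom 𝒜') a

/-- Representability over all larger families, not just one, is what lets two step kernels be
written over a common family. -/
lemma IsStepOver.add {s t : Z × Z → ℝ} (hs : IsStepOver ν s) (ht : IsStepOver ν t) :
    IsStepOver ν (s + t) := by
  classical
  obtain ⟨𝒜, h𝒜, hs⟩ := hs
  obtain ⟨ℬ, hℬ, ht⟩ := ht
  refine ⟨𝒜 ∪ ℬ, fun A hA => (Finset.mem_union.1 hA).elim (h𝒜 A) (hℬ A), fun 𝒞 h𝒞 hf => ?_⟩
  obtain ⟨a, rfl⟩ := hs 𝒞 (Finset.union_subset_left h𝒞) hf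
  obtain ⟨b, rfl⟩ := ht 𝒞 (Finset.union_subset_right h𝒞) hf
  refine ⟨fun i j => a i j + b i j, ?_⟩
  ext p
  by_cases hp : (∃ S, p.1 ∈ atom 𝒞 S) ∧ ∃ T, p.2 ∈ atom 𝒞 T
  · obtain ⟨⟨S, hS⟩, T, hT⟩ := hp
    simp [hf.isCells.stepKernel_apply hS hT]
  · simp [stepKernel_eq_zero hp]

lemma IsStepOver.const_smul {s : Z × Z → ℝ} (hs : IsStepOver ν s) (c : ℝ) :
    IsStepOver ν (c • s) := by
  obtain ⟨𝒜, h𝒜, hs⟩ := hs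
  refine ⟨𝒜, h𝒜, fun 𝒞 h𝒞 hf => ?_⟩
  obtain ⟨a, rfl⟩ := hs 𝒞 h𝒞 hf
  refine ⟨fun i j => c * a i j, ?_⟩
  ext p
  exact hf.isCells.comp_stepKernel (Φ := fun r => c * r) (by simp) p

lemma isStepOver_zero : IsStepOver ν (0 : Z × Z → ℝ) :=
  ⟨∅, by simp [IsFiniteFamily], fun 𝒞 _ hf => ⟨fun _ _ => 0, by
    ext p
    simp [stepKernel]⟩⟩

lemma isStepOver_indicator {A A' : Set Z} (hA : MeasurableSet A) (hA' : MeasurableSet A')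
    (hf : ν A < ∞) (hf' : ν A' < ∞) :
    IsStepOver ν ((A ×ˢ A').indicator fun _ => (1 : ℝ)) := by
  classical
  refine ⟨{A, A'}, ?_, fun 𝒞 h𝒞 hfin => ⟨_, indicator_prod_eq_stepKernel hfin
    ⟨A, h𝒞 (by simp)⟩ ⟨A', h𝒞 (by simp)⟩⟩⟩
  intro C hC
  rcases Finset.mem_insert.1 hC with rfl | hC
  · exact ⟨hA, hf⟩
  · rw [Finset.mem_singleton.1 hC]
    exact ⟨hA', hf'⟩

lemma IsStepOver.measurable {s : Z × Z → ℝ} (hs : IsStepOver ν s) : Measurable s := by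
  obtain ⟨𝒜, h𝒜, hs⟩ := hs
  obtain ⟨a, rfl⟩ := hs 𝒜 le_rfl h𝒜
  exact h𝒜.isCells.measurable_stepKernel

end Traces

/-! ### Simultaneous density of step kernels in `L¹` and `L²`. -/

section Density

variable {Z : Type*} [MeasurableSpace Z] {ν : Measure Z}

/-- `f` can be approximated by step kernels, simultaneously in `L¹` and in `L²`. -/
def StepApprox {Z : Type*} [MeasurableSpace Z] (ν : Measure Z) (f : Z × Z → ℝ) : Prop :=
  Measurable f ∧ ∀ ε : ℝ≥0∞, ε ≠ 0 → ∃ s, IsStepOver ν s ∧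
    eLpNorm (f - s) 1 (ν.prod ν) ≤ ε ∧ eLpNorm (f - s) 2 (ν.prod ν) ≤ ε

lemma IsStepOver.stepApprox {s : Z × Z → ℝ} (hs : IsStepOver ν s) : StepApprox ν s :=
  ⟨hs.measurable, fun ε _ => ⟨s, hs, by simp, by simp⟩⟩

lemma StepApprox.add {f g : Z × Z → ℝ} (hf : StepApprox ν f) (hg : StepApprox ν g) :
    StepApprox ν (f + g) := by
  refine ⟨hf.1.add hg.1, fun ε hε => ?_⟩
  have hε2 : ε / 2 ≠ 0 := (ENNReal.half_pos hε).ne'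
  obtain ⟨s, hs, hs1, hs2⟩ := hf.2 (ε / 2) hε2
  obtain ⟨t, ht, ht1, ht2⟩ := hg.2 (ε / 2) hε2
  have e : f + g - (s + t) = (f - s) + (g - t) := by abel
  have m1 : AEStronglyMeasurable (f - s) (ν.prod ν) :=
    (hf.1.sub hs.measurable).aestronglyMeasurable
  have m2 : AEStronglyMeasurable (g - t) (ν.prod ν) :=
    (hg.1.sub ht.measurable).aestronglyMeasurable
  refine ⟨s + t, hs.add ht, ?_, ?_⟩ <;> rw [e, ← ENNReal.add_halves ε]
  · exact (eLpNorm_add_le m1 m2 le_rfl).trans (add_le_add hs1 ht1)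
  · exact (eLpNorm_add_le m1 m2 one_le_two).trans (add_le_add hs2 ht2)

lemma StepApprox.const_smul {f : Z × Z → ℝ} (hf : StepApprox ν f) (c : ℝ) :
    StepApprox ν (c • f) := by
  rcases eq_or_ne c 0 with rfl | hc
  · rw [zero_smul]
    exact isStepOver_zero.stepApprox
  refine ⟨hf.1.const_smul c, fun ε hε => ?_⟩
  have hc' : ‖c‖ₑ ≠ 0 := by simpa using hc
  obtain ⟨s, hs, hs1, hs2⟩ := hf.2 (ε / ‖c‖ₑ) (ENNReal.div_pos hε enorm_ne_top).ne'
  refine ⟨c • s, hs.const_smul c, ?_, ?_⟩ <;> rw [← smul_sub, eLpNorm_const_smul]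
  · exact (mul_le_mul_right hs1 _).trans (ENNReal.mul_div_le)
  · exact (mul_le_mul_right hs2 _).trans (ENNReal.mul_div_le)

lemma StepApprox.of_approx {f : Z × Z → ℝ} (hf : Measurable f)
    (h : ∀ ε : ℝ≥0∞, ε ≠ 0 → ∃ g, StepApprox ν g ∧
      eLpNorm (f - g) 1 (ν.prod ν) ≤ ε ∧ eLpNorm (f - g) 2 (ν.prod ν) ≤ ε) : StepApprox ν f := by
  refine ⟨hf, fun ε hε => ?_⟩
  have hε2 : ε / 2 ≠ 0 := (ENNReal.half_pos hε).ne'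
  obtain ⟨g, hg, hg1, hg2⟩ := h (ε / 2) hε2
  obtain ⟨s, hs, hs1, hs2⟩ := hg.2 (ε / 2) hε2
  have e : f - s = (f - g) + (g - s) := by abel
  have m1 : AEStronglyMeasurable (f - g) (ν.prod ν) := (hf.sub hg.1).aestronglyMeasurable
  have m2 : AEStronglyMeasurable (g - s) (ν.prod ν) :=
    (hg.1.sub hs.measurable).aestronglyMeasurable
  refine ⟨s, hs, ?_, ?_⟩ <;> rw [e, ← ENNReal.add_halves ε]
  · exact (eLpNorm_add_le m1 m2 le_rfl).trans (add_le_add hg1 hs1)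
  · exact (eLpNorm_add_le m1 m2 one_le_two).trans (add_le_add hg2 hs2)

lemma StepApprox.sum {κ : Type*} (s : Finset κ) {f : κ → Z × Z → ℝ}
    (h : ∀ k ∈ s, StepApprox ν (f k)) : StepApprox ν (∑ k ∈ s, f k) := by
  classical
  induction s using Finset.induction_on with
  | empty => exact isStepOver_zero.stepApprox
  | insert k s hk ih =>
    rw [Finset.sum_insert hk]
    exact (h k (Finset.mem_insert_self _ _)).add
      (ih fun j hj => h j (Finset.mem_insert_of_mem hj))

lemma StepApprox.of_subset {E : Set (Z × Z)} (hE : MeasurableSet E)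
    (h : ∀ δ : ℝ≥0∞, δ ≠ 0 → ∃ E' ⊆ E, MeasurableSet E' ∧
      StepApprox ν (E'.indicator fun _ => (1 : ℝ)) ∧ (ν.prod ν) (E \ E') ≤ δ) :
    StepApprox ν (E.indicator fun _ => (1 : ℝ)) := by
  refine StepApprox.of_approx (measurable_const.indicator hE) fun ε hε => ?_
  -- The norms of the indicator of a set of measure `δ` are `δ` in `L¹` and `√δ` in `L²`; the
  -- minimum of `ε` and `ε ^ 2` serves both.
  obtain ⟨E', hsub, hE', happ, hδ⟩ := h (min ε (ε ^ 2)) (by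
    rw [← bot_eq_zero, ne_eq, min_eq_bot, not_or]
    exact ⟨hε, pow_ne_zero 2 hε⟩)
  refine ⟨_, happ, ?_, ?_⟩ <;> rw [← Set.indicator_sdiff hsub,
    eLpNorm_indicator_const (hE.diff hE') (by norm_num) (by norm_num)]
  · simpa using hδ.trans (min_le_left _ _)
  · have h2 : (ν.prod ν) (E \ E') ^ (1 / (2 : ℝ≥0∞).toReal) ≤ (ε ^ 2) ^ (1 / (2 : ℝ≥0∞).toReal) :=
      ENNReal.rpow_le_rpow (hδ.trans (min_le_right _ _)) (by positivity)
    refine le_trans ?_ (h2.trans (le_of_eq ?_))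
    · simp
    · rw [← ENNReal.rpow_natCast, ← ENNReal.rpow_mul]
      simp

/-- A π-λ argument from measurable rectangles. Working inside `T × T`, of finite measure, makes
complements legitimate and the tails of disjoint unions small. -/
lemma stepApprox_indicator_inter [SigmaFinite ν] {T : Set Z} (hT : MeasurableSet T)
    (hTf : ν T < ∞) {E : Set (Z × Z)} (hE : MeasurableSet E) :
    StepApprox ν ((E ∩ T ×ˢ T).indicator fun _ => (1 : ℝ)) := by
  have hTT : MeasurableSet (T ×ˢ T) := hT.prod hT
  have hTTf : (ν.prod ν) (T ×ˢ T) < ∞ := by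
    rw [Measure.prod_prod]
    exact ENNReal.mul_lt_top hTf hTf
  refine MeasurableSpace.induction_on_inter (C := fun E _ => StepApprox ν
    ((E ∩ T ×ˢ T).indicator fun _ => (1 : ℝ))) generateFrom_prod.symm isPiSystem_prod
    ?_ ?_ ?_ ?_ E hE
  · rw [Set.empty_inter, Set.indicator_empty]
    exact isStepOver_zero.stepApprox
  · rintro _ ⟨A, hA, B, hB, rfl⟩
    rw [Set.prod_inter_prod]
    exact (isStepOver_indicator (MeasurableSet.inter hA hT) (MeasurableSet.inter hB hT)
      ((measure_mono Set.inter_subset_right).trans_lt hTf)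
      ((measure_mono Set.inter_subset_right).trans_lt hTf)).stepApprox
  · intro E hE ih
    have e : ((Eᶜ ∩ T ×ˢ T).indicator fun _ => (1 : ℝ)) =
        ((T ×ˢ T).indicator fun _ => (1 : ℝ)) + (-1 : ℝ) • (E ∩ T ×ˢ T).indicator fun _ => (1 : ℝ) := by
      ext p
      by_cases h1 : p ∈ E <;> by_cases h2 : p ∈ T ×ˢ T <;> simp [h1, h2]
    rw [e]
    exact (isStepOver_indicator hT hT hTf hTf).stepApprox.add (ih.const_smul _)
  · intro f hd hf ih
    refine StepApprox.of_subset ((MeasurableSet.iUnion hf).inter hTT) fun δ hδ => ?_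
    have hfin : IsFiniteMeasure ((ν.prod ν).restrict (T ×ˢ T)) := ⟨by simpa using hTTf⟩
    have htail := tendsto_measure_biUnion_Ici_zero_of_pairwise_disjoint
      (μ := (ν.prod ν).restrict (T ×ˢ T)) (fun i => (hf i).nullMeasurableSet) hd
    obtain ⟨n, hn⟩ := ((tendsto_order.1 htail).2 δ (pos_iff_ne_zero.2 hδ)).exists
    refine ⟨(⋃ i ∈ Finset.range n, f i) ∩ T ×ˢ T, ?_, ?_, ?_, ?_⟩
    · exact Set.inter_subset_inter_left _ (Set.iUnion₂_subset fun i _ => Set.subset_iUnion f i)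
    · exact (Finset.measurableSet_biUnion _ fun i _ => hf i).inter hTT
    · have e : (((⋃ i ∈ Finset.range n, f i) ∩ T ×ˢ T).indicator fun _ => (1 : ℝ)) =
          ∑ i ∈ Finset.range n, (f i ∩ T ×ˢ T).indicator fun _ => (1 : ℝ) := by
        rw [Set.iUnion₂_inter]
        ext p
        rw [Finset.indicator_biUnion_apply, Finset.sum_apply]
        intro i _ j _ hij
        exact (hd hij).mono Set.inter_subset_left Set.inter_subset_left
      rw [e]
      exact StepApprox.sum _ fun i _ => ih i
    · refine le_trans ?_ hn.le
      rw [Function.comp_apply, Measure.restrict_apply' hTT]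
      refine measure_mono fun p hp => ⟨?_, hp.1.2⟩
      obtain ⟨i, hi⟩ := Set.mem_iUnion.1 hp.1.1
      refine Set.mem_iUnion₂.2 ⟨i, ?_, hi⟩
      by_contra hlt
      refine hp.2 ⟨Set.mem_iUnion₂.2 ⟨i, ?_, hi⟩, hp.1.2⟩
      simpa using hlt

lemma stepApprox_indicator [SigmaFinite ν] {E : Set (Z × Z)} (hE : MeasurableSet E)
    (hEf : (ν.prod ν) E < ∞) : StepApprox ν (E.indicator fun _ => (1 : ℝ)) := by
  refine StepApprox.of_subset hE fun δ hδ => ?_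
  set T := spanningSets ν
  have hmono : Monotone fun n => T n ×ˢ T n := fun m n hmn =>
    Set.prod_mono (monotone_spanningSets ν hmn) (monotone_spanningSets ν hmn)
  have hTm : ∀ n, MeasurableSet (T n ×ˢ T n) := fun n =>
    (measurableSet_spanningSets ν n).prod (measurableSet_spanningSets ν n)
  have htend : Tendsto (fun n => (ν.prod ν) (E \ (T n ×ˢ T n))) atTop (𝓝 0) := by
    have h0 : ⋂ n, E \ (T n ×ˢ T n) = ∅ := by
      rw [← Set.sdiff_iUnion, Set.iUnion_prod_of_monotone (monotone_spanningSets ν)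
        (monotone_spanningSets ν), iUnion_spanningSets, Set.univ_prod_univ, Set.sdiff_univ]
    rw [← measure_empty (μ := ν.prod ν), ← h0]
    refine tendsto_measure_iInter_atTop (fun n => (hE.diff (hTm n)).nullMeasurableSet) ?_
      ⟨0, ((measure_mono Set.sdiff_subset).trans_lt hEf).ne⟩
    exact fun m n hmn => Set.sdiff_subset_sdiff_right (hmono hmn)
  obtain ⟨n, hn⟩ := ((tendsto_order.1 htend).2 δ (pos_iff_ne_zero.2 hδ)).exists
  refine ⟨E ∩ T n ×ˢ T n, Set.inter_subset_left, hE.inter (hTm n),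
    stepApprox_indicator_inter (measurableSet_spanningSets ν n)
      (measure_spanningSets_lt_top ν n) hE, ?_⟩
  rw [Set.sdiff_self_inter]
  exact hn.le

lemma stepApprox_simpleFunc [SigmaFinite ν] (f : SimpleFunc (Z × Z) ℝ)
    {p : ℝ≥0∞} (hp0 : p ≠ 0) (hp : p ≠ ∞) (hf : MemLp f p (ν.prod ν)) : StepApprox ν f := by
  have e : (f : Z × Z → ℝ) = ∑ c ∈ f.range, c • (f ⁻¹' {c}).indicator fun _ => (1 : ℝ) := by
    ext q
    rw [Finset.sum_apply, Finset.sum_eq_single (f q)]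
    · simp
    · intro c _ hc
      rw [Pi.smul_apply, Set.indicator_of_notMem (fun h => hc h.symm), smul_zero]
    · intro h
      exact absurd (SimpleFunc.mem_range_self f q) h
  rw [e]
  refine StepApprox.sum _ fun c _ => ?_
  rcases eq_or_ne c 0 with rfl | hc
  · rw [zero_smul]
    exact isStepOver_zero.stepApprox
  · exact (stepApprox_indicator (f.measurableSet_fiber c)
      (SimpleFunc.measure_preimage_lt_top_of_memLp hp0 hp f hf c hc)).const_smul c

/-- The same sequence of simple functions approximates `f` in both norms, so one step kernel can
serve both. -/
lemma stepApprox_of_memLp [SigmaFinite ν] {f : Z × Z → ℝ} (hf : Measurable f)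
    (h1 : MemLp f 1 (ν.prod ν)) (h2 : MemLp f 2 (ν.prod ν)) : StepApprox ν f := by
  refine StepApprox.of_approx hf fun ε hε => ?_
  have t1 := SimpleFunc.tendsto_approxOn_range_Lp_eLpNorm ENNReal.one_ne_top hf h1.eLpNorm_lt_top
  have t2 := SimpleFunc.tendsto_approxOn_range_Lp_eLpNorm ENNReal.ofNat_ne_top hf h2.eLpNorm_lt_top
  obtain ⟨n, hn1, hn2⟩ := (((tendsto_order.1 t1).2 ε (pos_iff_ne_zero.2 hε)).and
    ((tendsto_order.1 t2).2 ε (pos_iff_ne_zero.2 hε))).exists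
  refine ⟨_, stepApprox_simpleFunc _ one_ne_zero ENNReal.one_ne_top
    (SimpleFunc.memLp_approxOn_range hf h1 n), ?_, ?_⟩
  · rw [eLpNorm_sub_comm]
    exact hn1.le
  · rw [eLpNorm_sub_comm]
    exact hn2.le

lemma exists_stepOver_eLpNorm_sub_le [SigmaFinite ν] {f : Z × Z → ℝ}
    (hf : MemLp f 2 (ν.prod ν)) {ε : ℝ≥0∞} (hε : ε ≠ 0) :
    ∃ s, IsStepOver ν s ∧ eLpNorm (f - s) 2 (ν.prod ν) ≤ ε := by
  have hε2 : ε / 2 ≠ 0 := (ENNReal.half_pos hε).ne'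
  obtain ⟨g, hg, hgm⟩ := hf.exists_simpleFunc_eLpNorm_sub_lt ENNReal.ofNat_ne_top hε2
  obtain ⟨s, hs, -, hs2⟩ := (stepApprox_simpleFunc g two_ne_zero ENNReal.ofNat_ne_top hgm).2
    (ε / 2) hε2
  refine ⟨s, hs, ?_⟩
  rw [← ENNReal.add_halves ε, ← sub_add_sub_cancel f g s]
  exact (eLpNorm_add_le (hf.1.sub hgm.1)
    (g.measurable.sub hs.measurable).aestronglyMeasurable one_le_two).trans
    (add_le_add hg.le hs2)

end Density

end

noncomputable section

/-! ### The `L²` bound for double integrals, first for step kernels and then in general. -/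

section IsometryBound

lemma eLpNorm_two_pow_two {α : Type*} [MeasurableSpace α] (μ : Measure α) (f : α → ℝ) :
    eLpNorm f 2 μ ^ 2 = ∫⁻ x, ‖f x‖ₑ ^ 2 ∂μ := by
  have := eLpNorm_nnreal_pow_eq_lintegral (f := f) (μ := μ) (p := 2) two_ne_zero
  simpa using this

variable {Ω Z : Type*} [MeasurableSpace Ω] [MeasurableSpace Z] {P : Measure Ω}
  [IsProbabilityMeasure P] {ν : Measure Z} [SigmaFinite ν] {η : Ω → Measure Z}
  {f g : Z × Z → ℝ}

lemma IsPoissonPointProcess.ae_doubleNorm_ne_top (hη : IsPoissonPointProcess η ν P)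
    (hf : Measurable f) (h1 : MemLp f 1 (ν.prod ν)) : ∀ᵐ ω ∂P, doubleNorm (η ω) ν f ≠ ∞ := by
  obtain ⟨hm, hi⟩ := hη.lintegral_doubleNorm hf
  have : ∫⁻ ω, doubleNorm (η ω) ν f ∂P ≠ ∞ := by
    rw [hi, ← eLpNorm_one_eq_lintegral_enorm]
    exact ENNReal.mul_ne_top (by norm_num) h1.eLpNorm_ne_top
  filter_upwards [ae_lt_top' hm this] with ω hω
  exact hω.ne

lemma IsPoissonPointProcess.pathwiseDoubleIntegral_sub_ae (hη : IsPoissonPointProcess η ν P)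
    (hf : Measurable f) (hg : Measurable g) (hf1 : MemLp f 1 (ν.prod ν))
    (hg1 : MemLp g 1 (ν.prod ν)) :
    pathwiseDoubleIntegral η ν (f - g) =ᵐ[P]
      pathwiseDoubleIntegral η ν f - pathwiseDoubleIntegral η ν g := by
  filter_upwards [hη.ae_doubleNorm_ne_top hf hf1, hη.ae_doubleNorm_ne_top hg hg1] with ω h1 h2
  exact (hη.counting ω).doubleInt_sub hf hg h1 h2

lemma IsPoissonPointProcess.eLpNorm_stepKernel_le (hη : IsPoissonPointProcess η ν P)
    {ι : Type*} [Fintype ι] {B : ι → Set Z} (hB : IsCells ν B) (a : ι → ι → ℝ) :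
    AEStronglyMeasurable (pathwiseDoubleIntegral η ν (stepKernel B a)) P ∧
    eLpNorm (pathwiseDoubleIntegral η ν (stepKernel B a)) 2 P ≤
      2 * eLpNorm (stepKernel B a) 2 (ν.prod ν) := by
  have hae := hη.doubleInt_stepKernel_ae (a := a) hB
  constructor
  · refine AEStronglyMeasurable.congr (Measurable.aestronglyMeasurable ?_) (ae_eq_symm hae)
    exact (measurable_stepQuad _ _).comp
      (measurable_pi_lambda _ fun i => hη.measurable_apply (hB.meas i))
  · rw [eLpNorm_congr_ae hae, ← ENNReal.pow_le_pow_left_iff two_ne_zero, mul_pow,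
      eLpNorm_two_pow_two, eLpNorm_two_pow_two]
    -- The second moment carries the factor `2`, here enlarged to `2 ^ 2` so that no square root
    -- appears in the norm bound.
    refine (hη.lintegral_stepQuad_sq_le hB).trans ?_
    gcongr
    norm_num

/-- The `L²` bound for double Poisson integrals. -/
lemma IsPoissonPointProcess.eLpNorm_pathwiseDoubleIntegral_le (hη : IsPoissonPointProcess η ν P)
    (hf : Measurable f) (h1 : MemLp f 1 (ν.prod ν)) (h2 : MemLp f 2 (ν.prod ν)) :
    AEStronglyMeasurable (pathwiseDoubleIntegral η ν f) P ∧
    eLpNorm (pathwiseDoubleIntegral η ν f) 2 P ≤ 2 * eLpNorm f 2 (ν.prod ν) := by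
  -- The `L¹` errors are chosen summable. The doubled norms of the errors then have a finite
  -- expected sum, and the pathwise integrals converge almost surely.
  have hε : ∀ k : ℕ, (2⁻¹ : ℝ≥0∞) ^ k ≠ 0 := fun k => pow_ne_zero k (by norm_num)
  choose s hs hs1 hs2 using fun k => (stepApprox_of_memLp hf h1 h2).2 _ (hε k)
  have hscells : ∀ k, ∃ 𝒜 : Finset (Set Z), IsFiniteFamily ν 𝒜 ∧
      ∃ a, s k = stepKernel (atom 𝒜) a := by
    intro k
    obtain ⟨𝒜, h𝒜, hs⟩ := hs k
    exact ⟨𝒜, h𝒜, hs 𝒜 le_rfl h𝒜⟩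
  have hsLp : ∀ k p, MemLp (s k) p (ν.prod ν) := by
    intro k p
    obtain ⟨𝒜, h𝒜, a, ha⟩ := hscells k
    rw [ha]
    exact h𝒜.isCells.memLp_stepKernel p
  have hsI : ∀ k, AEStronglyMeasurable (pathwiseDoubleIntegral η ν (s k)) P ∧
      eLpNorm (pathwiseDoubleIntegral η ν (s k)) 2 P ≤ 2 * eLpNorm (s k) 2 (ν.prod ν) := by
    intro k
    obtain ⟨𝒜, h𝒜, a, ha⟩ := hscells k
    rw [ha]
    exact hη.eLpNorm_stepKernel_le h𝒜.isCells a
  have hsm : ∀ k, Measurable (s k) := fun k => (hs k).measurable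
  have hsum : ∫⁻ ω, ∑' k, doubleNorm (η ω) ν (f - s k) ∂P ≠ ∞ := by
    rw [lintegral_tsum fun k => (hη.lintegral_doubleNorm (hf.sub (hsm k))).1]
    have : ∀ k, ∫⁻ ω, doubleNorm (η ω) ν (f - s k) ∂P ≤ 4 * 2⁻¹ ^ k := by
      intro k
      rw [(hη.lintegral_doubleNorm (hf.sub (hsm k))).2, ← eLpNorm_one_eq_lintegral_enorm]
      gcongr
      exact hs1 k
    refine ne_top_of_le_ne_top ?_ (ENNReal.tsum_le_tsum this)
    rw [ENNReal.tsum_mul_left, ENNReal.tsum_geometric]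
    refine ENNReal.mul_ne_top (by norm_num) ?_
    rw [ENNReal.one_sub_inv_two, inv_inv]
    norm_num
  have hlim : ∀ᵐ ω ∂P, Tendsto (fun k => pathwiseDoubleIntegral η ν (s k) ω) atTop
      (𝓝 (pathwiseDoubleIntegral η ν f ω)) := by
    filter_upwards [ae_lt_top' (AEMeasurable.tsum fun k =>
      (hη.lintegral_doubleNorm (hf.sub (hsm k))).1) hsum, hη.ae_doubleNorm_ne_top hf h1,
      ae_all_iff.2 fun k => hη.ae_doubleNorm_ne_top (hsm k) (hsLp k 1)] with ω h3 h4 h5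
    have h6 := ENNReal.tendsto_atTop_zero_of_tsum_ne_top h3.ne
    rw [tendsto_iff_edist_tendsto_0]
    refine tendsto_of_tendsto_of_tendsto_of_le_of_le tendsto_const_nhds h6 (fun _ => zero_le)
      fun k => ?_
    rw [edist_comm, edist_eq_enorm_sub]
    have h7 := (hη.counting ω).doubleInt_sub (ν := ν) hf (hsm k) h4 (h5 k)
    have h8 : doubleNorm (η ω) ν (f - s k) ≠ ∞ := ENNReal.ne_top_of_tsum_ne_top h3.ne k
    have h9 := (hη.counting ω).enorm_doubleInt_le (ν := ν) (hf.sub (hsm k)) h8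
    rw [h7] at h9
    exact h9
  refine ⟨aestronglyMeasurable_of_tendsto_ae atTop (fun k => (hsI k).1) hlim, ?_⟩
  -- Fatou's lemma carries the bound for step kernels over to the almost sure limit.
  refine (Lp.eLpNorm_lim_le_liminf_eLpNorm (fun k => (hsI k).1) _ hlim).trans ?_
  have hb : ∀ k, eLpNorm (pathwiseDoubleIntegral η ν (s k)) 2 P ≤
      2 * (eLpNorm f 2 (ν.prod ν) + 2⁻¹ ^ k) := by
    intro k
    refine (hsI k).2.trans ?_
    gcongr
    have e : s k = f - (f - s k) := by abel
    rw [e]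
    refine (eLpNorm_sub_le hf.aestronglyMeasurable
      (hf.sub (hsm k)).aestronglyMeasurable one_le_two).trans ?_
    gcongr
    exact hs2 k
  have ht : Tendsto (fun k : ℕ => 2 * (eLpNorm f 2 (ν.prod ν) + (2⁻¹ : ℝ≥0∞) ^ k)) atTop
      (𝓝 (2 * (eLpNorm f 2 (ν.prod ν) + 0))) := by
    refine ENNReal.Tendsto.const_mul ?_ (Or.inr (by norm_num))
    exact tendsto_const_nhds.add (ENNReal.tendsto_pow_atTop_nhds_zero_of_lt_one (by norm_num))
  rw [add_zero] at ht
  rw [← ht.liminf_eq]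
  exact liminf_le_liminf (Eventually.of_forall hb)

/-- The `L²` distance between a double Poisson integral and the integral of a simple kernel. -/
lemma IsDoublePoissonIntegral.eLpNorm_sub_le (hη : IsPoissonPointProcess η ν P) {X : Ω → ℝ}
    (hX : IsDoublePoissonIntegral η ν P f X) (hg : Measurable g) (h1 : MemLp g 1 (ν.prod ν))
    (h2 : MemLp g 2 (ν.prod ν)) :
    eLpNorm (X - pathwiseDoubleIntegral η ν g) 2 P ≤ 2 * eLpNorm (f - g) 2 (ν.prod ν) := by
  obtain ⟨φ, hφ, hφf, hφX⟩ := hX.exists_approx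
  have hI : ∀ {h : Z × Z → ℝ}, Measurable h → MemLp h 1 (ν.prod ν) → MemLp h 2 (ν.prod ν) →
    AEStronglyMeasurable (pathwiseDoubleIntegral η ν h) P := fun hm h1 h2 =>
      (hη.eLpNorm_pathwiseDoubleIntegral_le hm h1 h2).1
  have hb : ∀ k, eLpNorm (X - pathwiseDoubleIntegral η ν g) 2 P ≤
      eLpNorm (pathwiseDoubleIntegral η ν (φ k) - X) 2 P +
        2 * (eLpNorm (φ k - f) 2 (ν.prod ν) + eLpNorm (f - g) 2 (ν.prod ν)) := by
    intro k
    obtain ⟨hm, hk1, hk2⟩ := hφ k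
    rw [← sub_add_sub_cancel X (pathwiseDoubleIntegral η ν (φ k))]
    refine (eLpNorm_add_le (hX.memLp.1.sub (hI hm hk1 hk2))
      ((hI hm hk1 hk2).sub (hI hg h1 h2)) one_le_two).trans ?_
    rw [eLpNorm_sub_comm]
    gcongr
    rw [← eLpNorm_congr_ae (hη.pathwiseDoubleIntegral_sub_ae hm hg hk1 h1)]
    refine (hη.eLpNorm_pathwiseDoubleIntegral_le (hm.sub hg) (hk1.sub h1) (hk2.sub h2)).2.trans ?_
    gcongr
    rw [← sub_add_sub_cancel (φ k) f g]
    exact eLpNorm_add_le (hm.aestronglyMeasurable.sub hX.memLp_kernel.1)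
      (hX.memLp_kernel.1.sub hg.aestronglyMeasurable) one_le_two
  have ht : Tendsto (fun k => eLpNorm (pathwiseDoubleIntegral η ν (φ k) - X) 2 P +
      2 * (eLpNorm (φ k - f) 2 (ν.prod ν) + eLpNorm (f - g) 2 (ν.prod ν))) atTop
      (𝓝 (0 + 2 * (0 + eLpNorm (f - g) 2 (ν.prod ν)))) :=
    hφX.add (ENNReal.Tendsto.const_mul (hφf.add tendsto_const_nhds) (Or.inr (by norm_num)))
  rw [zero_add, zero_add] at ht
  exact ge_of_tendsto' ht hb

/-- The double Poisson integral of a kernel that vanishes almost everywhere. -/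
lemma IsDoublePoissonIntegral.ae_eq_zero (hη : IsPoissonPointProcess η ν P) {X : Ω → ℝ}
    (hX : IsDoublePoissonIntegral η ν P f X) (hf : f =ᵐ[ν.prod ν] 0) : X =ᵐ[P] 0 := by
  have h := hX.eLpNorm_sub_le hη (g := 0) measurable_zero MemLp.zero MemLp.zero
  have h0 : pathwiseDoubleIntegral η ν 0 = 0 := by
    ext ω
    simp [pathwiseDoubleIntegral]
  rw [h0, sub_zero, sub_zero, eLpNorm_congr_ae hf, eLpNorm_zero, mul_zero,
    nonpos_iff_eq_zero, eLpNorm_eq_zero_iff hX.memLp.1 two_ne_zero] at h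
  exact h

end IsometryBound

end

noncomputable section

/-! ### Hilbert–Schmidt estimates for contractions, and the effect of symmetrizing. -/

section Contractions

variable {Z : Type*} [MeasurableSpace Z] {ν : Measure Z} {f g f' g' : Z × Z → ℝ}

lemma sq_lintegral_mul_le {α : Type*} [MeasurableSpace α] (μ : Measure α) {u v : α → ℝ≥0∞}
    (hu : AEMeasurable u μ) (hv : AEMeasurable v μ) :
    (∫⁻ x, u x * v x ∂μ) ^ 2 ≤ (∫⁻ x, u x ^ 2 ∂μ) * ∫⁻ x, v x ^ 2 ∂μ := by
  have h := ENNReal.lintegral_mul_le_Lp_mul_Lq μ Real.HolderConjugate.two_two hu hv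
  calc (∫⁻ x, u x * v x ∂μ) ^ 2
      ≤ ((∫⁻ x, u x ^ (2 : ℝ) ∂μ) ^ (1 / 2 : ℝ) * (∫⁻ x, v x ^ (2 : ℝ) ∂μ) ^ (1 / 2 : ℝ)) ^ 2 :=
        pow_le_pow_left' h 2
    _ = _ := by
        rw [mul_pow, ← ENNReal.rpow_natCast, ← ENNReal.rpow_natCast, ← ENNReal.rpow_mul,
          ← ENNReal.rpow_mul]
        simp

lemma enorm_integral_mul_le {α : Type*} [MeasurableSpace α] (μ : Measure α) {u v : α → ℝ}
    (hu : AEStronglyMeasurable u μ) (hv : AEStronglyMeasurable v μ) :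
    ‖∫ x, u x * v x ∂μ‖ₑ ≤ eLpNorm u 2 μ * eLpNorm v 2 μ := by
  rw [← ENNReal.pow_le_pow_left_iff two_ne_zero, mul_pow, eLpNorm_two_pow_two,
    eLpNorm_two_pow_two]
  refine le_trans ?_ (sq_lintegral_mul_le μ hu.enorm hv.enorm)
  gcongr
  refine (enorm_integral_le_lintegral_enorm _).trans (le_of_eq ?_)
  simp_rw [enorm_mul]

/-- The absolute version of the contraction. -/
def starAbs {Z : Type*} [MeasurableSpace Z] (ν : Measure Z) (f g : Z × Z → ℝ) (p : Z × Z) : ℝ≥0∞ :=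
  ∫⁻ y, ‖f (y, p.1)‖ₑ * ‖g (y, p.2)‖ₑ ∂ν

variable [SFinite ν]

lemma measurable_starAbs (hf : Measurable f) (hg : Measurable g) : Measurable (starAbs ν f g) := by
  refine Measurable.lintegral_prod_right' (f := fun q : (Z × Z) × Z =>
    ‖f (q.2, q.1.1)‖ₑ * ‖g (q.2, q.1.2)‖ₑ) ?_
  exact (hf.comp (by fun_prop)).enorm.mul (hg.comp (by fun_prop)).enorm

lemma measurable_starOneOne (hf : Measurable f) (hg : Measurable g) :
    Measurable (starOneOne ν f g) := by
  have : StronglyMeasurable fun q : (Z × Z) × Z => f (q.2, q.1.1) * g (q.2, q.1.2) :=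
    ((hf.comp (by fun_prop)).mul (hg.comp (by fun_prop))).stronglyMeasurable
  exact this.integral_prod_right'.measurable

lemma lintegral_starAbs_sq_le (hf : Measurable f) (hg : Measurable g) :
    ∫⁻ p, starAbs ν f g p ^ 2 ∂(ν.prod ν) ≤
      (eLpNorm f 2 (ν.prod ν)) ^ 2 * (eLpNorm g 2 (ν.prod ν)) ^ 2 := by
  have hswap : ∀ {h : Z × Z → ℝ}, Measurable h →
      eLpNorm h 2 (ν.prod ν) ^ 2 = ∫⁻ x, ∫⁻ y, ‖h (y, x)‖ₑ ^ 2 ∂ν ∂ν := fun hh => by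
    rw [eLpNorm_two_pow_two, lintegral_prod_symm _ (hh.enorm.pow_const 2).aemeasurable]
  have hm : ∀ {h : Z × Z → ℝ}, Measurable h → Measurable fun x => ∫⁻ y, ‖h (y, x)‖ₑ ^ 2 ∂ν :=
    fun hh => (hh.enorm.pow_const 2).lintegral_prod_left'
  rw [hswap hf, hswap hg, ← lintegral_prod_mul (hm hf).aemeasurable (hm hg).aemeasurable]
  refine lintegral_mono fun p => ?_
  exact sq_lintegral_mul_le ν (hf.comp measurable_prodMk_right).enorm.aemeasurable
    (hg.comp measurable_prodMk_right).enorm.aemeasurable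

lemma enorm_starOneOne_le (p : Z × Z) : ‖starOneOne ν f g p‖ₑ ≤ starAbs ν f g p := by
  refine (enorm_integral_le_lintegral_enorm _).trans (le_of_eq ?_)
  simp_rw [enorm_mul, starAbs]

lemma eLpNorm_starOneOne_le (hf : Measurable f) (hg : Measurable g) :
    eLpNorm (starOneOne ν f g) 2 (ν.prod ν) ≤
      eLpNorm f 2 (ν.prod ν) * eLpNorm g 2 (ν.prod ν) := by
  rw [← ENNReal.pow_le_pow_left_iff two_ne_zero, mul_pow, eLpNorm_two_pow_two]
  refine le_trans (lintegral_mono fun p => ?_) (lintegral_starAbs_sq_le hf hg)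
  exact pow_le_pow_left' (enorm_starOneOne_le p) 2

lemma ae_integrable_mul (hf : Measurable f) (hg : Measurable g) (hf2 : MemLp f 2 (ν.prod ν))
    (hg2 : MemLp g 2 (ν.prod ν)) :
    ∀ᵐ p ∂(ν.prod ν), Integrable (fun y => f (y, p.1) * g (y, p.2)) ν := by
  have h : ∫⁻ p, starAbs ν f g p ^ 2 ∂(ν.prod ν) ≠ ∞ :=
    ne_top_of_le_ne_top (ENNReal.mul_ne_top (ENNReal.pow_ne_top hf2.eLpNorm_ne_top)
      (ENNReal.pow_ne_top hg2.eLpNorm_ne_top)) (lintegral_starAbs_sq_le hf hg)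
  filter_upwards [ae_lt_top ((measurable_starAbs hf hg).pow_const 2) h] with p hp
  refine ⟨((hf.comp measurable_prodMk_right).mul
    (hg.comp measurable_prodMk_right)).aestronglyMeasurable, ?_⟩
  rw [hasFiniteIntegral_iff_enorm]
  have : starAbs ν f g p < ∞ := by
    by_contra htop
    rw [not_lt, top_le_iff] at htop
    simp [htop] at hp
  simpa [starAbs, enorm_mul] using this

lemma memLp_starOneOne (hf : Measurable f) (hg : Measurable g) (hf2 : MemLp f 2 (ν.prod ν))
    (hg2 : MemLp g 2 (ν.prod ν)) : MemLp (starOneOne ν f g) 2 (ν.prod ν) :=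
  ⟨(measurable_starOneOne hf hg).aestronglyMeasurable, (eLpNorm_starOneOne_le hf hg).trans_lt
    (ENNReal.mul_lt_top hf2.eLpNorm_lt_top hg2.eLpNorm_lt_top)⟩

lemma starOneOne_sub_ae (hf : Measurable f) (hg : Measurable g) (hf2 : MemLp f 2 (ν.prod ν))
    (hg2 : MemLp g 2 (ν.prod ν)) :
    starOneOne ν f f - starOneOne ν g g =ᵐ[ν.prod ν]
      starOneOne ν (f - g) f + starOneOne ν g (f - g) := by
  filter_upwards [ae_integrable_mul hf hf hf2 hf2, ae_integrable_mul hg hf hg2 hf2,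
    ae_integrable_mul hg hg hg2 hg2] with p h1 h2 h4
  simp only [Pi.sub_apply, Pi.add_apply, starOneOne, sub_mul, mul_sub]
  rw [integral_sub h1 h2, integral_sub h2 h4]
  ring

/-- Stability of the contraction norm under an `L²` perturbation of the kernel, from `f⋆f - g⋆g = (f
- g)⋆f + g⋆(f - g)`. -/
lemma eLpNorm_starOneOne_self_le (hf : Measurable f) (hg : Measurable g)
    (hf2 : MemLp f 2 (ν.prod ν)) (hg2 : MemLp g 2 (ν.prod ν)) :
    eLpNorm (starOneOne ν f f) 2 (ν.prod ν) ≤ eLpNorm (starOneOne ν g g) 2 (ν.prod ν) +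
      (eLpNorm f 2 (ν.prod ν) + eLpNorm g 2 (ν.prod ν)) * eLpNorm (f - g) 2 (ν.prod ν) := by
  have m1 := (measurable_starOneOne (ν := ν) hg hg).aestronglyMeasurable (μ := ν.prod ν)
  have m2 := (measurable_starOneOne (ν := ν) (hf.sub hg) hf).aestronglyMeasurable (μ := ν.prod ν)
  have m3 := (measurable_starOneOne (ν := ν) hg (hf.sub hg)).aestronglyMeasurable (μ := ν.prod ν)
  have e : starOneOne ν f f =ᵐ[ν.prod ν] starOneOne ν g g +
      (starOneOne ν (f - g) f + starOneOne ν g (f - g)) := by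
    filter_upwards [starOneOne_sub_ae hf hg hf2 hg2] with p hp
    rw [Pi.add_apply, ← hp]
    simp
  rw [eLpNorm_congr_ae e]
  refine (eLpNorm_add_le m1 (m2.add m3) one_le_two).trans (add_le_add le_rfl ?_)
  refine (eLpNorm_add_le m2 m3 one_le_two).trans ?_
  rw [add_mul]
  refine add_le_add ?_ (eLpNorm_starOneOne_le hg (hf.sub hg))
  rw [mul_comm]
  exact eLpNorm_starOneOne_le (hf.sub hg) hf

/-- `tr (G³ A) = 0` for symmetric `G` and antisymmetric `A`. -/
lemma integral_starOneOne_mul_starOneOne_eq_zero (hf : Measurable f) (hg : Measurable g)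
    (hf2 : MemLp f 2 (ν.prod ν)) (hg2 : MemLp g 2 (ν.prod ν)) (hsymm : ∀ x y, f (x, y) = f (y, x))
    (hanti : ∀ x y, g (x, y) = -g (y, x)) :
    ∫ p, starOneOne ν f f p * starOneOne ν f g p ∂(ν.prod ν) = 0 := by
  set Φ : (Z × Z) × (Z × Z) → ℝ := fun r =>
    (f (r.2.1, r.1.1) * f (r.2.1, r.1.2)) * (f (r.2.2, r.1.1) * g (r.2.2, r.1.2)) with hΦ
  have hΦm : Measurable Φ :=
    ((hf.comp (by fun_prop)).mul (hf.comp (by fun_prop))).mul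
      ((hf.comp (by fun_prop)).mul (hg.comp (by fun_prop)))
  have hint : Integrable Φ ((ν.prod ν).prod (ν.prod ν)) := by
    refine ⟨hΦm.aestronglyMeasurable, ?_⟩
    rw [hasFiniteIntegral_iff_enorm, lintegral_prod _ hΦm.enorm.aemeasurable]
    have h1 : ∀ p : Z × Z, ∫⁻ q, ‖Φ (p, q)‖ₑ ∂(ν.prod ν) = starAbs ν f f p * starAbs ν f g p := by
      intro p
      simp_rw [hΦ, enorm_mul]
      exact lintegral_prod_mul
        (f := fun y => ‖f (y, p.1)‖ₑ * ‖f (y, p.2)‖ₑ) (g := fun y => ‖f (y, p.1)‖ₑ * ‖g (y, p.2)‖ₑ)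
        ((hf.comp measurable_prodMk_right).enorm.mul
          (hf.comp measurable_prodMk_right).enorm).aemeasurable
        ((hf.comp measurable_prodMk_right).enorm.mul
          (hg.comp measurable_prodMk_right).enorm).aemeasurable
    simp_rw [h1]
    have h2 := sq_lintegral_mul_le (ν.prod ν) (measurable_starAbs (ν := ν) hf hf).aemeasurable
      (measurable_starAbs (ν := ν) hf hg).aemeasurable
    have h3 : (∫⁻ p, starAbs ν f f p * starAbs ν f g p ∂(ν.prod ν)) ^ 2 < ∞ := by
      refine h2.trans_lt (ENNReal.mul_lt_top ((lintegral_starAbs_sq_le hf hf).trans_lt ?_)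
        ((lintegral_starAbs_sq_le hf hg).trans_lt ?_)) <;>
      exact ENNReal.mul_lt_top (ENNReal.pow_lt_top (by first | exact hf2.eLpNorm_lt_top))
        (ENNReal.pow_lt_top (by first | exact hf2.eLpNorm_lt_top | exact hg2.eLpNorm_lt_top))
    by_contra htop
    rw [not_lt, top_le_iff] at htop
    simp [htop] at h3
  have hΦp : ∀ p : Z × Z, ∫ q, Φ (p, q) ∂(ν.prod ν) = starOneOne ν f f p * starOneOne ν f g p :=
    fun p => integral_prod_mul (fun y => f (y, p.1) * f (y, p.2)) fun y => f (y, p.1) * g (y, p.2)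
  -- The four factors form a cycle through the four variables. Exchanging `p` and `q` permutes the
  -- three symmetric factors and reverses the antisymmetric one, which changes the sign.
  have hanti' : ∀ p q, Φ (p, q) = -Φ (q, p) := by
    intro p q
    simp only [hΦ]
    rw [hanti q.2 p.2, hsymm q.1 p.1, hsymm q.1 p.2, hsymm q.2 p.1]
    ring
  have h1 : ∫ p, ∫ q, Φ (p, q) ∂(ν.prod ν) ∂(ν.prod ν) =
      ∫ q, ∫ p, Φ (p, q) ∂(ν.prod ν) ∂(ν.prod ν) := integral_integral_swap hint
  have h2 : ∫ q, ∫ p, Φ (p, q) ∂(ν.prod ν) ∂(ν.prod ν) =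
      -∫ p, ∫ q, Φ (p, q) ∂(ν.prod ν) ∂(ν.prod ν) := by
    rw [← integral_neg]
    refine integral_congr_ae (ae_of_all _ fun q => ?_)
    simp only
    rw [← integral_neg]
    exact integral_congr_ae (ae_of_all _ fun p => hanti' p q)
  simp_rw [← hΦp]
  linarith

lemma symmetrization_apply_swap (g : Z × Z → ℝ) (x y : Z) :
    symmetrization g (x, y) = symmetrization g (y, x) := by
  simp only [symmetrization, Prod.swap]
  ring

lemma measurable_symmetrization (hg : Measurable g) : Measurable (symmetrization g) :=
  (hg.add (hg.comp measurable_swap)).div_const 2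

lemma memLp_symmetrization (hg2 : MemLp g 2 (ν.prod ν)) :
    MemLp (symmetrization g) 2 (ν.prod ν) := by
  have : MemLp (g ∘ Prod.swap) 2 (ν.prod ν) :=
    hg2.comp_measurePreserving Measure.measurePreserving_swap
  have h := (hg2.add this).const_mul (1 / 2 : ℝ)
  refine h.ae_eq (ae_of_all _ fun p => ?_)
  simp only [symmetrization, Pi.add_apply, Function.comp_apply]
  ring

/-- Since `g - f` is antisymmetric for `f = symmetrization g`, the kernels `f⋆f` and `f⋆(g - f)` are
orthogonal. Their sum is `f⋆g`, and Pythagoras gives the inequality. -/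
lemma eLpNorm_starOneOne_symmetrization_le (hg : Measurable g) (hg2 : MemLp g 2 (ν.prod ν)) :
    eLpNorm (starOneOne ν (symmetrization g) (symmetrization g)) 2 (ν.prod ν) ≤
      eLpNorm (starOneOne ν (symmetrization g) g) 2 (ν.prod ν) := by
  set f := symmetrization g with hfdef
  have hf : Measurable f := measurable_symmetrization hg
  have hf2 : MemLp f 2 (ν.prod ν) := memLp_symmetrization hg2
  have h0 := integral_starOneOne_mul_starOneOne_eq_zero hf (hg.sub hf) hf2 (hg2.sub hf2)
    (symmetrization_apply_swap g) (fun x y => by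
      simp only [Pi.sub_apply, hfdef, symmetrization, Prod.swap]
      ring)
  have hA := memLp_starOneOne hf hf hf2 hf2
  have hB := memLp_starOneOne hf (hg.sub hf) hf2 (hg2.sub hf2)
  have hsum : starOneOne ν f g =ᵐ[ν.prod ν] starOneOne ν f f + starOneOne ν f (g - f) := by
    filter_upwards [ae_integrable_mul hf hf hf2 hf2, ae_integrable_mul hf hg hf2 hg2] with p h1 h2
    simp only [Pi.add_apply, starOneOne, Pi.sub_apply, mul_sub]
    rw [integral_sub h2 h1]
    ring
  have hsq : ∀ {h : Z × Z → ℝ}, MemLp h 2 (ν.prod ν) →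
      eLpNorm h 2 (ν.prod ν) ^ 2 = ENNReal.ofReal (∫ p, h p ^ 2 ∂(ν.prod ν)) := by
    intro h hh
    rw [eLpNorm_two_pow_two, ofReal_integral_eq_lintegral_ofReal hh.integrable_sq
      (ae_of_all _ fun _ => sq_nonneg _)]
    refine lintegral_congr fun p => ?_
    rw [Real.enorm_eq_ofReal_abs, ← ENNReal.ofReal_pow (abs_nonneg _), sq_abs]
  rw [eLpNorm_congr_ae hsum, ← ENNReal.pow_le_pow_left_iff two_ne_zero, hsq hA, hsq (hA.add hB)]
  refine ENNReal.ofReal_le_ofReal ?_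
  have e : ∀ p, (starOneOne ν f f + starOneOne ν f (g - f)) p ^ 2 =
      starOneOne ν f f p ^ 2 + (2 * (starOneOne ν f f p * starOneOne ν f (g - f) p) +
        starOneOne ν f (g - f) p ^ 2) := fun p => by
    rw [Pi.add_apply]; ring
  simp_rw [e]
  have hAB : Integrable (fun p => starOneOne ν f f p * starOneOne ν f (g - f) p) (ν.prod ν) :=
    hA.integrable_mul hB
  have hI : Integrable (fun p => 2 * (starOneOne ν f f p * starOneOne ν f (g - f) p) +
      starOneOne ν f (g - f) p ^ 2) (ν.prod ν) := (hAB.const_mul 2).add hB.integrable_sq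
  rw [integral_add hA.integrable_sq hI,
    integral_add (hAB.const_mul 2) hB.integrable_sq, integral_const_mul, h0]
  have : 0 ≤ ∫ p, starOneOne ν f (g - f) p ^ 2 ∂(ν.prod ν) := integral_nonneg fun _ => sq_nonneg _
  linarith

end Contractions

end

noncomputable section

/-! ### Local mass: the part of a kernel over a set of finite intensity. -/

section LocalMass

variable {Z : Type*} [MeasurableSpace Z] {ν : Measure Z} [SFinite ν] {f g : Z × Z → ℝ} {C D : Set Z}

/-- Cauchy–Schwarz on `C` for the function `f ⋆₂¹ f`. This is how smallness of that contraction
makes the kernel negligible near any fixed set of finite intensity. -/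
lemma sq_setLIntegral_sq_le (hf : Measurable f) (hf2 : MemLp f 2 (ν.prod ν)) (C : Set Z) :
    (∫⁻ x in C, ∫⁻ y, ‖f (y, x)‖ₑ ^ 2 ∂ν ∂ν) ^ 2 ≤ eLpNorm (starTwoOne ν f f) 2 ν ^ 2 * ν C := by
  have hm : Measurable fun x => ∫⁻ y, ‖f (y, x)‖ₑ ^ 2 ∂ν :=
    (hf.enorm.pow_const 2).lintegral_prod_left'
  have hfin : ∀ᵐ x ∂ν, ∫⁻ y, ‖f (y, x)‖ₑ ^ 2 ∂ν < ∞ := by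
    refine ae_lt_top hm ?_
    rw [← lintegral_prod_symm _ (hf.enorm.pow_const 2).aemeasurable, ← eLpNorm_two_pow_two]
    exact ENNReal.pow_ne_top hf2.eLpNorm_ne_top
  have he : ∀ᵐ x ∂ν, ∫⁻ y, ‖f (y, x)‖ₑ ^ 2 ∂ν = ‖starTwoOne ν f f x‖ₑ := by
    filter_upwards [hfin] with x hx
    have hi : Integrable (fun y => f (y, x) * f (y, x)) ν := by
      refine ⟨((hf.comp measurable_prodMk_right).mul
        (hf.comp measurable_prodMk_right)).aestronglyMeasurable, ?_⟩
      rw [hasFiniteIntegral_iff_enorm]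
      simpa [enorm_mul, ← sq] using hx
    rw [starTwoOne, Real.enorm_of_nonneg (integral_nonneg fun y => mul_self_nonneg _),
      ofReal_integral_eq_lintegral_ofReal hi (ae_of_all _ fun y => mul_self_nonneg _)]
    refine lintegral_congr fun y => ?_
    rw [← Real.enorm_of_nonneg (mul_self_nonneg _), enorm_mul, sq]
  have h := sq_lintegral_mul_le (ν.restrict C) (u := fun x => ∫⁻ y, ‖f (y, x)‖ₑ ^ 2 ∂ν)
    (v := fun _ => 1) hm.aemeasurable aemeasurable_const
  simp only [mul_one, one_pow, lintegral_const, Measure.restrict_apply_univ, one_mul] at h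
  refine h.trans (mul_le_mul' ?_ le_rfl)
  rw [eLpNorm_two_pow_two]
  refine (setLIntegral_le_lintegral _ _).trans (le_of_eq (lintegral_congr_ae ?_))
  filter_upwards [he] with x hx
  rw [hx]

/-- What is removed lies in the strips `C × Z` and `Z × C`, which by symmetry carry the same local
mass. The fourth power comes from an `L²` square followed by the squared local mass. -/
lemma eLpNorm_sub_indicator_le (hf : Measurable f) (hf2 : MemLp f 2 (ν.prod ν))
    (hsymm : ∀ x y, f (x, y) = f (y, x)) (hC : MeasurableSet C) :
    eLpNorm (f - (Cᶜ ×ˢ Cᶜ).indicator f) 2 (ν.prod ν) ^ 4 ≤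
      4 * (eLpNorm (starTwoOne ν f f) 2 ν ^ 2 * ν C) := by
  have hm := hf.enorm.pow_const 2
  have h1 : eLpNorm (f - (Cᶜ ×ˢ Cᶜ).indicator f) 2 (ν.prod ν) ^ 2 ≤
      2 * ∫⁻ x in C, ∫⁻ y, ‖f (y, x)‖ₑ ^ 2 ∂ν ∂ν := by
    have hp : ∀ p : Z × Z, ‖(f - (Cᶜ ×ˢ Cᶜ).indicator f) p‖ₑ ^ 2 ≤
        C.indicator (fun x => ‖f (p.1, x)‖ₑ ^ 2) p.2 +
          C.indicator (fun x => ‖f (p.2, x)‖ₑ ^ 2) p.1 := by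
      rintro ⟨x, y⟩
      by_cases hx : x ∈ C <;> by_cases hy : y ∈ C <;> simp [hx, hy, hsymm x y]
    rw [eLpNorm_two_pow_two]
    refine (lintegral_mono hp).trans ?_
    have e1 : ∫⁻ p : Z × Z, C.indicator (fun x => ‖f (p.1, x)‖ₑ ^ 2) p.2 ∂(ν.prod ν) =
        ∫⁻ x in C, ∫⁻ y, ‖f (y, x)‖ₑ ^ 2 ∂ν ∂ν := by
      have : Measurable fun p : Z × Z => C.indicator (fun x => ‖f (p.1, x)‖ₑ ^ 2) p.2 := by
        have h : (fun p : Z × Z => C.indicator (fun x => ‖f (p.1, x)‖ₑ ^ 2) p.2) =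
            (Set.univ ×ˢ C).indicator fun p => ‖f p‖ₑ ^ 2 := by
          ext p
          by_cases hp2 : p.2 ∈ C <;> simp [Set.indicator, hp2]
        rw [h]
        exact hm.indicator (MeasurableSet.univ.prod hC)
      rw [lintegral_prod_symm _ this.aemeasurable, ← lintegral_indicator hC]
      refine lintegral_congr fun x => ?_
      by_cases hx : x ∈ C <;> simp [hx]
    rw [lintegral_add_left', e1, two_mul]
    · refine add_le_add le_rfl (le_of_eq ?_)
      rw [← e1, ← lintegral_prod_swap]
      rfl
    · have h : (fun p : Z × Z => C.indicator (fun x => ‖f (p.1, x)‖ₑ ^ 2) p.2) =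
          (Set.univ ×ˢ C).indicator fun p => ‖f p‖ₑ ^ 2 := by
        ext p
        by_cases hp2 : p.2 ∈ C <;> simp [Set.indicator, hp2]
      rw [h]
      exact (hm.indicator (MeasurableSet.univ.prod hC)).aemeasurable
  calc eLpNorm (f - (Cᶜ ×ˢ Cᶜ).indicator f) 2 (ν.prod ν) ^ 4
      = (eLpNorm (f - (Cᶜ ×ˢ Cᶜ).indicator f) 2 (ν.prod ν) ^ 2) ^ 2 := by ring
    _ ≤ (2 * ∫⁻ x in C, ∫⁻ y, ‖f (y, x)‖ₑ ^ 2 ∂ν ∂ν) ^ 2 := pow_le_pow_left' h1 2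
    _ = 4 * (∫⁻ x in C, ∫⁻ y, ‖f (y, x)‖ₑ ^ 2 ∂ν ∂ν) ^ 2 := by rw [mul_pow]; norm_num
    _ ≤ _ := mul_le_mul' le_rfl (sq_setLIntegral_sq_le hf hf2 C)

/-- The action of a symmetric kernel on an indicator is controlled by its local mass. -/
lemma eLpNorm_starOneOneVec_indicator_le (hf : Measurable f) (hf2 : MemLp f 2 (ν.prod ν))
    (hsymm : ∀ x y, f (x, y) = f (y, x)) (hC : MeasurableSet C) :
    eLpNorm (starOneOneVec ν f (C.indicator fun _ => 1)) 2 ν ^ 4 ≤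
      eLpNorm (starTwoOne ν f f) 2 ν ^ 2 * ν C ^ 3 := by
  have h1 : eLpNorm (starOneOneVec ν f (C.indicator fun _ => 1)) 2 ν ^ 2 ≤
      (∫⁻ x in C, ∫⁻ y, ‖f (y, x)‖ₑ ^ 2 ∂ν ∂ν) * ν C := by
    have hsw : ∫⁻ x in C, ∫⁻ y, ‖f (y, x)‖ₑ ^ 2 ∂ν ∂ν = ∫⁻ y, ∫⁻ x in C, ‖f (x, y)‖ₑ ^ 2 ∂ν ∂ν := by
      rw [lintegral_lintegral_swap]
      · simp_rw [hsymm]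
      · exact ((hf.comp measurable_swap).enorm.pow_const 2).aemeasurable
    rw [eLpNorm_two_pow_two, hsw, ← lintegral_mul_const]
    · refine lintegral_mono fun y => ?_
      have h := sq_lintegral_mul_le (ν.restrict C) (u := fun x => ‖f (x, y)‖ₑ) (v := fun _ => 1)
        (hf.comp measurable_prodMk_right).enorm.aemeasurable aemeasurable_const
      simp only [mul_one, one_pow, lintegral_const, Measure.restrict_apply_univ, one_mul] at h
      refine le_trans (pow_le_pow_left' ?_ 2) h
      refine (enorm_integral_le_lintegral_enorm _).trans (le_of_eq ?_)
      rw [← lintegral_indicator hC]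
      refine lintegral_congr fun x => ?_
      by_cases hx : x ∈ C <;> simp [hx]
    · exact (hf.enorm.pow_const 2).lintegral_prod_left'
  calc eLpNorm (starOneOneVec ν f (C.indicator fun _ => 1)) 2 ν ^ 4
      = (eLpNorm (starOneOneVec ν f (C.indicator fun _ => 1)) 2 ν ^ 2) ^ 2 := by ring
    _ ≤ ((∫⁻ x in C, ∫⁻ y, ‖f (y, x)‖ₑ ^ 2 ∂ν ∂ν) * ν C) ^ 2 := pow_le_pow_left' h1 2
    _ = (∫⁻ x in C, ∫⁻ y, ‖f (y, x)‖ₑ ^ 2 ∂ν ∂ν) ^ 2 * ν C ^ 2 := mul_pow _ _ _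
    _ ≤ (eLpNorm (starTwoOne ν f f) 2 ν ^ 2 * ν C) * ν C ^ 2 :=
        mul_le_mul' (sq_setLIntegral_sq_le hf hf2 C) le_rfl
    _ = _ := by ring

lemma measurable_starOneOneVec {h : Z → ℝ} (hf : Measurable f) (hh : Measurable h) :
    Measurable (starOneOneVec ν f h) := by
  have : StronglyMeasurable fun q : Z × Z => f (q.2, q.1) * h q.2 :=
    ((hf.comp (by fun_prop)).mul (hh.comp (by fun_prop))).stronglyMeasurable
  exact this.integral_prod_right'.measurable

lemma setIntegral_starOneOne (hf : Measurable f) (hg : Measurable g)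
    (hf2 : MemLp f 2 (ν.prod ν)) (hg2 : MemLp g 2 (ν.prod ν))
    (hC : ν C < ∞) (hD : ν D < ∞) :
    ∫ p in D ×ˢ C, starOneOne ν f g p ∂(ν.prod ν) =
      ∫ y, (∫ x in D, f (y, x) ∂ν) * (∫ x in C, g (y, x) ∂ν) ∂ν := by
  have hm : Measurable fun q : (Z × Z) × Z => f (q.2, q.1.1) * g (q.2, q.1.2) :=
    (hf.comp (by fun_prop)).mul (hg.comp (by fun_prop))
  have hint : Integrable (fun q : (Z × Z) × Z => f (q.2, q.1.1) * g (q.2, q.1.2))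
      (((ν.prod ν).restrict (D ×ˢ C)).prod ν) := by
    refine ⟨hm.aestronglyMeasurable, ?_⟩
    rw [hasFiniteIntegral_iff_enorm, lintegral_prod _ hm.enorm.aemeasurable]
    simp_rw [enorm_mul]
    change ∫⁻ p in D ×ˢ C, starAbs ν f g p ∂(ν.prod ν) < ∞
    have h := sq_lintegral_mul_le ((ν.prod ν).restrict (D ×ˢ C)) (v := fun _ => 1)
      (measurable_starAbs (ν := ν) hf hg).aemeasurable aemeasurable_const
    simp only [mul_one, one_pow, lintegral_const, Measure.restrict_apply_univ, one_mul] at h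
    have h3 : (∫⁻ p in D ×ˢ C, starAbs ν f g p ∂(ν.prod ν)) ^ 2 < ∞ := by
      refine h.trans_lt (ENNReal.mul_lt_top ?_ ?_)
      · refine (setLIntegral_le_lintegral _ _).trans_lt ((lintegral_starAbs_sq_le hf hg).trans_lt ?_)
        exact ENNReal.mul_lt_top (ENNReal.pow_lt_top hf2.eLpNorm_lt_top)
          (ENNReal.pow_lt_top hg2.eLpNorm_lt_top)
      · rw [Measure.prod_prod]
        exact ENNReal.mul_lt_top hD hC
    by_contra htop
    rw [not_lt, top_le_iff] at htop
    simp [htop] at h3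
  have := integral_integral_swap (f := fun (p : Z × Z) y => f (y, p.1) * g (y, p.2)) hint
  refine this.trans (integral_congr_ae (ae_of_all _ fun y => ?_))
  simp only
  rw [← Measure.prod_restrict]
  exact integral_prod_mul (fun x => f (y, x)) fun x => g (y, x)

lemma ae_setIntegrable (hf : Measurable f) (hf2 : MemLp f 2 (ν.prod ν)) (hC : ν C < ∞) :
    ∀ᵐ y ∂ν, Integrable (fun x => f (x, y)) (ν.restrict C) := by
  have hm : Measurable fun x => ∫⁻ y, ‖f (y, x)‖ₑ ^ 2 ∂ν :=
    (hf.enorm.pow_const 2).lintegral_prod_left'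
  have hfin : ∀ᵐ x ∂ν, ∫⁻ y, ‖f (y, x)‖ₑ ^ 2 ∂ν < ∞ := by
    refine ae_lt_top hm ?_
    rw [← lintegral_prod_symm _ (hf.enorm.pow_const 2).aemeasurable, ← eLpNorm_two_pow_two]
    exact ENNReal.pow_ne_top hf2.eLpNorm_ne_top
  filter_upwards [hfin] with y hy
  have hmem : MemLp (fun x => f (x, y)) 2 ν := by
    refine ⟨(hf.comp measurable_prodMk_right).aestronglyMeasurable, ?_⟩
    rw [← eLpNorm_two_pow_two] at hy
    by_contra htop
    rw [not_lt, top_le_iff] at htop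
    simp [htop] at hy
  have : IsFiniteMeasure (ν.restrict C) := ⟨by simpa using hC⟩
  exact (hmem.restrict C).integrable one_le_two

/-- By Fubini the rectangle splits into two one-variable functions. The second integrates `g` in its
second variable, whereas `starOneOneVec` uses the first; the identity `g (y, x) = 2 * f (x, y) - g
(x, y)`, with `f = symmetrization g`, exchanges the two. -/
lemma enorm_setIntegral_starOneOne_symmetrization_le (hg : Measurable g)
    (hg2 : MemLp g 2 (ν.prod ν)) (hC : MeasurableSet C) (hCf : ν C < ∞) (hD : MeasurableSet D)
    (hDf : ν D < ∞) :
    ‖∫ p in D ×ˢ C, starOneOne ν (symmetrization g) g p ∂(ν.prod ν)‖ₑ ≤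
      eLpNorm (starOneOneVec ν (symmetrization g) (D.indicator fun _ => 1)) 2 ν *
        (2 * eLpNorm (starOneOneVec ν (symmetrization g) (C.indicator fun _ => 1)) 2 ν +
          eLpNorm (starOneOneVec ν g (C.indicator fun _ => 1)) 2 ν) := by
  set f := symmetrization g with hfdef
  have hf : Measurable f := measurable_symmetrization hg
  have hf2 : MemLp f 2 (ν.prod ν) := memLp_symmetrization hg2
  have hvec : ∀ {E : Set Z} (k : Z × Z → ℝ), MeasurableSet E → ∀ y,
      starOneOneVec ν k (E.indicator fun _ => 1) y = ∫ x in E, k (x, y) ∂ν := by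
    intro E k hE y
    rw [← integral_indicator hE]
    refine integral_congr_ae (ae_of_all _ fun x => ?_)
    by_cases hx : x ∈ E <;> simp [hx]
  have hone : ∀ {E : Set Z}, MeasurableSet E → Measurable (E.indicator fun _ => (1 : ℝ)) :=
    fun hE => measurable_const.indicator hE
  have e : ∀ᵐ y ∂ν, (∫ x in D, f (y, x) ∂ν) * (∫ x in C, g (y, x) ∂ν) =
      starOneOneVec ν f (D.indicator fun _ => 1) y *
        ((2 : ℝ) • starOneOneVec ν f (C.indicator fun _ => 1) -
          starOneOneVec ν g (C.indicator fun _ => 1)) y := by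
    filter_upwards [ae_setIntegrable hf hf2 hCf, ae_setIntegrable hg hg2 hCf] with y h1 h2
    simp only [Pi.sub_apply, Pi.smul_apply, hvec _ hC, hvec _ hD, smul_eq_mul]
    congr 1
    · exact integral_congr_ae (ae_of_all _ fun x => symmetrization_apply_swap g y x)
    · rw [← integral_const_mul, ← integral_sub (h1.const_mul 2) h2]
      refine integral_congr_ae (ae_of_all _ fun x => ?_)
      simp only [hfdef, symmetrization, Prod.swap]
      ring
  rw [setIntegral_starOneOne hf hg hf2 hg2 hCf hDf, integral_congr_ae e]
  have m1 := (measurable_starOneOneVec (ν := ν) hf (hone hC)).aestronglyMeasurable (μ := ν)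
  have m2 := (measurable_starOneOneVec (ν := ν) hg (hone hC)).aestronglyMeasurable (μ := ν)
  refine (enorm_integral_mul_le ν
    (measurable_starOneOneVec hf (hone hD)).aestronglyMeasurable ((m1.const_smul (2 : ℝ)).sub m2)).trans ?_
  refine mul_le_mul' le_rfl ((eLpNorm_sub_le (m1.const_smul (2 : ℝ)) m2 one_le_two).trans
    (add_le_add ?_ le_rfl))
  rw [eLpNorm_const_smul]
  simp [enorm_eq_nnnorm]

/-- An `L²` kernel all of whose integrals over rectangles vanish is zero. -/
lemma ae_eq_zero_of_setIntegral_prod_eq_zero [SigmaFinite ν] (hf2 : MemLp f 2 (ν.prod ν))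
    (h : ∀ C D, MeasurableSet C → ν C < ∞ → MeasurableSet D → ν D < ∞ →
      ∫ p in C ×ˢ D, f p ∂(ν.prod ν) = 0) : f =ᵐ[ν.prod ν] 0 := by
  have hstep : ∀ s, IsStepOver ν s → MemLp s 2 (ν.prod ν) ∧ ∫ p, f p * s p ∂(ν.prod ν) = 0 := by
    rintro s ⟨𝒜, h𝒜, hs⟩
    obtain ⟨a, rfl⟩ := hs 𝒜 le_rfl h𝒜
    have hB := h𝒜.isCells
    refine ⟨hB.memLp_stepKernel 2, ?_⟩
    have hi : ∀ i j, Integrable (fun p => f p *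
        (atom 𝒜 i ×ˢ atom 𝒜 j).indicator (fun _ => a i j) p) (ν.prod ν) := fun i j => by
      refine hf2.integrable_mul (memLp_indicator_const 2 ((hB.meas i).prod (hB.meas j)) _
        (Or.inr ?_))
      rw [Measure.prod_prod]
      exact ENNReal.mul_ne_top (hB.fin i).ne (hB.fin j).ne
    simp only [stepKernel, Finset.mul_sum]
    rw [integral_finsetSum _ fun i _ => integrable_finsetSum _ fun j _ => hi i j]
    refine Finset.sum_eq_zero fun i _ => ?_
    rw [integral_finsetSum _ fun j _ => hi i j]
    refine Finset.sum_eq_zero fun j _ => ?_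
    have : ∀ p, f p * (atom 𝒜 i ×ˢ atom 𝒜 j).indicator (fun _ => a i j) p =
        (atom 𝒜 i ×ˢ atom 𝒜 j).indicator (fun p => f p * a i j) p := fun p => by
      by_cases hp : p ∈ atom 𝒜 i ×ˢ atom 𝒜 j
      · rw [Set.indicator_of_mem hp, Set.indicator_of_mem hp]
      · rw [Set.indicator_of_notMem hp, Set.indicator_of_notMem hp, mul_zero]
    simp_rw [this]
    rw [integral_indicator ((hB.meas i).prod (hB.meas j)), integral_mul_const,
      h _ _ (hB.meas i) (hB.fin i) (hB.meas j) (hB.fin j), zero_mul]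
  rw [← eLpNorm_eq_zero_iff hf2.1 two_ne_zero]
  by_contra hne
  have hε : eLpNorm f 2 (ν.prod ν) / 2 ≠ 0 := (ENNReal.half_pos hne).ne'
  obtain ⟨s, hs, hsε⟩ := exists_stepOver_eLpNorm_sub_le hf2 hε
  obtain ⟨hs2, hs0⟩ := hstep s hs
  -- As `f` is orthogonal to step kernels, `‖f‖² = ⟨f, f - s⟩ ≤ ‖f‖ * ‖f‖ / 2`, which is impossible
  -- for a nonzero `f`.
  have hsq : eLpNorm f 2 (ν.prod ν) ^ 2 = ‖∫ p, f p * (f - s) p ∂(ν.prod ν)‖ₑ := by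
    have : ∫ p, f p * (f - s) p ∂(ν.prod ν) = ∫ p, f p ^ 2 ∂(ν.prod ν) := by
      simp only [Pi.sub_apply, mul_sub]
      have h1 : Integrable (fun p => f p * f p) (ν.prod ν) := hf2.integrable_mul hf2
      have h2 : Integrable (fun p => f p * s p) (ν.prod ν) := hf2.integrable_mul hs2
      rw [integral_sub h1 h2, hs0, sub_zero]
      simp_rw [sq]
    rw [this, Real.enorm_of_nonneg (integral_nonneg fun _ => sq_nonneg _), eLpNorm_two_pow_two,
      ofReal_integral_eq_lintegral_ofReal hf2.integrable_sq (ae_of_all _ fun _ => sq_nonneg _)]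
    refine lintegral_congr fun p => ?_
    rw [Real.enorm_eq_ofReal_abs, ← ENNReal.ofReal_pow (abs_nonneg _), sq_abs]
  have hle := hsq.le.trans ((enorm_integral_mul_le _ hf2.1 (hf2.1.sub hs2.1)).trans
    (mul_le_mul' le_rfl hsε))
  rw [sq, ENNReal.mul_le_mul_iff_right hne hf2.eLpNorm_ne_top] at hle
  exact absurd hle (not_le.2 (ENNReal.half_lt_self hne hf2.eLpNorm_ne_top))

end LocalMass

end

noncomputable section

/-! ### Discretizing a kernel by its averages over cells. -/

section Averages

variable {Z : Type*} [MeasurableSpace Z] {ν : Measure Z} [SFinite ν] {f : Z × Z → ℝ}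
  {ι : Type*} [Fintype ι] {B : ι → Set Z}

/-- The average of a kernel over the products of the cells. -/
def cellAvg {Z : Type*} [MeasurableSpace Z] (ν : Measure Z) {ι : Type*} (B : ι → Set Z)
    (f : Z × Z → ℝ) (i j : ι) : ℝ :=
  ⨍ p in B i ×ˢ B j, f p ∂(ν.prod ν)

lemma measureReal_prod_cells (i j : ι) :
    (ν.prod ν).real (B i ×ˢ B j) = cellMass ν B i * cellMass ν B j := by
  rw [measureReal_prod_prod]
  rfl

lemma cellAvg_symm (hB : IsCells ν B) (hsymm : ∀ x y, f (x, y) = f (y, x)) (i j : ι) :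
    cellAvg ν B f i j = cellAvg ν B f j i := by
  have h : ∫ p in B i ×ˢ B j, f p ∂(ν.prod ν) = ∫ p in B j ×ˢ B i, f p ∂(ν.prod ν) := by
    rw [← integral_indicator ((hB.meas i).prod (hB.meas j)),
      ← integral_indicator ((hB.meas j).prod (hB.meas i)), ← integral_prod_swap]
    refine integral_congr_ae (ae_of_all _ fun p => ?_)
    obtain ⟨x, y⟩ := p
    by_cases hx : x ∈ B j <;> by_cases hy : y ∈ B i <;> simp [hx, hy, hsymm x y]
  rw [cellAvg, cellAvg, setAverage_eq, setAverage_eq, h, measureReal_prod_cells,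
    measureReal_prod_cells, mul_comm (cellMass ν B i : ℝ)]

lemma IsCells.prod_ne_top (hB : IsCells ν B) (i j : ι) : (ν.prod ν) (B i ×ˢ B j) ≠ ∞ := by
  rw [Measure.prod_prod]
  exact ENNReal.mul_ne_top (hB.fin i).ne (hB.fin j).ne

lemma cellMass_mul_cellAvg (hB : IsCells ν B) (i j : ι) :
    (cellMass ν B i : ℝ) * cellMass ν B j * cellAvg ν B f i j =
      ∫ p in B i ×ˢ B j, f p ∂(ν.prod ν) := by
  rw [← measureReal_prod_cells, cellAvg, ← smul_eq_mul, measure_smul_setAverage _ (hB.prod_ne_top i j)]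

lemma setIntegral_eq_smul {E : Set (Z × Z)} (hE : (ν.prod ν) E ≠ ∞) (F : Z × Z → ℝ) :
    (ν.prod ν).real E * ⨍ p in E, F p ∂(ν.prod ν) = ∫ p in E, F p ∂(ν.prod ν) := by
  rw [← smul_eq_mul, measure_smul_setAverage _ hE]

/-- Jensen's inequality on one product of cells. For the exponent four it keeps the `L⁴` norm under
control, which approximation in `L²` alone would not do. -/
lemma cellMass_mul_cellAvg_pow_le (hB : IsCells ν B) {k : ℕ} (hk : Even k) (hk1 : 1 ≤ k)
    (hf : MemLp f k (ν.prod ν)) (i j : ι) :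
    (cellMass ν B i : ℝ) * cellMass ν B j * cellAvg ν B f i j ^ k ≤
      ∫ p in B i ×ˢ B j, f p ^ k ∂(ν.prod ν) := by
  rw [← measureReal_prod_cells, ← setIntegral_eq_smul (hB.prod_ne_top i j)]
  by_cases h0 : (ν.prod ν) (B i ×ˢ B j) = 0
  · simp [measureReal_def, h0]
  have : IsFiniteMeasure ((ν.prod ν).restrict (B i ×ˢ B j)) :=
    ⟨by simpa using (hB.prod_ne_top i j).lt_top⟩
  have hi : Integrable (fun p => f p ^ k) (ν.prod ν) := by
    refine (hf.integrable_norm_pow (by omega)).congr (ae_of_all _ fun p => ?_)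
    simp [hk.pow_abs]
  refine mul_le_mul_of_nonneg_left ?_ measureReal_nonneg
  exact (hk.convexOn_pow (𝕜 := ℝ)).map_set_average_le (continuous_pow k).continuousOn isClosed_univ h0
    (hB.prod_ne_top i j) (ae_of_all _ fun _ => Set.mem_univ _)
    ((hf.restrict _).integrable (by exact_mod_cast hk1)) hi.integrableOn

lemma IsCells.sum_setIntegral_le (hB : IsCells ν B) {F : Z × Z → ℝ} (hF : Integrable F (ν.prod ν))
    (hF0 : ∀ p, 0 ≤ F p) :
    ∑ i, ∑ j, ∫ p in B i ×ˢ B j, F p ∂(ν.prod ν) ≤ ∫ p, F p ∂(ν.prod ν) := by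
  have hi : ∀ i j, Integrable ((B i ×ˢ B j).indicator F) (ν.prod ν) := fun i j =>
    hF.indicator ((hB.meas i).prod (hB.meas j))
  have e : ∑ i, ∑ j, ∫ p in B i ×ˢ B j, F p ∂(ν.prod ν) =
      ∫ p, ∑ i, ∑ j, (B i ×ˢ B j).indicator F p ∂(ν.prod ν) := by
    rw [integral_finsetSum _ fun i _ => integrable_finsetSum _ fun j _ => hi i j]
    refine Finset.sum_congr rfl fun i _ => ?_
    rw [integral_finsetSum _ fun j _ => hi i j]
    refine Finset.sum_congr rfl fun j _ => ?_
    rw [integral_indicator ((hB.meas i).prod (hB.meas j))]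
  rw [e]
  refine integral_mono (integrable_finsetSum _ fun i _ => integrable_finsetSum _ fun j _ => hi i j)
    hF fun p => ?_
  have hp : ∑ i, ∑ j, (B i ×ˢ B j).indicator F p = stepKernel B (fun _ _ => F p) p := by
    refine Finset.sum_congr rfl fun i _ => Finset.sum_congr rfl fun j _ => ?_
    by_cases h : p ∈ B i ×ˢ B j
    · rw [Set.indicator_of_mem h, Set.indicator_of_mem h]
    · rw [Set.indicator_of_notMem h, Set.indicator_of_notMem h]
  simp only
  rw [hp]
  by_cases h : (∃ i, p.1 ∈ B i) ∧ ∃ j, p.2 ∈ B j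
  · obtain ⟨⟨i, hi⟩, j, hj⟩ := h
    rw [hB.stepKernel_apply hi hj]
  · rw [stepKernel_eq_zero h]
    exact hF0 p

lemma stepSum_cellAvg_pow_le (hB : IsCells ν B) {k : ℕ} (hk : Even k) (hk1 : 1 ≤ k)
    (hf : MemLp f k (ν.prod ν)) :
    stepSum (cellMass ν B) (fun i j => cellAvg ν B f i j ^ k) ≤ ∫ p, f p ^ k ∂(ν.prod ν) := by
  have hi : Integrable (fun p => f p ^ k) (ν.prod ν) := by
    refine (hf.integrable_norm_pow (by omega)).congr (ae_of_all _ fun p => ?_)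
    simp [hk.pow_abs]
  refine le_trans ?_ (hB.sum_setIntegral_le hi fun p => hk.pow_nonneg _)
  exact Finset.sum_le_sum fun i _ => Finset.sum_le_sum fun j _ =>
    cellMass_mul_cellAvg_pow_le hB hk hk1 hf i j

lemma IsCells.integral_mul_stepKernel (hB : IsCells ν B) (hf : MemLp f 2 (ν.prod ν))
    (a : ι → ι → ℝ) :
    ∫ p, f p * stepKernel B a p ∂(ν.prod ν) =
      stepSum (cellMass ν B) (fun i j => cellAvg ν B f i j * a i j) := by
  have hi : ∀ i j, Integrable (fun p => f p *
      (B i ×ˢ B j).indicator (fun _ => a i j) p) (ν.prod ν) := fun i j =>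
    hf.integrable_mul (memLp_indicator_const 2 ((hB.meas i).prod (hB.meas j)) _
      (Or.inr (hB.prod_ne_top i j)))
  simp only [stepKernel, Finset.mul_sum]
  rw [integral_finsetSum _ fun i _ => integrable_finsetSum _ fun j _ => hi i j]
  refine Finset.sum_congr rfl fun i _ => ?_
  rw [integral_finsetSum _ fun j _ => hi i j]
  refine Finset.sum_congr rfl fun j _ => ?_
  have : ∀ p, f p * (B i ×ˢ B j).indicator (fun _ => a i j) p =
      (B i ×ˢ B j).indicator (fun p => f p * a i j) p := fun p => by
    by_cases hp : p ∈ B i ×ˢ B j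
    · rw [Set.indicator_of_mem hp, Set.indicator_of_mem hp]
    · rw [Set.indicator_of_notMem hp, Set.indicator_of_notMem hp, mul_zero]
  simp_rw [this]
  rw [integral_indicator ((hB.meas i).prod (hB.meas j)), integral_mul_const,
    ← cellMass_mul_cellAvg hB]
  ring

lemma stepKernel_sub (a b : ι → ι → ℝ) :
    stepKernel B a - stepKernel B b = stepKernel B (fun i j => a i j - b i j) := by
  ext p
  simp only [Pi.sub_apply, stepKernel, ← Finset.sum_sub_distrib]
  refine Finset.sum_congr rfl fun i _ => Finset.sum_congr rfl fun j _ => ?_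
  by_cases hp : p ∈ B i ×ˢ B j
  · simp only [Set.indicator_of_mem hp]
  · simp only [Set.indicator_of_notMem hp, sub_zero]

lemma eLpNorm_sq_eq_enorm_integral {α : Type*} [MeasurableSpace α] {μ : Measure α} {u : α → ℝ}
    (hu : MemLp u 2 μ) : eLpNorm u 2 μ ^ 2 = ‖∫ x, u x * u x ∂μ‖ₑ := by
  simp_rw [← sq]
  rw [Real.enorm_of_nonneg (integral_nonneg fun _ => sq_nonneg _), eLpNorm_two_pow_two,
    ofReal_integral_eq_lintegral_ofReal hu.integrable_sq (ae_of_all _ fun _ => sq_nonneg _)]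
  refine lintegral_congr fun p => ?_
  rw [Real.enorm_eq_ofReal_abs, ← ENNReal.ofReal_pow (abs_nonneg _), sq_abs]

/-- The averages over the cells give the best approximation by a step kernel. -/
lemma IsCells.eLpNorm_sub_cellAvg_le (hB : IsCells ν B) (hf : MemLp f 2 (ν.prod ν))
    (b : ι → ι → ℝ) :
    eLpNorm (f - stepKernel B (cellAvg ν B f)) 2 (ν.prod ν) ≤
      eLpNorm (f - stepKernel B b) 2 (ν.prod ν) := by
  set a := cellAvg ν B f with ha
  set u := f - stepKernel B a with hu
  have hsa := hB.memLp_stepKernel (a := a) 2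
  have hsb := hB.memLp_stepKernel (a := b) 2
  have hu2 : MemLp u 2 (ν.prod ν) := hf.sub hsa
  -- The remainder is orthogonal to all step kernels over these cells, so averaging is the
  -- orthogonal projection onto them.
  have horth : ∀ c : ι → ι → ℝ, ∫ p, u p * stepKernel B c p ∂(ν.prod ν) = 0 := by
    intro c
    have hsc := hB.memLp_stepKernel (a := c) 2
    have h1 : Integrable (fun p => f p * stepKernel B c p) (ν.prod ν) := hf.integrable_mul hsc
    have h2 : Integrable (fun p => stepKernel B a p * stepKernel B c p) (ν.prod ν) :=
      hsa.integrable_mul hsc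
    simp only [hu, Pi.sub_apply, sub_mul]
    rw [integral_sub h1 h2, hB.integral_mul_stepKernel hf]
    have h3 : ∀ p, stepKernel B a p * stepKernel B c p = stepKernel B (fun i j => a i j * c i j) p := by
      intro p
      by_cases h : (∃ i, p.1 ∈ B i) ∧ ∃ j, p.2 ∈ B j
      · obtain ⟨⟨i, hi⟩, j, hj⟩ := h
        rw [hB.stepKernel_apply hi hj, hB.stepKernel_apply hi hj, hB.stepKernel_apply hi hj]
      · rw [stepKernel_eq_zero h, stepKernel_eq_zero h, stepKernel_eq_zero h, mul_zero]
    simp_rw [h3]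
    rw [hB.integral_stepKernel, sub_self]
  by_cases h0 : eLpNorm u 2 (ν.prod ν) = 0
  · rw [h0]
    exact zero_le
  have hsq : ∫ p, u p * u p ∂(ν.prod ν) = ∫ p, u p * (f - stepKernel B b) p ∂(ν.prod ν) := by
    have h1 : Integrable (fun p => u p * u p) (ν.prod ν) := hu2.integrable_mul hu2
    have h2 : Integrable (fun p => u p * (f - stepKernel B b) p) (ν.prod ν) :=
      hu2.integrable_mul (hf.sub hsb)
    rw [← sub_eq_zero, ← integral_sub h1 h2, ← horth (fun i j => b i j - a i j), ← stepKernel_sub]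
    refine integral_congr_ae (ae_of_all _ fun p => ?_)
    simp only [hu, Pi.sub_apply]
    ring
  have hle : eLpNorm u 2 (ν.prod ν) ^ 2 ≤
      eLpNorm u 2 (ν.prod ν) * eLpNorm (f - stepKernel B b) 2 (ν.prod ν) := by
    rw [eLpNorm_sq_eq_enorm_integral hu2, hsq]
    exact enorm_integral_mul_le _ hu2.1 (hf.sub hsb).1
  rwa [sq, ENNReal.mul_le_mul_iff_right h0 hu2.eLpNorm_ne_top] at hle

lemma IsCells.starOneOne_stepKernel (hB : IsCells ν B) (a b : ι → ι → ℝ) :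
    starOneOne ν (stepKernel B a) (stepKernel B b) = stepKernel B (stepContr (cellMass ν B) a b) := by
  ext ⟨x, y⟩
  by_cases h : (∃ i, x ∈ B i) ∧ ∃ j, y ∈ B j
  · obtain ⟨⟨j, hj⟩, k, hk⟩ := h
    rw [hB.stepKernel_apply (p := (x, y)) hj hk, starOneOne, stepContr]
    simp_rw [← measureReal_eq_cellMass]
    rw [← hB.integral_indicator_sum hB.fin]
    refine integral_congr_ae (ae_of_all _ fun z => ?_)
    simp only
    by_cases hz : ∃ i, z ∈ B i
    · obtain ⟨i, hi⟩ := hz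
      rw [hB.stepKernel_apply (p := (z, x)) hi hj, hB.stepKernel_apply (p := (z, y)) hi hk,
        Finset.sum_eq_single i, Set.indicator_of_mem hi]
      · exact fun l _ hl => Set.indicator_of_notMem (fun h => hl (hB.eq_of_mem h hi)) _
      · simp
    · rw [stepKernel_eq_zero (fun h => hz h.1), zero_mul]
      exact (Finset.sum_eq_zero fun i _ => Set.indicator_of_notMem (fun h => hz ⟨i, h⟩) _).symm
  · rw [stepKernel_eq_zero h, starOneOne]
    rw [← integral_zero Z ℝ]
    refine integral_congr_ae (ae_of_all _ fun z => ?_)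
    simp only
    by_cases hx : ∃ i, x ∈ B i
    · rw [stepKernel_eq_zero (p := (z, y)) fun h' => h ⟨hx, h'.2⟩, mul_zero]
    · rw [stepKernel_eq_zero (p := (z, x)) fun h' => hx h'.2, zero_mul]

lemma IsCells.stepSum_sq (hB : IsCells ν B) (a : ι → ι → ℝ) :
    stepSum (cellMass ν B) (fun i j => a i j ^ 2) = ∫ p, stepKernel B a p ^ 2 ∂(ν.prod ν) := by
  rw [← hB.integral_stepKernel]
  exact integral_congr_ae (ae_of_all _ fun p => (hB.comp_stepKernel (Φ := fun r => r ^ 2)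
    (by simp) p).symm)

/-- Jensen is used twice: on products of cells, to bound the column norms by averages of `f ⋆₂¹ f`,
and then on single cells for the square of that function. -/
lemma sum_stepCol_cellAvg_sq_le (hB : IsCells ν B) (hf : MemLp f 2 (ν.prod ν))
    (hq : MemLp (starTwoOne ν f f) 2 ν) :
    ∑ j, (cellMass ν B j : ℝ) * stepCol (cellMass ν B) (cellAvg ν B f) j ^ 2 ≤
      ∫ x, starTwoOne ν f f x ^ 2 ∂ν := by
  set l := cellMass ν B with hl
  set q := starTwoOne ν f f with hqdef
  have hq0 : ∀ x, 0 ≤ q x := fun x => integral_nonneg fun y => mul_self_nonneg _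
  have hsqi : Integrable (fun p => f p * f p) (ν.prod ν) := hf.integrable_mul hf
  have hlq : ∀ j, (l j : ℝ) * stepCol l (cellAvg ν B f) j ≤ ∫ x in B j, q x ∂ν := by
    intro j
    have h1 : (l j : ℝ) * stepCol l (cellAvg ν B f) j ≤
        ∑ i, ∫ p in B i ×ˢ B j, f p ^ 2 ∂(ν.prod ν) := by
      rw [stepCol, Finset.mul_sum]
      refine Finset.sum_le_sum fun i _ => ?_
      have := cellMass_mul_cellAvg_pow_le hB (k := 2) even_two one_le_two (by exact_mod_cast hf) i j
      calc _ = (l i : ℝ) * l j * cellAvg ν B f i j ^ 2 := by ring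
        _ ≤ _ := this
    refine h1.trans ?_
    have hi : ∀ i, Integrable ((B i ×ˢ B j).indicator fun p => f p ^ 2) (ν.prod ν) := fun i =>
      hf.integrable_sq.indicator ((hB.meas i).prod (hB.meas j))
    have e1 : ∑ i, ∫ p in B i ×ˢ B j, f p ^ 2 ∂(ν.prod ν) =
        ∫ p, ∑ i, (B i ×ˢ B j).indicator (fun p => f p ^ 2) p ∂(ν.prod ν) := by
      rw [integral_finsetSum _ fun i _ => hi i]
      refine Finset.sum_congr rfl fun i _ => ?_
      rw [integral_indicator ((hB.meas i).prod (hB.meas j))]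
    have hi2 : Integrable ((Set.univ ×ˢ B j).indicator fun p => f p * f p) (ν.prod ν) :=
      hsqi.indicator (MeasurableSet.univ.prod (hB.meas j))
    have e2 : ∫ p, (Set.univ ×ˢ B j).indicator (fun p => f p * f p) p ∂(ν.prod ν) =
        ∫ x in B j, q x ∂ν := by
      rw [integral_prod_symm _ hi2, ← integral_indicator (hB.meas j)]
      refine integral_congr_ae (ae_of_all _ fun x => ?_)
      by_cases hx : x ∈ B j <;> simp [hx, hqdef, starTwoOne]
    rw [e1, ← e2]
    refine integral_mono (integrable_finsetSum _ fun i _ => hi i) hi2 fun p => ?_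
    simp only
    by_cases hp : ∃ i, p ∈ B i ×ˢ B j
    · obtain ⟨i, hi⟩ := hp
      rw [Finset.sum_eq_single i, Set.indicator_of_mem hi,
        Set.indicator_of_mem (show p ∈ Set.univ ×ˢ B j from ⟨Set.mem_univ _, hi.2⟩), sq]
      · exact fun k _ hk => Set.indicator_of_notMem (fun h => hk (hB.eq_of_mem h.1 hi.1)) _
      · simp
    · rw [Finset.sum_eq_zero fun i _ => Set.indicator_of_notMem (fun h => hp ⟨i, h⟩) _]
      exact Set.indicator_nonneg (fun p _ => mul_self_nonneg _) _
  have hjen : ∀ j, (∫ x in B j, q x ∂ν) ^ 2 ≤ l j * ∫ x in B j, q x ^ 2 ∂ν := by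
    intro j
    by_cases h0 : ν (B j) = 0
    · simp [Measure.restrict_eq_zero.2 h0]
    have : IsFiniteMeasure (ν.restrict (B j)) := ⟨by simpa using hB.fin j⟩
    have h := (even_two.convexOn_pow (𝕜 := ℝ)).map_set_average_le (continuous_pow 2).continuousOn
      isClosed_univ h0 (hB.fin j).ne (ae_of_all _ fun _ => Set.mem_univ _)
      ((hq.restrict _).integrable one_le_two) hq.integrable_sq.integrableOn
    rw [setAverage_eq, setAverage_eq, measureReal_eq_cellMass, ← hl] at h
    have hpos : 0 < (l j : ℝ) := by
      rw [hl, ← measureReal_eq_cellMass]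
      exact ENNReal.toReal_pos h0 (hB.fin j).ne
    simp only [smul_eq_mul] at h
    rw [mul_pow, inv_pow, inv_mul_le_iff₀ (by positivity)] at h
    calc _ ≤ (l j : ℝ) ^ 2 * ((l j : ℝ)⁻¹ * ∫ x in B j, q x ^ 2 ∂ν) := h
      _ = _ := by field_simp
  have hj : ∀ j, (l j : ℝ) * stepCol l (cellAvg ν B f) j ^ 2 ≤ ∫ x in B j, q x ^ 2 ∂ν := by
    intro j
    have hcol : 0 ≤ stepCol l (cellAvg ν B f) j := Finset.sum_nonneg fun i _ => by positivity
    rcases eq_or_lt_of_le (l j).coe_nonneg with h0 | hpos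
    · rw [← h0, zero_mul]
      exact integral_nonneg fun x => sq_nonneg _
    · have := (pow_le_pow_left₀ (by positivity) (hlq j) 2).trans (hjen j)
      rw [mul_pow, sq (l j : ℝ), mul_assoc] at this
      exact le_of_mul_le_mul_left this hpos
  refine (Finset.sum_le_sum fun j _ => hj j).trans ?_
  have hi : ∀ j, Integrable ((B j).indicator fun x => q x ^ 2) ν := fun j =>
    hq.integrable_sq.indicator (hB.meas j)
  have e1 : ∑ j, ∫ x in B j, q x ^ 2 ∂ν = ∫ x, ∑ j, (B j).indicator (fun x => q x ^ 2) x ∂ν := by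
    rw [integral_finsetSum _ fun i _ => hi i]
    exact Finset.sum_congr rfl fun j _ => (integral_indicator (hB.meas j)).symm
  rw [e1]
  refine integral_mono (integrable_finsetSum _ fun i _ => hi i) hq.integrable_sq fun x => ?_
  simp only
  by_cases hx : ∃ i, x ∈ B i
  · obtain ⟨i, hi⟩ := hx
    rw [Finset.sum_eq_single i, Set.indicator_of_mem hi]
    · exact fun k _ hk => Set.indicator_of_notMem (fun h => hk (hB.eq_of_mem h hi)) _
    · simp
  · rw [Finset.sum_eq_zero fun i _ => Set.indicator_of_notMem (fun h => hx ⟨i, h⟩) _]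
    exact sq_nonneg _

end Averages

end

noncomputable section

/-! ### Characteristic functions of discretized double integrals; independence from disjoint cells.
-/

section CharacteristicFunction

lemma integral_pow_eq_eLpNorm_pow {α : Type*} [MeasurableSpace α] {μ : Measure α} {u : α → ℝ}
    {k : ℕ} (hk : Even k) (hk0 : k ≠ 0) (hu : MemLp u k μ) :
    ∫ x, u x ^ k ∂μ = (eLpNorm u k μ).toReal ^ k := by
  have hi : 0 ≤ ∫ x, u x ^ k ∂μ := integral_nonneg fun x => hk.pow_nonneg _
  have h := hu.eLpNorm_eq_integral_rpow_norm (by exact_mod_cast hk0) (ENNReal.natCast_ne_top k)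
  have e : ∀ x, ‖u x‖ ^ (k : ℝ≥0∞).toReal = u x ^ k := fun x => by
    rw [ENNReal.toReal_natCast, Real.rpow_natCast, Real.norm_eq_abs, hk.pow_abs]
  simp_rw [e] at h
  rw [h, ENNReal.toReal_ofReal (by positivity), ENNReal.toReal_natCast,
    Real.rpow_inv_natCast_pow hi hk0]

lemma poissonQuad_const_mul {ι : Type*} [Fintype ι] (l : ι → ℝ≥0) (a : ι → ι → ℝ) (θ : ℝ)
    (n : ι → ℕ) : poissonQuad l (fun i j => θ * a i j) n = θ * poissonQuad l a n := by
  simp only [poissonQuad, poissonLin, Finset.mul_sum, mul_sub]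
  refine Finset.sum_congr rfl fun i _ => ?_
  congr 1
  · exact Finset.sum_congr rfl fun j _ => by ring
  · ring

variable {Ω Z : Type*} [MeasurableSpace Ω] [MeasurableSpace Z] {P : Measure Ω}
  [IsProbabilityMeasure P] {ν : Measure Z} [SFinite ν] {η : Ω → Measure Z}
  {ι : Type*} [Fintype ι] {B : ι → Set Z} {f : Z × Z → ℝ}

/-- A quantitative central limit theorem for the double integral of the averages of a kernel. -/
lemma IsPoissonPointProcess.norm_integral_cexp_cellAvg_sub_le (hη : IsPoissonPointProcess η ν P)
    (hB : IsCells ν B) (hsymm : ∀ x y, f (x, y) = f (y, x)) (hf2 : MemLp f 2 (ν.prod ν))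
    (hf4 : MemLp f 4 (ν.prod ν)) (hq : MemLp (starTwoOne ν f f) 2 ν) (θ : ℝ) {c : ℝ} (hc : 0 < c)
    {k : Z × Z → ℝ} (hk : k = stepKernel B (cellAvg ν B f)) :
    ‖∫ ω, Complex.exp ((θ * pathwiseDoubleIntegral η ν k ω : ℝ) * Complex.I) ∂P -
        Complex.exp (-(θ ^ 2 * (eLpNorm k 2 (ν.prod ν)).toReal ^ 2) : ℝ)‖ ≤
      c * (1 + 6 * (θ ^ 2 * (eLpNorm k 2 (ν.prod ν)).toReal ^ 2)) +
      θ ^ 4 * (4 * (eLpNorm (starOneOne ν k k) 2 (ν.prod ν)).toReal ^ 2 +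
        20 * (eLpNorm (starTwoOne ν f f) 2 ν).toReal ^ 2 +
        6 * (eLpNorm f 4 (ν.prod ν)).toReal ^ 4) / c := by
  set l := cellMass ν B with hl
  set a := cellAvg ν B f with ha
  have hV : stepSum l (fun i j => a i j ^ 2) = (eLpNorm k 2 (ν.prod ν)).toReal ^ 2 := by
    rw [hl, hB.stepSum_sq, ← hk]
    exact integral_pow_eq_eLpNorm_pow even_two two_ne_zero
      (by rw [hk]; exact_mod_cast hB.memLp_stepKernel 2)
  have hT : stepSum l (fun i j => stepContr l a a i j ^ 2) =
      (eLpNorm (starOneOne ν k k) 2 (ν.prod ν)).toReal ^ 2 := by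
    rw [hl, hB.stepSum_sq, hk, hB.starOneOne_stepKernel]
    exact integral_pow_eq_eLpNorm_pow even_two two_ne_zero
      (by exact_mod_cast hB.memLp_stepKernel 2)
  have hQ : ∑ j, (l j : ℝ) * stepCol l a j ^ 2 ≤ (eLpNorm (starTwoOne ν f f) 2 ν).toReal ^ 2 :=
    (sum_stepCol_cellAvg_sq_le hB hf2 hq).trans_eq
      (integral_pow_eq_eLpNorm_pow even_two two_ne_zero (by exact_mod_cast hq))
  have h4 : Even 4 := by decide
  have hW : stepSum l (fun i j => a i j ^ 4) ≤ (eLpNorm f 4 (ν.prod ν)).toReal ^ 4 :=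
    (stepSum_cellAvg_pow_le hB h4 (by norm_num) (by exact_mod_cast hf4)).trans_eq
      (integral_pow_eq_eLpNorm_pow h4 four_ne_zero (by exact_mod_cast hf4))
  have e1 : ∫ ω, Complex.exp ((θ * pathwiseDoubleIntegral η ν k ω : ℝ) * Complex.I) ∂P =
      ∫ n, Complex.exp ((poissonQuad l (fun i j => θ * a i j) n : ℝ) * Complex.I)
        ∂(poissonVec l) := by
    have hm : StronglyMeasurable fun x : ι → ℝ≥0∞ =>
        Complex.exp ((θ * stepQuad l a x : ℝ) * Complex.I) := by
      have := measurable_stepQuad l a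
      exact Measurable.stronglyMeasurable (by fun_prop)
    have h := hη.integral_cells hB.meas hB.disj hB.fin hm
    simp_rw [stepQuad_natCast, ← poissonQuad_const_mul] at h
    rw [← h]
    refine integral_congr_ae ?_
    filter_upwards [hη.doubleInt_stepKernel_ae (a := a) hB] with ω hω
    rw [hk, hω]
  have hs : ∀ m : ℕ, stepSum l (fun i j => (θ * a i j) ^ m) =
      θ ^ m * stepSum l (fun i j => a i j ^ m) := fun m => by
    simp only [stepSum, Finset.mul_sum, mul_pow]
    exact Finset.sum_congr rfl fun i _ => Finset.sum_congr rfl fun j _ => by ring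
  have hcol : ∀ j, stepCol l (fun i j => θ * a i j) j ^ 2 = θ ^ 4 * stepCol l a j ^ 2 := by
    intro j
    have : stepCol l (fun i j => θ * a i j) j = θ ^ 2 * stepCol l a j := by
      simp only [stepCol, Finset.mul_sum, mul_pow]
      exact Finset.sum_congr rfl fun i _ => by ring
    rw [this]
    ring
  have hcon : ∀ j k, stepContr l (fun i j => θ * a i j) (fun i j => θ * a i j) j k =
      θ ^ 2 * stepContr l a a j k := by
    intro j k
    simp only [stepContr, Finset.mul_sum]
    exact Finset.sum_congr rfl fun i _ => by ring
  have hcon2 : stepSum l (fun j k => stepContr l (fun i j => θ * a i j) (fun i j => θ * a i j)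
      j k ^ 2) = θ ^ 4 * stepSum l (fun j k => stepContr l a a j k ^ 2) := by
    simp only [stepSum, hcon, Finset.mul_sum]
    exact Finset.sum_congr rfl fun i _ => Finset.sum_congr rfl fun j _ => by ring
  -- The frequency is absorbed into the kernel: with `θ * a` in place of `a`, the variance scales by
  -- `θ ^ 2` and the three error terms by `θ ^ 4`.
  have h := norm_integral_cexp_poissonQuad_sub_le l (a := fun i j => θ * a i j)
    (fun i j => by rw [ha, cellAvg_symm hB hsymm]) hc
  rw [← e1, hs, hs, hcon2, hV, hT] at h
  simp_rw [hcol] at h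
  refine h.trans (add_le_add le_rfl ?_)
  have e2 : ∑ j, (l j : ℝ) * (θ ^ 4 * stepCol l a j ^ 2) =
      θ ^ 4 * ∑ j, (l j : ℝ) * stepCol l a j ^ 2 := by
    rw [Finset.mul_sum]
    exact Finset.sum_congr rfl fun j _ => by ring
  rw [e2]
  gcongr
  have hθ : 0 ≤ θ ^ 4 := by positivity
  have := mul_le_mul_of_nonneg_left hQ hθ
  have := mul_le_mul_of_nonneg_left hW hθ
  linarith

lemma stepQuad_congr {l : ι → ℝ≥0} {a : ι → ι → ℝ} {x x' : ι → ℝ≥0∞} {T : Set ι}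
    (ha : ∀ i j, i ∉ T ∨ j ∉ T → a i j = 0) (hx : ∀ i ∈ T, x i = x' i) :
    stepQuad l a x = stepQuad l a x' := by
  refine Finset.sum_congr rfl fun i _ => ?_
  by_cases hi : i ∈ T
  · rw [hx i hi]
    congr 2
    refine Finset.sum_congr rfl fun j _ => ?_
    by_cases hj : j ∈ T
    · rw [hx j hj]
    · simp [ha i j (Or.inr hj)]
  · simp [ha i _ (Or.inl hi)]

/-- The double integral of a step kernel is independent of the restriction of the point process
to a set where the kernel vanishes. -/
lemma IsPoissonPointProcess.setIntegral_cexp_stepKernel (hη : IsPoissonPointProcess η ν P)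
    {𝒜 𝒟 : Finset (Set Z)} (h𝒜 : IsFiniteFamily ν 𝒜) (hsub : 𝒟 ⊆ 𝒜) {a : Trace 𝒜 → Trace 𝒜 → ℝ}
    (ha : ∀ S T, ((∃ A ∈ S.1, A.1 ∈ 𝒟) ∨ ∃ A ∈ T.1, A.1 ∈ 𝒟) → a S T = 0)
    {U : Set Z → Set ℝ≥0∞} (hU : ∀ A, MeasurableSet (U A)) (θ : ℝ) :
    ∫ ω in {ω | ∀ A ∈ 𝒟, η ω A ∈ U A},
      Complex.exp ((θ * pathwiseDoubleIntegral η ν (stepKernel (atom 𝒜) a) ω : ℝ) * Complex.I) ∂P =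
    P.real {ω | ∀ A ∈ 𝒟, η ω A ∈ U A} *
      ∫ ω, Complex.exp ((θ * pathwiseDoubleIntegral η ν (stepKernel (atom 𝒜) a) ω : ℝ) *
        Complex.I) ∂P := by
  classical
  set E := {ω | ∀ A ∈ 𝒟, η ω A ∈ U A} with hE
  have hB := h𝒜.isCells
  set X : Trace 𝒜 → Ω → ℝ≥0∞ := fun S ω => η ω (atom 𝒜 S) with hX
  have hXm : ∀ S, Measurable (X S) := fun S => hη.measurable_apply (hB.meas S)
  have hind : iIndepFun X P := hη.iIndepFun_cells hB.meas hB.disj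
  -- `T` indexes the atoms outside all members of `𝒟`. The kernel only uses counts in `T` and the
  -- event only counts in its complement, so independence of disjoint subfamilies applies.
  set T : Finset (Trace 𝒜) := {S | ∀ A ∈ S.1, A.1 ∉ 𝒟} with hT
  have hIF := hind.indepFun_finset T Tᶜ disjoint_compl_right fun S => hXm S
  -- Padding by zero presents both quantities as functions of a subfamily of the counts.
  let ext : (R : Finset (Trace 𝒜)) → (R → ℝ≥0∞) → Trace 𝒜 → ℝ≥0∞ :=
    fun R y S => if h : S ∈ R then y ⟨S, h⟩ else 0
  have hext : ∀ R, Measurable (ext R) := fun R => by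
    refine measurable_pi_lambda _ fun S => ?_
    by_cases h : S ∈ R
    · simpa [ext, h] using measurable_pi_apply _
    · simp [ext, h]
  have hquad : ∀ ω, stepQuad (cellMass ν (atom 𝒜)) a (fun S => X S ω) =
      stepQuad (cellMass ν (atom 𝒜)) a (ext T fun S => X S ω) := by
    intro ω
    refine stepQuad_congr (T := {S | S ∈ T}) (fun S S' h => ha S S' ?_) fun S hS => ?_
    · simpa [hT] using h
    · have hS' : S ∈ T := hS
      simp [ext, hS']
  have hmass : ∀ A ∈ 𝒟, ∀ ω, η ω A = ∑ S : Trace 𝒜, if (∃ hA : A ∈ 𝒜, ⟨A, hA⟩ ∈ S.1) then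
      (ext Tᶜ fun S => X S ω) S else 0 := by
    intro A hA ω
    rw [measure_eq_sum_atoms h𝒜 (η ω) ⟨A, hsub hA⟩]
    refine Finset.sum_congr rfl fun S _ => ?_
    by_cases hS : (⟨A, hsub hA⟩ : 𝒜) ∈ S.1
    · have hST : S ∈ Tᶜ := by
        simp only [hT, Finset.mem_compl, Finset.mem_filter, Finset.mem_univ, true_and, not_forall]
        exact ⟨⟨A, hsub hA⟩, hS, by simpa using hA⟩
      rw [if_pos hS, if_pos ⟨hsub hA, hS⟩]
      simp only [ext, hST, dite_true, hX]
    · rw [if_neg hS, if_neg (fun h => hS h.2)]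
  set φ : (↥(Tᶜ) → ℝ≥0∞) → ℂ := Set.indicator {y | ∀ A ∈ 𝒟, (∑ S : Trace 𝒜,
    if (∃ hA : A ∈ 𝒜, ⟨A, hA⟩ ∈ S.1) then ext Tᶜ y S else 0) ∈ U A} (fun _ => 1) with hφ
  have hφm : Measurable φ := by
    refine measurable_const.indicator ?_
    have : {y : ↥(Tᶜ) → ℝ≥0∞ | ∀ A ∈ 𝒟, (∑ S : Trace 𝒜,
        if (∃ hA : A ∈ 𝒜, ⟨A, hA⟩ ∈ S.1) then ext Tᶜ y S else 0) ∈ U A} =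
        ⋂ A ∈ 𝒟, (fun y => ∑ S : Trace 𝒜,
          if (∃ hA : A ∈ 𝒜, ⟨A, hA⟩ ∈ S.1) then ext Tᶜ y S else 0) ⁻¹' U A := by
      ext y
      simp
    rw [this]
    refine Finset.measurableSet_biInter _ fun A _ => ?_
    refine Finset.measurable_sum _ (fun S _ => ?_) (hU A)
    split_ifs
    · exact (measurable_pi_apply S).comp (hext _)
    · exact measurable_const
  set ψ : (T → ℝ≥0∞) → ℂ := fun y =>
    Complex.exp ((θ * stepQuad (cellMass ν (atom 𝒜)) a (ext T y) : ℝ) * Complex.I) with hψ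
  have hψm : Measurable ψ := by
    have := (measurable_stepQuad (cellMass ν (atom 𝒜)) a).comp (hext T)
    simp only [Function.comp_def] at this
    fun_prop
  have hEm : MeasurableSet E := by
    have : E = ⋂ A ∈ 𝒟, {ω | η ω A ∈ U A} := by
      ext ω
      simp [hE]
    rw [this]
    exact Finset.measurableSet_biInter _ fun A hA => hη.measurable_apply (h𝒜 A (hsub hA)).1 (hU A)
  have hφE : ∀ ω, φ (fun S => X S ω) = E.indicator (fun _ => 1) ω := by
    intro ω
    simp only [hφ, Set.indicator_apply, Set.mem_ofPred_eq, hE]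
    refine if_congr (forall₂_congr fun A hA => ?_) rfl rfl
    rw [hmass A hA ω]
  have hψE : (fun ω => Complex.exp ((θ * pathwiseDoubleIntegral η ν (stepKernel (atom 𝒜) a) ω : ℝ) *
      Complex.I)) =ᵐ[P] fun ω => ψ (fun S => X S ω) := by
    filter_upwards [hη.doubleInt_stepKernel_ae (a := a) hB] with ω hω
    rw [hω, hψ]
    simp only
    rw [← hquad]
  have hprod := (hIF.comp hψm hφm).integral_fun_mul_eq_mul_integral
    ((hψm.comp (measurable_pi_lambda _ fun S => hXm S)).aestronglyMeasurable)
    ((hφm.comp (measurable_pi_lambda _ fun S => hXm S)).aestronglyMeasurable)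
  simp only [Function.comp_apply, hφE] at hprod
  rw [integral_congr_ae hψE, setIntegral_congr_ae hEm (hψE.mono fun ω h _ => h),
    ← integral_indicator hEm]
  rw [integral_indicator_const _ hEm] at hprod
  rw [mul_comm]
  refine Eq.trans (integral_congr_ae (ae_of_all _ fun ω => ?_)) (hprod.trans ?_)
  · by_cases h : ω ∈ E <;> simp [h]
  · simp [mul_comm]

end CharacteristicFunction

end

noncomputable section

/-! ### The limit theorem on events that involve finitely many point counts. -/

section CylinderLimit

variable {Z : Type*} [MeasurableSpace Z] {ν : Measure Z} {f : Z × Z → ℝ}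

/-- Including `𝒟` in the family makes every atom lie inside or outside each member of `𝒟`. The
vanishing of `f` there thus passes to its averages. -/
lemma exists_finiteFamily_eLpNorm_sub_cellAvg_le [SigmaFinite ν] {𝒟 : Finset (Set Z)}
    (h𝒟 : IsFiniteFamily ν 𝒟) (hf : MemLp f 2 (ν.prod ν))
    (hf0 : ∀ x y, ((∃ A ∈ 𝒟, x ∈ A) ∨ ∃ A ∈ 𝒟, y ∈ A) → f (x, y) = 0) {ε : ℝ≥0∞} (hε : ε ≠ 0) :
    ∃ 𝒜 : Finset (Set Z), 𝒟 ⊆ 𝒜 ∧ IsFiniteFamily ν 𝒜 ∧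
      eLpNorm (f - stepKernel (atom 𝒜) (cellAvg ν (atom 𝒜) f)) 2 (ν.prod ν) ≤ ε ∧
      ∀ S T : Trace 𝒜, ((∃ A ∈ S.1, A.1 ∈ 𝒟) ∨ ∃ A ∈ T.1, A.1 ∈ 𝒟) →
        cellAvg ν (atom 𝒜) f S T = 0 := by
  classical
  obtain ⟨s, ⟨ℬ, hℬ, hs⟩, hsε⟩ := exists_stepOver_eLpNorm_sub_le hf hε
  have hfam : IsFiniteFamily ν (𝒟 ∪ ℬ) := fun A hA =>
    (Finset.mem_union.1 hA).elim (h𝒟 A) (hℬ A)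
  obtain ⟨b, rfl⟩ := hs _ Finset.subset_union_right hfam
  refine ⟨𝒟 ∪ ℬ, Finset.subset_union_left, hfam,
    (hfam.isCells.eLpNorm_sub_cellAvg_le hf b).trans hsε, fun S T hST => ?_⟩
  have h0 : ∫ p in atom (𝒟 ∪ ℬ) S ×ˢ atom (𝒟 ∪ ℬ) T, f p ∂(ν.prod ν) = 0 := by
    refine setIntegral_eq_zero_of_forall_eq_zero fun p hp => hf0 p.1 p.2 (hST.imp ?_ ?_)
    · rintro ⟨A, hA, hA𝒟⟩
      exact ⟨A.1, hA𝒟, (mem_iff_mem_trace hp.1 A).2 hA⟩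
    · rintro ⟨A, hA, hA𝒟⟩
      exact ⟨A.1, hA𝒟, (mem_iff_mem_trace hp.2 A).2 hA⟩
  rw [cellAvg, setAverage_eq, h0, smul_zero]

lemma eLpNorm_starTwoOne_indicator_le [SFinite ν] (E : Set (Z × Z))
    (hf2 : MemLp f 2 (ν.prod ν)) :
    eLpNorm (starTwoOne ν (E.indicator f) (E.indicator f)) 2 ν ≤
      eLpNorm (starTwoOne ν f f) 2 ν := by
  refine eLpNorm_mono_ae ?_
  have hsq : Integrable (fun p => f p * f p) (ν.prod ν) := hf2.integrable_mul hf2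
  filter_upwards [hsq.swap.prod_right_ae] with x hx
  simp only [Function.comp_apply, Prod.swap] at hx
  rw [starTwoOne, starTwoOne, Real.norm_of_nonneg (integral_nonneg fun y => mul_self_nonneg _),
    Real.norm_of_nonneg (integral_nonneg fun y => mul_self_nonneg _)]
  refine integral_mono_of_nonneg (ae_of_all _ fun y => mul_self_nonneg _) hx
    (ae_of_all _ fun y => ?_)
  by_cases hp : (y, x) ∈ E
  · simp [hp]
  · simp [hp, mul_self_nonneg]

lemma measurable_starTwoOne [SFinite ν] (hf : Measurable f) : Measurable (starTwoOne ν f f) := by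
  have : StronglyMeasurable fun q : Z × Z => f (q.2, q.1) * f (q.2, q.1) :=
    ((hf.comp (by fun_prop)).mul (hf.comp (by fun_prop))).stronglyMeasurable
  exact this.integral_prod_right'.measurable

lemma norm_cexp_mul_I_sub_le (x y : ℝ) :
    ‖Complex.exp (x * Complex.I) - Complex.exp (y * Complex.I)‖ ≤ |x - y| := by
  have h : Complex.exp (x * Complex.I) - Complex.exp (y * Complex.I) =
      Complex.exp (y * Complex.I) * (Complex.exp (Complex.I * (x - y : ℝ)) - 1) := by
    rw [mul_sub, ← Complex.exp_add, mul_one]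
    congr 2
    push_cast
    ring
  rw [h, norm_mul, Complex.norm_exp_ofReal_mul_I, one_mul]
  simpa using Real.norm_exp_I_mul_ofReal_sub_one_le (x := x - y)

lemma norm_setIntegral_cexp_sub_le {Ω : Type*} [MeasurableSpace Ω] {P : Measure Ω}
    [IsProbabilityMeasure P] {X Y : Ω → ℝ} (hX : AEStronglyMeasurable X P)
    (hY : AEStronglyMeasurable Y P) (E : Set Ω) (θ : ℝ)
    (hXY : eLpNorm (X - Y) 2 P ≠ ∞) :
    ‖∫ ω in E, Complex.exp ((θ * X ω : ℝ) * Complex.I) ∂P -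
      ∫ ω in E, Complex.exp ((θ * Y ω : ℝ) * Complex.I) ∂P‖ ≤
      |θ| * (eLpNorm (X - Y) 2 P).toReal := by
  have hi : ∀ {X : Ω → ℝ}, AEStronglyMeasurable X P →
      Integrable (fun ω => Complex.exp ((θ * X ω : ℝ) * Complex.I)) P := by
    intro X hX
    refine Integrable.of_bound (C := 1) ?_ (ae_of_all _ fun ω => ?_)
    · have : Continuous fun r : ℝ => Complex.exp ((θ * r : ℝ) * Complex.I) := by fun_prop
      exact this.comp_aestronglyMeasurable hX
    · rw [Complex.norm_exp_ofReal_mul_I]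
  rw [← integral_sub (hi hX).integrableOn (hi hY).integrableOn]
  have hXY2 : MemLp (X - Y) 2 P := ⟨hX.sub hY, hXY.lt_top⟩
  have hint : Integrable (fun ω => |θ| * |(X - Y) ω|) P := ((hXY2.integrable one_le_two).abs).const_mul _
  calc ‖∫ ω in E, (Complex.exp ((θ * X ω : ℝ) * Complex.I) -
        Complex.exp ((θ * Y ω : ℝ) * Complex.I)) ∂P‖
      ≤ ∫ ω in E, |θ| * |(X - Y) ω| ∂P := by
        refine norm_integral_le_of_norm_le hint.integrableOn (ae_of_all _ fun ω => ?_)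
        refine (norm_cexp_mul_I_sub_le _ _).trans (le_of_eq ?_)
        rw [← mul_sub, abs_mul, Pi.sub_apply]
    _ ≤ ∫ ω, |θ| * |(X - Y) ω| ∂P :=
        setIntegral_le_integral hint (ae_of_all _ fun ω => by positivity)
    _ = |θ| * (eLpNorm (X - Y) 1 P).toReal := by
        rw [integral_const_mul]
        congr 1
        rw [eLpNorm_one_eq_lintegral_enorm, ← integral_toReal]
        · simp
        · exact hXY2.1.enorm
        · exact ae_of_all _ fun ω => enorm_lt_top
    _ ≤ |θ| * (eLpNorm (X - Y) 2 P).toReal := by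
        refine mul_le_mul_of_nonneg_left (ENNReal.toReal_mono hXY ?_) (abs_nonneg _)
        exact eLpNorm_le_eLpNorm_of_exponent_le one_le_two hXY2.1

/-- Minimizing over the free parameter `c` of a bound `c * A + R / c`. -/
lemma tendsto_zero_of_forall_le {E : Type*} [SeminormedAddCommGroup E] {u : ℕ → E} {A R : ℕ → ℝ}
    {a : ℝ} (hA : Tendsto A atTop (𝓝 a)) (hR : Tendsto R atTop (𝓝 0)) (hR0 : ∀ n, 0 ≤ R n)
    (h : ∀ᶠ n in atTop, ∀ c : ℝ, 0 < c → ‖u n‖ ≤ c * A n + R n / c) :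
    Tendsto u atTop (𝓝 0) := by
  -- The choice `c = √R` balances the bound; the summand `1 / (n + 1)` keeps `c` positive where `R`
  -- vanishes.
  have hc : Tendsto (fun n : ℕ => √(R n) + 1 / ((n : ℝ) + 1)) atTop (𝓝 0) := by
    have h1 : Tendsto (fun n => √(R n)) atTop (𝓝 0) := by simpa using hR.sqrt
    simpa using h1.add tendsto_one_div_add_atTop_nhds_zero_nat
  have hlim : Tendsto (fun n : ℕ => (√(R n) + 1 / ((n : ℝ) + 1)) * A n + √(R n)) atTop (𝓝 0) := by
    have h1 : Tendsto (fun n => √(R n)) atTop (𝓝 0) := by simpa using hR.sqrt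
    simpa using (hc.mul hA).add h1
  refine squeeze_zero_norm' ?_ hlim
  filter_upwards [h] with n hn
  have hp : 0 < √(R n) + 1 / ((n : ℝ) + 1) := by positivity
  refine (hn _ hp).trans (add_le_add le_rfl ?_)
  rw [div_le_iff₀ hp]
  have h1 : √(R n) * √(R n) = R n := Real.mul_self_sqrt (hR0 n)
  have h2 : 0 ≤ √(R n) * (1 / ((n : ℝ) + 1)) := by positivity
  rw [mul_add, h1]
  linarith

variable {Ω : Type*} [MeasurableSpace Ω] {P : Measure Ω} [IsProbabilityMeasure P]
  {η : Ω → Measure Z}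

/-- The central limit theorem for double integrals, mixing with respect to cylinder events. -/
lemma IsPoissonPointProcess.tendsto_setIntegral_cexp_cylinder [SigmaFinite ν]
    (hη : IsPoissonPointProcess η ν P)
    {g : ℕ → Z × Z → ℝ} {F : ℕ → Ω → ℝ} (hgm : ∀ n, Measurable (g n))
    (hsymm : ∀ n x y, g n (x, y) = g n (y, x)) (hg2 : ∀ n, MemLp (g n) 2 (ν.prod ν))
    (hF : ∀ n, IsDoublePoissonIntegral η ν P (g n) (F n)) {σ : ℝ≥0∞} (hσ : σ ≠ ∞)
    (hnorm : Tendsto (fun n => eLpNorm (g n) 2 (ν.prod ν)) atTop (𝓝 σ))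
    (hstar : Tendsto (fun n => eLpNorm (starOneOne ν (g n) (g n)) 2 (ν.prod ν)) atTop (𝓝 0))
    (h4 : Tendsto (fun n => eLpNorm (g n) 4 (ν.prod ν)) atTop (𝓝 0))
    (hq : Tendsto (fun n => eLpNorm (starTwoOne ν (g n) (g n)) 2 ν) atTop (𝓝 0))
    {𝒟 : Finset (Set Z)} (h𝒟 : IsFiniteFamily ν 𝒟) {U : Set Z → Set ℝ≥0∞}
    (hU : ∀ A, MeasurableSet (U A)) (θ : ℝ) :
    Tendsto (fun n => ∫ ω in {ω | ∀ A ∈ 𝒟, η ω A ∈ U A},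
      Complex.exp ((θ * F n ω : ℝ) * Complex.I) ∂P) atTop
      (𝓝 (P.real {ω | ∀ A ∈ 𝒟, η ω A ∈ U A} *
        Complex.exp (-(θ ^ 2 * σ.toReal ^ 2) : ℝ))) := by
  set E := {ω | ∀ A ∈ 𝒟, η ω A ∈ U A} with hE
  set D := ⋃ A ∈ 𝒟, A with hD
  have hDm : MeasurableSet D := Finset.measurableSet_biUnion _ fun A hA => (h𝒟 A hA).1
  have hDf : ν D < ∞ :=
    (measure_biUnion_finset_le _ _).trans_lt (ENNReal.sum_lt_top.2 fun A hA => (h𝒟 A hA).2)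
  have hmem : ∀ x, (∃ A ∈ 𝒟, x ∈ A) ↔ x ∈ D := fun x => by simp [hD]
  have hDD : MeasurableSet (Dᶜ ×ˢ Dᶜ) := hDm.compl.prod hDm.compl
  -- Points of `D` are cut out of the kernel in both variables; the loss of local mass makes the cut
  -- negligible in `L²`.
  set f : ℕ → Z × Z → ℝ := fun n => (Dᶜ ×ˢ Dᶜ).indicator (g n) with hf
  have hf2 : ∀ n, MemLp (f n) 2 (ν.prod ν) := fun n => (hg2 n).indicator hDD
  have hfsymm : ∀ n x y, f n (x, y) = f n (y, x) := by
    intro n x y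
    by_cases hx : x ∈ D <;> by_cases hy : y ∈ D <;> simp [hf, hx, hy, hsymm n x y]
  have hf0 : ∀ n x y, ((∃ A ∈ 𝒟, x ∈ A) ∨ ∃ A ∈ 𝒟, y ∈ A) → f n (x, y) = 0 := by
    intro n x y h
    rw [hmem, hmem] at h
    refine Set.indicator_of_notMem (fun hp => ?_) _
    exact h.elim hp.1 hp.2
  -- The approximation tolerance is `1 / n`; its value `∞` at `n = 0` is harmless.
  have hε : ∀ n : ℕ, ((n : ℝ≥0∞))⁻¹ ≠ 0 := fun n => by simp
  choose 𝒜 h𝒟𝒜 h𝒜 happ hzero using fun n =>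
    exists_finiteFamily_eLpNorm_sub_cellAvg_le h𝒟 (hf2 n) (hf0 n) (hε n)
  set k : ℕ → Z × Z → ℝ := fun n => stepKernel (atom (𝒜 n)) (cellAvg ν (atom (𝒜 n)) (f n)) with hk
  have hkm : ∀ n, Measurable (k n) := fun n => (h𝒜 n).isCells.measurable_stepKernel
  have hkp : ∀ n p, MemLp (k n) p (ν.prod ν) := fun n p => (h𝒜 n).isCells.memLp_stepKernel p
  have hinv : Tendsto (fun n : ℕ => ((n : ℝ≥0∞))⁻¹) atTop (𝓝 0) :=
    ENNReal.tendsto_inv_nat_nhds_zero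
  have hgf : Tendsto (fun n => eLpNorm (g n - f n) 2 (ν.prod ν)) atTop (𝓝 0) := by
    have h0 : Tendsto (fun n => 4 * (eLpNorm (starTwoOne ν (g n) (g n)) 2 ν ^ 2 * ν D)) atTop
        (𝓝 0) := by
      have h := ENNReal.Tendsto.const_mul (ENNReal.Tendsto.mul_const (ENNReal.Tendsto.pow (n := 2) hq)
        (Or.inr hDf.ne)) (a := 4) (Or.inr (by norm_num))
      simpa using h
    have h1 : Tendsto (fun n => eLpNorm (g n - f n) 2 (ν.prod ν) ^ 4) atTop (𝓝 0) :=
      tendsto_of_tendsto_of_tendsto_of_le_of_le tendsto_const_nhds h0 (fun n => zero_le)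
        fun n => eLpNorm_sub_indicator_le (hgm n) (hg2 n) (hsymm n) hDm
    have h2 := ((ENNReal.continuous_rpow_const (y := (1 / 4 : ℝ))).tendsto 0).comp h1
    rw [ENNReal.zero_rpow_of_pos (by norm_num)] at h2
    refine h2.congr fun n => ?_
    simp only [Function.comp_apply]
    rw [← ENNReal.rpow_natCast, ← ENNReal.rpow_mul]
    norm_num
  have hgk : Tendsto (fun n => eLpNorm (g n - k n) 2 (ν.prod ν)) atTop (𝓝 0) := by
    refine tendsto_of_tendsto_of_tendsto_of_le_of_le tendsto_const_nhds
      (by simpa using hgf.add hinv) (fun n => zero_le) fun n => ?_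
    rw [← sub_add_sub_cancel (g n) (f n) (k n)]
    exact (eLpNorm_add_le ((hg2 n).1.sub (hf2 n).1) ((hf2 n).1.sub (hkp n 2).1) one_le_two).trans
      (add_le_add le_rfl (happ n))
  have hknorm : Tendsto (fun n => eLpNorm (k n) 2 (ν.prod ν)) atTop (𝓝 σ) := by
    have hlow : Tendsto (fun n => eLpNorm (g n) 2 (ν.prod ν) - eLpNorm (g n - k n) 2 (ν.prod ν))
        atTop (𝓝 σ) := by
      simpa using ENNReal.Tendsto.sub hnorm hgk (Or.inl hσ)
    have hup : Tendsto (fun n => eLpNorm (g n) 2 (ν.prod ν) + eLpNorm (g n - k n) 2 (ν.prod ν))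
        atTop (𝓝 σ) := by
      simpa using hnorm.add hgk
    refine tendsto_of_tendsto_of_tendsto_of_le_of_le hlow hup (fun n => ?_) fun n => ?_
    · refine tsub_le_iff_right.2 ?_
      have := eLpNorm_add_le (hkp n 2).1 ((hg2 n).1.sub (hkp n 2).1) one_le_two
      rwa [add_sub_cancel] at this
    · have := eLpNorm_sub_le (hg2 n).1 ((hg2 n).1.sub (hkp n 2).1) one_le_two
      rwa [sub_sub_cancel] at this
  have hkstar : Tendsto (fun n => eLpNorm (starOneOne ν (k n) (k n)) 2 (ν.prod ν)) atTop (𝓝 0) := by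
    have h1 := ENNReal.Tendsto.mul (hknorm.add hnorm) (Or.inr ENNReal.zero_ne_top) hgk
      (Or.inr (ENNReal.add_ne_top.2 ⟨hσ, hσ⟩))
    have h2 := hstar.add h1
    rw [mul_zero, add_zero] at h2
    refine tendsto_of_tendsto_of_tendsto_of_le_of_le tendsto_const_nhds h2 (fun n => zero_le)
      fun n => ?_
    have := eLpNorm_starOneOne_self_le (hkm n) (hgm n) (hkp n 2) (hg2 n)
    rwa [eLpNorm_sub_comm] at this
  have hf4 : Tendsto (fun n => eLpNorm (f n) 4 (ν.prod ν)) atTop (𝓝 0) :=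
    tendsto_of_tendsto_of_tendsto_of_le_of_le tendsto_const_nhds h4 (fun n => zero_le)
      fun n => eLpNorm_indicator_le _
  have hfq : Tendsto (fun n => eLpNorm (starTwoOne ν (f n) (f n)) 2 ν) atTop (𝓝 0) :=
    tendsto_of_tendsto_of_tendsto_of_le_of_le tendsto_const_nhds hq (fun n => zero_le)
      fun n => eLpNorm_starTwoOne_indicator_le _ (hg2 n)
  have hreal : ∀ {u : ℕ → ℝ≥0∞}, Tendsto u atTop (𝓝 0) →
      Tendsto (fun n => (u n).toReal) atTop (𝓝 0) := fun hu => by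
    simpa [Function.comp_def] using (ENNReal.tendsto_toReal ENNReal.zero_ne_top).comp hu
  have hkr : Tendsto (fun n => θ ^ 2 * (eLpNorm (k n) 2 (ν.prod ν)).toReal ^ 2) atTop
      (𝓝 (θ ^ 2 * σ.toReal ^ 2)) :=
    (((ENNReal.tendsto_toReal hσ).comp hknorm).pow 2).const_mul _
  have hclt : Tendsto (fun n =>
      (∫ ω, Complex.exp ((θ * pathwiseDoubleIntegral η ν (k n) ω : ℝ) * Complex.I) ∂P) -
        Complex.exp (-(θ ^ 2 * (eLpNorm (k n) 2 (ν.prod ν)).toReal ^ 2) : ℝ)) atTop (𝓝 0) := by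
    refine tendsto_zero_of_forall_le
      (A := fun n => 1 + 6 * (θ ^ 2 * (eLpNorm (k n) 2 (ν.prod ν)).toReal ^ 2))
      (R := fun n => θ ^ 4 * (4 * (eLpNorm (starOneOne ν (k n) (k n)) 2 (ν.prod ν)).toReal ^ 2 +
        20 * (eLpNorm (starTwoOne ν (f n) (f n)) 2 ν).toReal ^ 2 +
        6 * (eLpNorm (f n) 4 (ν.prod ν)).toReal ^ 4))
      ((hkr.const_mul 6).const_add 1) ?_ (fun n => by positivity) ?_
    · have := (((((hreal hkstar).pow 2).const_mul 4).add (((hreal hfq).pow 2).const_mul 20)).add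
        (((hreal hf4).pow 4).const_mul 6)).const_mul (θ ^ 4)
      simpa using this
    -- The `L⁴` and `⋆₂¹` norms are only known to tend to zero in `ℝ≥0∞`, so the memberships
    -- required by the bound hold from some index on.
    · filter_upwards [hf4.eventually (gt_mem_nhds zero_lt_one),
        hfq.eventually (gt_mem_nhds zero_lt_one)] with n hn4 hnq c hc
      exact hη.norm_integral_cexp_cellAvg_sub_le (h𝒜 n).isCells (hfsymm n) (hf2 n)
        ⟨(hf2 n).1, hn4.trans ENNReal.one_lt_top⟩
        ⟨(measurable_starTwoOne ((hgm n).indicator hDD)).aestronglyMeasurable,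
          hnq.trans ENNReal.one_lt_top⟩ θ hc rfl
  have hexp : Tendsto (fun n =>
      ∫ ω, Complex.exp ((θ * pathwiseDoubleIntegral η ν (k n) ω : ℝ) * Complex.I) ∂P) atTop
      (𝓝 (Complex.exp (-(θ ^ 2 * σ.toReal ^ 2) : ℝ))) := by
    have h1 : Tendsto (fun n => Complex.exp
        (-(θ ^ 2 * (eLpNorm (k n) 2 (ν.prod ν)).toReal ^ 2) : ℝ)) atTop
        (𝓝 (Complex.exp (-(θ ^ 2 * σ.toReal ^ 2) : ℝ))) := by
      have hcont : Continuous fun r : ℝ => Complex.exp (-r : ℝ) := by fun_prop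
      exact (hcont.tendsto _).comp hkr
    simpa using hclt.add h1
  have hdiff : Tendsto (fun n =>
      (∫ ω in E, Complex.exp ((θ * F n ω : ℝ) * Complex.I) ∂P) -
      ∫ ω in E, Complex.exp ((θ * pathwiseDoubleIntegral η ν (k n) ω : ℝ) * Complex.I) ∂P) atTop
      (𝓝 0) := by
    have hb : ∀ n, eLpNorm (F n - pathwiseDoubleIntegral η ν (k n)) 2 P ≤
        2 * eLpNorm (g n - k n) 2 (ν.prod ν) := fun n =>
      (hF n).eLpNorm_sub_le hη (hkm n) (hkp n 1) (hkp n 2)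
    have hz : Tendsto (fun n => eLpNorm (F n - pathwiseDoubleIntegral η ν (k n)) 2 P) atTop (𝓝 0) :=
      tendsto_of_tendsto_of_tendsto_of_le_of_le tendsto_const_nhds
        (by simpa using ENNReal.Tendsto.const_mul hgk (a := 2) (Or.inr (by norm_num)))
        (fun n => zero_le) hb
    refine squeeze_zero_norm (fun n => ?_) (by simpa using (hreal hz).const_mul |θ|)
    refine norm_setIntegral_cexp_sub_le (hF n).memLp.1
      (hη.eLpNorm_pathwiseDoubleIntegral_le (hkm n) (hkp n 1) (hkp n 2)).1 E θ ?_
    exact ne_top_of_le_ne_top (ENNReal.mul_ne_top (by norm_num)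
      ((hg2 n).sub (hkp n 2)).eLpNorm_ne_top) (hb n)
  -- After the cut and the averaging, the double integral is exactly independent of `E`.
  have hmix : ∀ n, ∫ ω in E, Complex.exp ((θ * pathwiseDoubleIntegral η ν (k n) ω : ℝ) *
      Complex.I) ∂P = P.real E * ∫ ω, Complex.exp ((θ * pathwiseDoubleIntegral η ν (k n) ω : ℝ) *
      Complex.I) ∂P := fun n =>
    hη.setIntegral_cexp_stepKernel (h𝒜 n) (h𝒟𝒜 n) (hzero n) hU θ
  simp_rw [hmix] at hdiff
  simpa using hdiff.add (hexp.const_mul (P.real E : ℂ))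

end CylinderLimit

end

noncomputable section

/-! ### From cylinder events to the whole σ-algebra of the process. -/

section Mixing

/-- The events with this convergence form a Dynkin system. For disjoint unions, limit and sum are
exchanged by domination: the `i`-th term is at most `P (f i)`, uniformly in `n`. -/
lemma tendsto_setIntegral_of_isPiSystem {Ω : Type*} [mΩ : MeasurableSpace Ω] {P : Measure Ω}
    [IsProbabilityMeasure P] {S : Set (Set Ω)} (hS : IsPiSystem S) (huniv : Set.univ ∈ S)
    (hle : MeasurableSpace.generateFrom S ≤ mΩ) {u : ℕ → Ω → ℂ}
    (hu : ∀ n, AEStronglyMeasurable (u n) P) (hu1 : ∀ n ω, ‖u n ω‖ ≤ 1) {c : ℂ}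
    (h : ∀ E ∈ S, Tendsto (fun n => ∫ ω in E, u n ω ∂P) atTop (𝓝 (P.real E * c))) {E : Set Ω}
    (hE : MeasurableSet[MeasurableSpace.generateFrom S] E) :
    Tendsto (fun n => ∫ ω in E, u n ω ∂P) atTop (𝓝 (P.real E * c)) := by
  have hint : ∀ n, Integrable (u n) P := fun n =>
    Integrable.of_bound (hu n) 1 (ae_of_all _ (hu1 n))
  induction E, hE using MeasurableSpace.induction_on_inter (m := .generateFrom S) rfl hS with
  | empty => simp
  | basic E hE => exact h E hE
  | compl E hE ih =>
    have h1 : ∀ n, ∫ ω in Eᶜ, u n ω ∂P = ∫ ω in Set.univ, u n ω ∂P - ∫ ω in E, u n ω ∂P := by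
      intro n
      rw [setIntegral_compl (hle _ hE) (hint n), setIntegral_univ]
    have h2 : ((P.real Eᶜ : ℝ) : ℂ) * c = P.real Set.univ * c - P.real E * c := by
      rw [measureReal_compl (hle _ hE)]
      push_cast
      ring
    simp_rw [h1, h2]
    exact (h _ huniv).sub ih
  | iUnion f hd hf ih =>
    have h1 : ∀ n, ∫ ω in ⋃ i, f i, u n ω ∂P = ∑' i, ∫ ω in f i, u n ω ∂P := fun n =>
      (hasSum_integral_iUnion (fun i => hle _ (hf i)) hd (hint n).integrableOn).tsum_eq.symm
    have hsum : HasSum (fun i => P.real (f i)) (P.real (⋃ i, f i)) := by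
      have h2 := hasSum_integral_iUnion (f := fun _ => (1 : ℝ)) (μ := P) (fun i => hle _ (hf i)) hd
        (integrable_const _).integrableOn
      simpa using h2
    have h2 : ((P.real (⋃ i, f i) : ℝ) : ℂ) * c = ∑' i, (P.real (f i) : ℂ) * c := by
      rw [tsum_mul_right, ← hsum.tsum_eq, Complex.ofReal_tsum]
    simp_rw [h1, h2]
    refine tendsto_tsum_of_dominated_convergence hsum.summable ih (Eventually.of_forall fun n i => ?_)
    have h3 := norm_setIntegral_le_of_norm_le_const (C := 1) (measure_lt_top P (f i))
      (f := u n) (fun ω _ => hu1 n ω)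
    simpa using h3

lemma exists_simpleFunc_eLpNorm_one_sub_lt {Ω : Type*} {m : MeasurableSpace Ω}
    {Q : Measure Ω} {v : Ω → ℂ} (hv : Integrable v Q) {ε : ℝ≥0∞} (hε : ε ≠ 0) :
    ∃ s : SimpleFunc Ω ℂ, eLpNorm (v - ⇑s) 1 Q < ε := by
  obtain ⟨s, hs, -⟩ := (memLp_one_iff_integrable.2 hv).exists_simpleFunc_eLpNorm_sub_lt
    ENNReal.one_ne_top hε
  exact ⟨s, hs⟩

lemma tendsto_integral_mul_of_tendsto_setIntegral {Ω : Type*} {m : MeasurableSpace Ω}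
    [mΩ : MeasurableSpace Ω] (hle : m ≤ mΩ) {P : Measure Ω} [IsProbabilityMeasure P]
    {u : ℕ → Ω → ℂ} (hu : ∀ n, AEStronglyMeasurable (u n) P) (hu1 : ∀ n ω, ‖u n ω‖ ≤ 1) {c : ℂ}
    (hc : ‖c‖ ≤ 1)
    (h : ∀ E, MeasurableSet[m] E →
      Tendsto (fun n => ∫ ω in E, u n ω ∂P) atTop (𝓝 (P.real E * c)))
    {v : Ω → ℂ} (hv : Measurable[m] v) (hvi : Integrable v P) :
    Tendsto (fun n => ∫ ω, v ω * u n ω ∂P) atTop (𝓝 ((∫ ω, v ω ∂P) * c)) := by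
  have hint : ∀ n {v : Ω → ℂ}, Integrable v P → Integrable (fun ω => v ω * u n ω) P :=
    fun n v hv => hv.mul_bdd (hu n) (ae_of_all _ (hu1 n))
  have hsimple : ∀ s : @SimpleFunc Ω m ℂ,
      Integrable s P ∧ Tendsto (fun n => ∫ ω, s ω * u n ω ∂P) atTop (𝓝 ((∫ ω, s ω ∂P) * c)) := by
    intro s
    induction s using SimpleFunc.induction with
    | const a hs =>
      rename_i E
      have hE := hle _ hs
      have e : ∀ ω, @SimpleFunc.piecewise Ω ℂ m E hs (@SimpleFunc.const Ω ℂ m a)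
          (@SimpleFunc.const Ω ℂ m 0) ω = E.indicator (fun _ => a) ω := fun ω => by
        by_cases hω : ω ∈ E <;> simp [hω]
      have e' : ∀ n ω, E.indicator (fun _ => a) ω * u n ω = a * E.indicator (u n) ω := fun n ω => by
        by_cases hω : ω ∈ E <;> simp [hω]
      refine ⟨((integrable_const a).indicator hE).congr (ae_of_all _ fun ω => (e ω).symm), ?_⟩
      simp_rw [e, e', integral_const_mul, integral_indicator hE]
      rw [setIntegral_const, Complex.real_smul, mul_comm _ a, mul_assoc]
      exact (h E hs).const_mul a
    | add hd hf hg =>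
      rename_i f g
      refine ⟨hf.1.add hg.1, ?_⟩
      have e : ∀ n, ∫ ω, (f + g) ω * u n ω ∂P = ∫ ω, f ω * u n ω ∂P + ∫ ω, g ω * u n ω ∂P := by
        intro n
        rw [← integral_add (hint n hf.1) (hint n hg.1)]
        exact integral_congr_ae (ae_of_all _ fun ω => by simp [add_mul])
      have e2 : ∫ ω, (f + g) ω ∂P = ∫ ω, f ω ∂P + ∫ ω, g ω ∂P := by
        rw [← integral_add hf.1 hg.1]
        rfl
      simp_rw [e, e2, add_mul]
      exact hf.2.add hg.2
  have hvm : @StronglyMeasurable Ω ℂ _ m v := hv.stronglyMeasurable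
  rw [Metric.tendsto_atTop]
  intro ε hε
  obtain ⟨s, hs⟩ := exists_simpleFunc_eLpNorm_one_sub_lt (m := m) (hvi.trim hle hvm)
    (ENNReal.ofReal_pos.2 (by positivity : 0 < ε / 3)).ne'
  have hsm : @StronglyMeasurable Ω ℂ _ m s := s.stronglyMeasurable
  rw [eLpNorm_trim hle (hvm.sub hsm)] at hs
  obtain ⟨hsi, hst⟩ := hsimple s
  have hd : ∫ ω, ‖v ω - s ω‖ ∂P < ε / 3 := by
    rw [eLpNorm_one_eq_lintegral_enorm] at hs
    change ∫ ω, ‖(v - ⇑s) ω‖ ∂P < ε / 3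
    rw [integral_norm_eq_lintegral_enorm (hvi.sub hsi).1]
    exact (ENNReal.lt_ofReal_iff_toReal_lt (ne_top_of_lt hs)).1 hs
  have hd1 : ∀ n, ‖∫ ω, v ω * u n ω ∂P - ∫ ω, s ω * u n ω ∂P‖ < ε / 3 := by
    intro n
    rw [← integral_sub (hint n hvi) (hint n hsi)]
    refine (norm_integral_le_of_norm_le (hvi.sub hsi).norm (ae_of_all _ fun ω => ?_)).trans_lt hd
    rw [← sub_mul, norm_mul]
    exact mul_le_of_le_one_right (norm_nonneg _) (hu1 n ω)
  have hd2 : ‖(∫ ω, v ω ∂P) * c - (∫ ω, s ω ∂P) * c‖ < ε / 3 := by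
    rw [← sub_mul, norm_mul, ← integral_sub hvi hsi]
    refine (mul_le_of_le_one_right (norm_nonneg _) hc).trans_lt ?_
    exact (norm_integral_le_integral_norm _).trans_lt hd
  obtain ⟨n0, hn0⟩ := Metric.tendsto_atTop.1 hst (ε / 3) (by positivity)
  refine ⟨n0, fun n hn => ?_⟩
  have h3 := hn0 n hn
  rw [dist_eq_norm] at h3 ⊢
  have h4 := hd1 n
  calc _ = ‖(∫ ω, v ω * u n ω ∂P - ∫ ω, s ω * u n ω ∂P) +
        (∫ ω, s ω * u n ω ∂P - (∫ ω, s ω ∂P) * c) -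
        ((∫ ω, v ω ∂P) * c - (∫ ω, s ω ∂P) * c)‖ := by congr 1; ring
    _ ≤ ‖∫ ω, v ω * u n ω ∂P - ∫ ω, s ω * u n ω ∂P‖ + ‖∫ ω, s ω * u n ω ∂P - (∫ ω, s ω ∂P) * c‖ +
        ‖(∫ ω, v ω ∂P) * c - (∫ ω, s ω ∂P) * c‖ :=
        (norm_sub_le _ _).trans (add_le_add (norm_add_le _ _) le_rfl)
    _ < ε := by linarith

/-- The events that depend on the numbers of points in finitely many sets of finite measure. -/
def cylinderEvents {Ω Z : Type*} [MeasurableSpace Z] (η : Ω → Measure Z) (ν : Measure Z) :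
    Set (Set Ω) :=
  {E | ∃ (𝒟 : Finset (Set Z)) (U : Set Z → Set ℝ≥0∞), IsFiniteFamily ν 𝒟 ∧
    (∀ A, MeasurableSet (U A)) ∧ E = {ω | ∀ A ∈ 𝒟, η ω A ∈ U A}}

variable {Ω Z : Type*} [MeasurableSpace Z] {ν : Measure Z} {η : Ω → Measure Z}

lemma isPiSystem_cylinderEvents : IsPiSystem (cylinderEvents η ν) := by
  classical
  rintro _ ⟨𝒟, U, h𝒟, hU, rfl⟩ _ ⟨𝒟', U', h𝒟', hU', rfl⟩ -
  refine ⟨𝒟 ∪ 𝒟', fun A => (if A ∈ 𝒟 then U A else Set.univ) ∩ (if A ∈ 𝒟' then U' A else Set.univ),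
    fun A hA => (Finset.mem_union.1 hA).elim (h𝒟 A) (h𝒟' A), fun A => ?_, ?_⟩
  · refine MeasurableSet.inter ?_ ?_ <;> split_ifs
    exacts [hU A, MeasurableSet.univ, hU' A, MeasurableSet.univ]
  · ext ω
    simp only [Set.mem_inter_iff, Set.mem_ofPred_eq, Finset.mem_union]
    constructor
    · rintro ⟨h1, h2⟩ A -
      constructor <;> split_ifs with hA
      exacts [h1 A hA, Set.mem_univ _, h2 A hA, Set.mem_univ _]
    · intro h
      refine ⟨fun A hA => ?_, fun A hA => ?_⟩
      · simpa [hA] using (h A (Or.inl hA)).1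
      · simpa [hA] using (h A (Or.inr hA)).2

lemma univ_mem_cylinderEvents : Set.univ ∈ cylinderEvents η ν :=
  ⟨∅, fun _ => Set.univ, by simp [IsFiniteFamily], fun _ => MeasurableSet.univ, by simp⟩

/-- Cylinder events use only sets of finite intensity; the count of any other set is a supremum over
its intersections with an exhaustion. -/
lemma generateFrom_cylinderEvents [SigmaFinite ν] :
    MeasurableSpace.generateFrom (cylinderEvents η ν) = sigmaAlgebraOf η := by
  refine le_antisymm (MeasurableSpace.generateFrom_le ?_) ?_
  · rintro _ ⟨𝒟, U, h𝒟, hU, rfl⟩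
    refine ⟨{m | ∀ A ∈ 𝒟, m A ∈ U A}, ?_, rfl⟩
    have : {m : Measure Z | ∀ A ∈ 𝒟, m A ∈ U A} = ⋂ A ∈ 𝒟, (fun m : Measure Z => m A) ⁻¹' U A := by
      ext m
      simp
    rw [this]
    exact Finset.measurableSet_biInter _ fun A hA => Measure.measurable_coe (h𝒟 A hA).1 (hU A)
  · rw [← measurable_iff_comap_le]
    refine @Measure.measurable_of_measurable_coe Z Ω _
      (MeasurableSpace.generateFrom (cylinderEvents η ν)) η fun s hs => ?_
    have hfin : ∀ A, MeasurableSet A → ν A < ∞ →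
        Measurable[MeasurableSpace.generateFrom (cylinderEvents η ν)] fun ω => η ω A := by
      intro A hA hAf U hU
      refine MeasurableSpace.measurableSet_generateFrom ⟨{A}, fun _ => U, ?_, fun _ => hU, ?_⟩
      · intro B hB
        rw [Finset.mem_singleton.1 hB]
        exact ⟨hA, hAf⟩
      · ext ω
        simp
    have e : ∀ ω, η ω s = ⨆ k, η ω (s ∩ spanningSets ν k) := by
      intro ω
      rw [← Monotone.measure_iUnion, ← Set.inter_iUnion, iUnion_spanningSets, Set.inter_univ]
      exact fun i j hij => Set.inter_subset_inter_right _ (monotone_spanningSets ν hij)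
    simp_rw [e]
    refine Measurable.iSup fun k => hfin _ (hs.inter (measurableSet_spanningSets ν k)) ?_
    exact (measure_mono Set.inter_subset_right).trans_lt (measure_spanningSets_lt_top ν k)

end Mixing

/-! ### Joint convergence in law from characteristic functions. -/

section StableConvergence

lemma charFun_map_toLp_prodMk {Ω : Type*} [MeasurableSpace Ω] {P : Measure Ω} {X Y : Ω → ℝ}
    (hX : AEMeasurable X P) (hY : AEMeasurable Y P) (t : WithLp 2 (ℝ × ℝ)) :
    charFun (P.map fun ω => WithLp.toLp 2 (X ω, Y ω)) t =
      ∫ ω, Complex.exp ((t.snd * Y ω : ℝ) * Complex.I) *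
        Complex.exp ((t.fst * X ω : ℝ) * Complex.I) ∂P := by
  rw [charFun_apply, integral_map]
  · refine integral_congr_ae (ae_of_all _ fun ω => ?_)
    simp only [← Complex.exp_add, WithLp.prod_inner_apply]
    congr 1
    simp
    ring
  · exact (WithLp.measurable_toLp 2 _).comp_aemeasurable (hX.prodMk hY)
  · exact Measurable.aestronglyMeasurable (by fun_prop)

/-- Lévy's continuity theorem needs an inner product, so it is applied on `WithLp 2 (ℝ × ℝ)` and
transported back by a continuous map. -/
lemma tendstoInDistribution_prodMk_of_tendsto_charFun {Ω : Type*} [MeasurableSpace Ω]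
    {P : Measure Ω} [IsProbabilityMeasure P] {X : ℕ → Ω → ℝ} {X' Y : Ω → ℝ}
    (hX : ∀ n, AEMeasurable (X n) P) (hX' : AEMeasurable X' P) (hY : AEMeasurable Y P)
    (h : ∀ θ μ : ℝ, Tendsto (fun n => ∫ ω, Complex.exp ((μ * Y ω : ℝ) * Complex.I) *
        Complex.exp ((θ * X n ω : ℝ) * Complex.I) ∂P) atTop
      (𝓝 (∫ ω, Complex.exp ((μ * Y ω : ℝ) * Complex.I) *
        Complex.exp ((θ * X' ω : ℝ) * Complex.I) ∂P))) :
    TendstoInDistribution (fun n ω => (X n ω, Y ω)) atTop (fun ω => (X' ω, Y ω)) (fun _ => P) P := by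
  have hm : ∀ {X : Ω → ℝ}, AEMeasurable X P →
      AEMeasurable (fun ω => WithLp.toLp 2 (X ω, Y ω)) P := fun hX =>
    (WithLp.measurable_toLp 2 _).comp_aemeasurable (hX.prodMk hY)
  have hlp : TendstoInDistribution (fun n ω => WithLp.toLp 2 (X n ω, Y ω)) atTop
      (fun ω => WithLp.toLp 2 (X' ω, Y ω)) (fun _ => P) P :=
    { forall_aemeasurable := fun n => hm (hX n)
      aemeasurable_limit := hm hX'
      tendsto := by
        refine ProbabilityMeasure.tendsto_iff_tendsto_charFun.2 fun t => ?_
        simp only [ProbabilityMeasure.coe_mk]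
        rw [charFun_map_toLp_prodMk hX' hY]
        simp_rw [charFun_map_toLp_prodMk (hX _) hY]
        exact h _ _ }
  exact hlp.continuous_comp (g := fun p : WithLp 2 (ℝ × ℝ) => p.ofLp) (WithLp.prod_continuous_ofLp 2 ℝ ℝ)

end StableConvergence

end

noncomputable section

/-! ### Independence of the choice of kernel representatives. -/

section Versions

variable {Z : Type*} [MeasurableSpace Z] {ν : Measure Z} [SFinite ν] {f g f' g' : Z × Z → ℝ}

/-- Contractions integrate along fibres, so equality almost everywhere for `ν²` is needed in the
form: almost everywhere on almost every fibre. -/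
lemma ae_ae_eq_left (hf : f =ᵐ[ν.prod ν] f') : ∀ᵐ x ∂ν, ∀ᵐ y ∂ν, f (y, x) = f' (y, x) :=
  Measure.ae_ae_of_ae_prod (Measure.measurePreserving_swap.quasiMeasurePreserving.ae hf)

lemma symmetrization_congr (hf : f =ᵐ[ν.prod ν] f') :
    symmetrization f =ᵐ[ν.prod ν] symmetrization f' := by
  filter_upwards [hf, Measure.measurePreserving_swap.quasiMeasurePreserving.ae hf] with p h1 h2
  rw [symmetrization, symmetrization, h1, h2]

lemma starOneOne_congr (hf : f =ᵐ[ν.prod ν] f') (hg : g =ᵐ[ν.prod ν] g') :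
    starOneOne ν f g =ᵐ[ν.prod ν] starOneOne ν f' g' := by
  filter_upwards [Measure.quasiMeasurePreserving_fst.ae (ae_ae_eq_left hf),
    Measure.quasiMeasurePreserving_snd.ae (ae_ae_eq_left hg)] with p h1 h2
  refine integral_congr_ae ?_
  filter_upwards [h1, h2] with y hy1 hy2
  rw [hy1, hy2]

lemma starTwoOne_congr (hf : f =ᵐ[ν.prod ν] f') : starTwoOne ν f f =ᵐ[ν] starTwoOne ν f' f' := by
  filter_upwards [ae_ae_eq_left hf] with x hx
  refine integral_congr_ae ?_
  filter_upwards [hx] with y hy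
  rw [hy]

lemma starOneOneVec_congr (hf : f =ᵐ[ν.prod ν] f') (h : Z → ℝ) :
    starOneOneVec ν f h =ᵐ[ν] starOneOneVec ν f' h := by
  filter_upwards [ae_ae_eq_left hf] with x hx
  refine integral_congr_ae ?_
  filter_upwards [hx] with y hy
  rw [hy]

lemma IsDoublePoissonIntegral.congr_kernel {Ω : Type*} [MeasurableSpace Ω] {P : Measure Ω}
    {η : Ω → Measure Z} {X : Ω → ℝ} (hX : IsDoublePoissonIntegral η ν P f X)
    (hf : f =ᵐ[ν.prod ν] f') : IsDoublePoissonIntegral η ν P f' X where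
  memLp_kernel := hX.memLp_kernel.ae_eq hf
  memLp := hX.memLp
  exists_approx := by
    obtain ⟨φ, h1, h2, h3⟩ := hX.exists_approx
    refine ⟨φ, h1, h2.congr fun k => eLpNorm_congr_ae ?_, h3⟩
    exact (EventuallyEq.refl _ (φ k)).sub hf

/-- The antisymmetric part of `g` is orthogonal to its symmetrization. This identifies `g0` as the
limit of the squared norms of the symmetric kernels. -/
lemma integral_symmetrization_mul (hg2 : MemLp g 2 (ν.prod ν)) :
    ∫ p, symmetrization g p * g p ∂(ν.prod ν) =
      (eLpNorm (symmetrization g) 2 (ν.prod ν)).toReal ^ 2 := by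
  have hs2 : MemLp (symmetrization g) 2 (ν.prod ν) := memLp_symmetrization hg2
  have hsw : MemLp (fun p => g p.swap) 2 (ν.prod ν) :=
    hg2.comp_measurePreserving Measure.measurePreserving_swap
  have h1 : Integrable (fun p => symmetrization g p * g p) (ν.prod ν) := hs2.integrable_mul hg2
  have h2 : Integrable (fun p => symmetrization g p * g p.swap) (ν.prod ν) := hs2.integrable_mul hsw
  have h3 : ∫ p, symmetrization g p * g p.swap ∂(ν.prod ν) =
      ∫ p, symmetrization g p * g p ∂(ν.prod ν) := by
    rw [← integral_prod_swap]
    refine integral_congr_ae (ae_of_all _ fun p => ?_)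
    obtain ⟨x, y⟩ := p
    simp only [Prod.swap]
    rw [symmetrization_apply_swap g y x]
  have h4 : ∫ p, symmetrization g p ^ 2 ∂(ν.prod ν) =
      (eLpNorm (symmetrization g) 2 (ν.prod ν)).toReal ^ 2 :=
    integral_pow_eq_eLpNorm_pow even_two two_ne_zero (by exact_mod_cast hs2)
  have h5 : ∫ p, symmetrization g p ^ 2 ∂(ν.prod ν) =
      ∫ p, (1 / 2 : ℝ) * (symmetrization g p * g p + symmetrization g p * g p.swap) ∂(ν.prod ν) := by
    refine integral_congr_ae (ae_of_all _ fun p => ?_)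
    simp only [symmetrization]
    ring
  rw [integral_const_mul, integral_add h1 h2, h3] at h5
  linarith

end Versions

/-! ### Vanishing of the limiting kernel. -/

section LimitKernel

variable {Z : Type*} [MeasurableSpace Z] {ν : Measure Z} [SigmaFinite ν]

/-- The limit of the contractions vanishes when the kernels lose their local mass. -/
lemma ae_eq_zero_of_tendsto_starOneOne {g : ℕ → Z × Z → ℝ} {g2 : Z × Z → ℝ}
    (hgm : ∀ n, Measurable (g n)) (hg : ∀ n, MemLp (g n) 2 (ν.prod ν))
    (hg2 : MemLp g2 2 (ν.prod ν))
    (hstar : Tendsto (fun n => eLpNorm (starOneOne ν (symmetrization (g n)) (g n) - g2) 2 (ν.prod ν))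
      atTop (𝓝 0))
    (hq : Tendsto (fun n => eLpNorm (starTwoOne ν (symmetrization (g n)) (symmetrization (g n))) 2 ν)
      atTop (𝓝 0))
    (hvec : ∀ h : Z → ℝ, MemLp h 2 ν →
      Tendsto (fun n => eLpNorm (starOneOneVec ν (g n) h) 2 ν) atTop (𝓝 0)) :
    g2 =ᵐ[ν.prod ν] 0 := by
  have hsm : ∀ n, Measurable (symmetrization (g n)) := fun n => measurable_symmetrization (hgm n)
  have hs2 : ∀ n, MemLp (symmetrization (g n)) 2 (ν.prod ν) := fun n => memLp_symmetrization (hg n)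
  have hA : ∀ {C : Set Z}, MeasurableSet C → ν C < ∞ → Tendsto (fun n =>
      eLpNorm (starOneOneVec ν (symmetrization (g n)) (C.indicator fun _ => 1)) 2 ν) atTop
      (𝓝 0) := by
    intro C hC hCf
    have h0 : Tendsto (fun n =>
        eLpNorm (starTwoOne ν (symmetrization (g n)) (symmetrization (g n))) 2 ν ^ 2 * ν C ^ 3)
        atTop (𝓝 0) := by
      have h := ENNReal.Tendsto.mul_const (ENNReal.Tendsto.pow (n := 2) hq)
        (Or.inr (ENNReal.pow_ne_top hCf.ne (n := 3)))
      simpa using h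
    have h1 : Tendsto (fun n =>
        eLpNorm (starOneOneVec ν (symmetrization (g n)) (C.indicator fun _ => 1)) 2 ν ^ 4) atTop
        (𝓝 0) :=
      tendsto_of_tendsto_of_tendsto_of_le_of_le tendsto_const_nhds h0 (fun n => zero_le)
        fun n => eLpNorm_starOneOneVec_indicator_le (hsm n) (hs2 n)
          (symmetrization_apply_swap (g n)) hC
    have h2 := ((ENNReal.continuous_rpow_const (y := (1 / 4 : ℝ))).tendsto 0).comp h1
    rw [ENNReal.zero_rpow_of_pos (by norm_num)] at h2
    refine h2.congr fun n => ?_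
    simp only [Function.comp_apply]
    rw [← ENNReal.rpow_natCast, ← ENNReal.rpow_mul]
    norm_num
  refine ae_eq_zero_of_setIntegral_prod_eq_zero hg2 fun D C hD hDf hC hCf => ?_
  have hE : MeasurableSet (D ×ˢ C) := hD.prod hC
  have hEf : (ν.prod ν) (D ×ˢ C) ≠ ∞ := by
    rw [Measure.prod_prod]
    exact ENNReal.mul_ne_top hDf.ne hCf.ne
  have hone : MemLp ((D ×ˢ C).indicator fun _ => (1 : ℝ)) 2 (ν.prod ν) :=
    memLp_indicator_const 2 hE 1 (Or.inr hEf)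
  have hset : ∀ u : Z × Z → ℝ, ∫ p in D ×ˢ C, u p ∂(ν.prod ν) =
      ∫ p, u p * (D ×ˢ C).indicator (fun _ => (1 : ℝ)) p ∂(ν.prod ν) := by
    intro u
    rw [← integral_indicator hE]
    refine integral_congr_ae (ae_of_all _ fun p => ?_)
    by_cases hp : p ∈ D ×ˢ C
    · simp only [Set.indicator_of_mem hp, mul_one]
    · simp only [Set.indicator_of_notMem hp, mul_zero]
  have hst2 : ∀ n, MemLp (starOneOne ν (symmetrization (g n)) (g n)) 2 (ν.prod ν) := fun n =>
    memLp_starOneOne (hsm n) (hgm n) (hs2 n) (hg n)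
  -- The left side does not depend on `n`. On the right, the pairing of the contraction with the
  -- rectangle and the distance of the contraction to `g2` both tend to zero.
  have hbound : ∀ n, ‖∫ p in D ×ˢ C, g2 p ∂(ν.prod ν)‖ₑ ≤
      eLpNorm (starOneOneVec ν (symmetrization (g n)) (D.indicator fun _ => 1)) 2 ν *
        (2 * eLpNorm (starOneOneVec ν (symmetrization (g n)) (C.indicator fun _ => 1)) 2 ν +
          eLpNorm (starOneOneVec ν (g n) (C.indicator fun _ => 1)) 2 ν) +
      eLpNorm (starOneOne ν (symmetrization (g n)) (g n) - g2) 2 (ν.prod ν) *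
        eLpNorm ((D ×ˢ C).indicator fun _ => (1 : ℝ)) 2 (ν.prod ν) := by
    intro n
    have h1 : Integrable (fun p => starOneOne ν (symmetrization (g n)) (g n) p *
        (D ×ˢ C).indicator (fun _ => (1 : ℝ)) p) (ν.prod ν) := (hst2 n).integrable_mul hone
    have h2 : Integrable (fun p => (starOneOne ν (symmetrization (g n)) (g n) - g2) p *
        (D ×ˢ C).indicator (fun _ => (1 : ℝ)) p) (ν.prod ν) :=
      ((hst2 n).sub hg2).integrable_mul hone
    have h3 : ∫ p in D ×ˢ C, g2 p ∂(ν.prod ν) =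
        ∫ p in D ×ˢ C, starOneOne ν (symmetrization (g n)) (g n) p ∂(ν.prod ν) -
        ∫ p, (starOneOne ν (symmetrization (g n)) (g n) - g2) p *
          (D ×ˢ C).indicator (fun _ => (1 : ℝ)) p ∂(ν.prod ν) := by
      rw [hset, hset, ← integral_sub h1 h2]
      refine integral_congr_ae (ae_of_all _ fun p => ?_)
      simp only [Pi.sub_apply]
      ring
    rw [h3]
    refine enorm_sub_le.trans (add_le_add ?_ ?_)
    · exact enorm_setIntegral_starOneOne_symmetrization_le (hgm n) (hg n) hC hCf hD hDf
    · exact enorm_integral_mul_le _ ((hst2 n).sub hg2).1 hone.1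
  have hlim : Tendsto (fun n =>
      eLpNorm (starOneOneVec ν (symmetrization (g n)) (D.indicator fun _ => 1)) 2 ν *
        (2 * eLpNorm (starOneOneVec ν (symmetrization (g n)) (C.indicator fun _ => 1)) 2 ν +
          eLpNorm (starOneOneVec ν (g n) (C.indicator fun _ => 1)) 2 ν) +
      eLpNorm (starOneOne ν (symmetrization (g n)) (g n) - g2) 2 (ν.prod ν) *
        eLpNorm ((D ×ˢ C).indicator fun _ => (1 : ℝ)) 2 (ν.prod ν)) atTop (𝓝 0) := by
    have hC2 : MemLp (C.indicator fun _ => (1 : ℝ)) 2 ν :=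
      memLp_indicator_const 2 hC 1 (Or.inr hCf.ne)
    have h1 := (ENNReal.Tendsto.const_mul (hA hC hCf) (a := 2) (Or.inr (by norm_num))).add
      (hvec _ hC2)
    rw [mul_zero, add_zero] at h1
    have h2 := ENNReal.Tendsto.mul (hA hD hDf) (Or.inr ENNReal.zero_ne_top) h1
      (Or.inr ENNReal.zero_ne_top)
    have h3 := ENNReal.Tendsto.mul_const hstar (b := eLpNorm
      ((D ×ˢ C).indicator fun _ => (1 : ℝ)) 2 (ν.prod ν)) (Or.inr hone.eLpNorm_ne_top)
    simpa using h2.add h3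
  have := ge_of_tendsto' hlim hbound
  simpa using this

end LimitKernel

/-! ### The stable limit theorem with constant variance. -/

section StableLimit

variable {Ω Z : Type*} [MeasurableSpace Ω] [MeasurableSpace Z] {P : Measure Ω}
  [IsProbabilityMeasure P] {ν : Measure Z} [SigmaFinite ν] {η : Ω → Measure Z}

/-- The stable central limit theorem for double integrals whose kernels lose their local mass. -/
lemma IsPoissonPointProcess.stablyConverges_const_mul (hη : IsPoissonPointProcess η ν P)
    {N : Ω → ℝ} (hN : Measurable N) (hN_law : P.map N = gaussianReal 0 1)
    (hN_indep : IndepFun N η P)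
    {g : ℕ → Z × Z → ℝ} {F : ℕ → Ω → ℝ} (hgm : ∀ n, Measurable (g n))
    (hsymm : ∀ n x y, g n (x, y) = g n (y, x)) (hg2 : ∀ n, MemLp (g n) 2 (ν.prod ν))
    (hF : ∀ n, IsDoublePoissonIntegral η ν P (g n) (F n)) {σ : ℝ≥0∞} (hσ : σ ≠ ∞)
    (hnorm : Tendsto (fun n => eLpNorm (g n) 2 (ν.prod ν)) atTop (𝓝 σ))
    (hstar : Tendsto (fun n => eLpNorm (starOneOne ν (g n) (g n)) 2 (ν.prod ν)) atTop (𝓝 0))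
    (h4 : Tendsto (fun n => eLpNorm (g n) 4 (ν.prod ν)) atTop (𝓝 0))
    (hq : Tendsto (fun n => eLpNorm (starTwoOne ν (g n) (g n)) 2 ν) atTop (𝓝 0)) :
    StablyConverges (sigmaAlgebraOf η) P F (fun ω => √2 * σ.toReal * N ω) := by
  intro Y hY _
  have hle : sigmaAlgebraOf η ≤ ‹MeasurableSpace Ω› := hη.measurable.comap_le
  have hYm : Measurable Y := hY.mono hle le_rfl
  have hFm : ∀ n, AEStronglyMeasurable (F n) P := fun n => (hF n).memLp.1
  refine tendstoInDistribution_prodMk_of_tendsto_charFun (fun n => (hFm n).aemeasurable)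
    (by fun_prop) hYm.aemeasurable fun θ μ => ?_
  have hu : ∀ n, AEStronglyMeasurable (fun ω => Complex.exp ((θ * F n ω : ℝ) * Complex.I)) P := by
    intro n
    have : Continuous fun r : ℝ => Complex.exp ((θ * r : ℝ) * Complex.I) := by fun_prop
    exact this.comp_aestronglyMeasurable (hFm n)
  have hu1 : ∀ (X : Ω → ℝ) ω, ‖Complex.exp ((X ω : ℝ) * Complex.I)‖ ≤ 1 := fun X ω => by
    rw [Complex.norm_exp_ofReal_mul_I]
  set c : ℂ := Complex.exp (-(θ ^ 2 * σ.toReal ^ 2) : ℝ) with hc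
  have hc1 : ‖c‖ ≤ 1 := by
    rw [hc, Complex.norm_exp_ofReal, Real.exp_le_one_iff]
    have : 0 ≤ θ ^ 2 * σ.toReal ^ 2 := by positivity
    linarith
  have hset : ∀ E, MeasurableSet[sigmaAlgebraOf η] E → Tendsto (fun n =>
      ∫ ω in E, Complex.exp ((θ * F n ω : ℝ) * Complex.I) ∂P) atTop (𝓝 (P.real E * c)) := by
    intro E hE
    rw [← generateFrom_cylinderEvents (ν := ν)] at hE
    refine tendsto_setIntegral_of_isPiSystem isPiSystem_cylinderEvents univ_mem_cylinderEvents
      (generateFrom_cylinderEvents.trans_le hle) hu (fun n => hu1 fun ω => θ * F n ω) ?_ hE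
    rintro _ ⟨𝒟, U, h𝒟, hU, rfl⟩
    exact hη.tendsto_setIntegral_cexp_cylinder hgm hsymm hg2 hF hσ hnorm hstar h4 hq h𝒟 hU θ
  have hcont : Continuous fun r : ℝ => Complex.exp ((μ * r : ℝ) * Complex.I) := by fun_prop
  have hv : Measurable[sigmaAlgebraOf η] fun ω => Complex.exp ((μ * Y ω : ℝ) * Complex.I) :=
    hcont.measurable.comp hY
  have hvi : Integrable (fun ω => Complex.exp ((μ * Y ω : ℝ) * Complex.I)) P :=
    Integrable.of_bound (hv.mono hle le_rfl).aestronglyMeasurable 1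
      (ae_of_all _ (hu1 fun ω => μ * Y ω))
  have hlim := tendsto_integral_mul_of_tendsto_setIntegral hle hu
    (fun n => hu1 fun ω => θ * F n ω) hc1 hset hv hvi
  have hind : IndepFun Y N P := by
    rw [IndepFun_iff_Indep] at hN_indep ⊢
    exact (indep_of_indep_of_le_right hN_indep hY.comap_le).symm
  -- The variance `2 * σ ^ 2` matches the isometry `E I₂(g)² = 2 ‖g‖²`, so the Gaussian
  -- characteristic function is `exp (-θ² σ²)`, with no factor one half left.
  have hN1 : ∫ ω, Complex.exp ((θ * (√2 * σ.toReal * N ω) : ℝ) * Complex.I) ∂P = c := by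
    have h1 := charFun_gaussianReal (μ := 0) (v := 1) (θ * (√2 * σ.toReal))
    rw [← hN_law, charFun_apply_real, integral_map hN.aemeasurable
      (Measurable.aestronglyMeasurable (by fun_prop))] at h1
    rw [hc]
    refine Eq.trans (integral_congr_ae (ae_of_all _ fun ω => ?_)) (h1.trans ?_)
    · simp only
      congr 1
      push_cast
      ring
    · congr 1
      have : ((√2 : ℝ) : ℂ) ^ 2 = 2 := by
        rw [← Complex.ofReal_pow, Real.sq_sqrt (by norm_num)]
        norm_num
      push_cast
      rw [mul_pow, mul_pow, this]
      ring
  -- Independence of `N` and `Y` puts the limiting characteristic function into the product form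
  -- obtained for the sequence.
  have hprod := hind.integral_fun_comp_mul_comp (f := fun r : ℝ => Complex.exp ((μ * r : ℝ) * Complex.I))
    (g := fun r : ℝ => Complex.exp ((θ * (√2 * σ.toReal * r) : ℝ) * Complex.I))
    hYm.aemeasurable hN.aemeasurable (Measurable.aestronglyMeasurable (by fun_prop))
    (Measurable.aestronglyMeasurable (by fun_prop))
  rw [hN1] at hprod
  rw [hprod]
  exact hlim

end StableLimit

end

/-! ### Assembly of the theorem. -/

theorem mainTheorem8 {Ω Z : Type*} [MeasurableSpace Ω] [MeasurableSpace Z]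
    (P : Measure Ω) [IsProbabilityMeasure P]
    (ν : Measure Z) [SigmaFinite ν]
    (η : Ω → Measure Z) (hη : IsPoissonPointProcess η ν P)
    -- a standard Gaussian random variable independent of the point process
    (N : Ω → ℝ) (hN : Measurable N) (hN_law : P.map N = gaussianReal 0 1)
    (hN_indep : IndepFun N η P)
    -- the kernels and the double integrals
    (g ghat : ℕ → Z × Z → ℝ) (F : ℕ → Ω → ℝ)
    (hg : ∀ n, MemLp (g n) 2 (ν.prod ν))
    (hg_symm : ∀ n, symmetrization (g n) =ᵐ[ν.prod ν] g n)
    (hghat : ∀ n, MemLp (ghat n) 2 (ν.prod ν))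
    (hghat_symm : ∀ n, symmetrization (ghat n) =ᵐ[ν.prod ν] g n)
    (hF : ∀ n, IsDoublePoissonIntegral η ν P (g n) (F n))
    -- the limiting kernel and its double integral
    (g2 : Z × Z → ℝ) (g0 : ℝ) (J : Ω → ℝ)
    (hg2 : MemLp g2 2 (ν.prod ν))
    (hJ : IsDoublePoissonIntegral η ν P g2 J)
    -- the analytic conditions
    (hKS2 : Tendsto (fun n => eLpNorm (starOneOne ν (g n) (ghat n) - g2) 2 (ν.prod ν))
      atTop (𝓝 0))
    (hKS0 : Tendsto (fun n => ∫ p, g n p * ghat n p ∂(ν.prod ν)) atTop (𝓝 g0))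
    (hKR4 : Tendsto (fun n => eLpNorm (g n) 4 (ν.prod ν)) atTop (𝓝 0))
    (hKRstar : Tendsto (fun n => eLpNorm (starTwoOne ν (g n) (g n)) 2 ν) atTop (𝓝 0))
    (hKW : ∀ h : Z → ℝ, MemLp h 2 ν →
      Tendsto (fun n => eLpNorm (starOneOneVec ν (ghat n) h) 2 ν) atTop (𝓝 0))
    -- the asymptotic variance is non-negative
    (hS : ∀ᵐ ω ∂P, 0 ≤ 2 * (J ω + g0)) :
    StablyConverges (sigmaAlgebraOf η) P F (fun ω => √(2 * (J ω + g0)) * N ω) := by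
  -- With measurable versions of the `ghat n`, their symmetrizations are symmetric at every point
  -- and stand in for the `g n`.
  set γ : ℕ → Z × Z → ℝ := fun n => (hghat n).1.mk (ghat n) with hγ
  have hγm : ∀ n, Measurable (γ n) := fun n => (hghat n).1.stronglyMeasurable_mk.measurable
  have hγe : ∀ n, ghat n =ᵐ[ν.prod ν] γ n := fun n => (hghat n).1.ae_eq_mk
  have hγ2 : ∀ n, MemLp (γ n) 2 (ν.prod ν) := fun n => (hghat n).ae_eq (hγe n)
  have hGe : ∀ n, g n =ᵐ[ν.prod ν] symmetrization (γ n) := fun n =>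
    (hghat_symm n).symm.trans (symmetrization_congr (hγe n))
  have hG2 : ∀ n, MemLp (symmetrization (γ n)) 2 (ν.prod ν) := fun n => (hg n).ae_eq (hGe n)
  have hGF : ∀ n, IsDoublePoissonIntegral η ν P (symmetrization (γ n)) (F n) := fun n =>
    (hF n).congr_kernel (hGe n)
  have hstar : Tendsto (fun n =>
      eLpNorm (starOneOne ν (symmetrization (γ n)) (γ n) - g2) 2 (ν.prod ν)) atTop (𝓝 0) :=
    hKS2.congr fun n => eLpNorm_congr_ae
      ((starOneOne_congr (hGe n) (hγe n)).sub (EventuallyEq.refl _ g2))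
  have hq : Tendsto (fun n =>
      eLpNorm (starTwoOne ν (symmetrization (γ n)) (symmetrization (γ n))) 2 ν) atTop (𝓝 0) :=
    hKRstar.congr fun n => eLpNorm_congr_ae (starTwoOne_congr (hGe n))
  have h4 : Tendsto (fun n => eLpNorm (symmetrization (γ n)) 4 (ν.prod ν)) atTop (𝓝 0) :=
    hKR4.congr fun n => eLpNorm_congr_ae (hGe n)
  have hg2z : g2 =ᵐ[ν.prod ν] 0 := ae_eq_zero_of_tendsto_starOneOne hγm hγ2 hg2 hstar hq
    fun h hh => (hKW h hh).congr fun n => eLpNorm_congr_ae (starOneOneVec_congr (hγe n) h)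
  -- Once `g2` vanishes, the contractions with `ghat n` tend to zero, and those of the symmetric
  -- kernels with themselves are smaller in norm.
  have hstar0 : Tendsto (fun n =>
      eLpNorm (starOneOne ν (symmetrization (γ n)) (symmetrization (γ n))) 2 (ν.prod ν)) atTop
      (𝓝 0) := by
    refine tendsto_of_tendsto_of_tendsto_of_le_of_le tendsto_const_nhds hstar (fun n => zero_le)
      fun n => (eLpNorm_starOneOne_symmetrization_le (hγm n) (hγ2 n)).trans_eq
        (eLpNorm_congr_ae ?_)
    filter_upwards [hg2z] with p hp
    simp [hp]
  have hsq : Tendsto (fun n => (eLpNorm (symmetrization (γ n)) 2 (ν.prod ν)).toReal ^ 2) atTop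
      (𝓝 g0) := by
    refine hKS0.congr fun n => ?_
    rw [← integral_symmetrization_mul (hγ2 n)]
    refine integral_congr_ae ?_
    filter_upwards [hGe n, hγe n] with p h1 h2
    rw [h1, h2]
  have hg0 : 0 ≤ g0 := ge_of_tendsto' hsq fun n => sq_nonneg _
  have hnorm : Tendsto (fun n => eLpNorm (symmetrization (γ n)) 2 (ν.prod ν)) atTop
      (𝓝 (ENNReal.ofReal √g0)) := by
    refine ((ENNReal.continuous_ofReal.tendsto _).comp hsq.sqrt).congr fun n => ?_
    simp only [Function.comp_apply]
    rw [Real.sqrt_sq ENNReal.toReal_nonneg, ENNReal.ofReal_toReal (hG2 n).eLpNorm_ne_top]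
  have hlim := hη.stablyConverges_const_mul hN hN_law hN_indep
    (fun n => measurable_symmetrization (hγm n)) (fun n => symmetrization_apply_swap (γ n)) hG2 hGF
    ENNReal.ofReal_ne_top hnorm hstar0 h4 hq
  intro Y hY hYb
  refine (hlim Y hY hYb).congr (fun n => EventuallyEq.refl _ _) ?_
  -- `J` is almost surely zero, so the random factor in the limit is the constant `√2 * √g0`.
  filter_upwards [hJ.ae_eq_zero hη hg2z] with ω hω
  rw [hω, Pi.zero_apply, zero_add, Real.sqrt_mul (by norm_num),
    ENNReal.toReal_ofReal (Real.sqrt_nonneg _)]
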